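/- **Setting.** An instance consists of a ground set $X$ of $n$ elements, a universe $U$ of $m$ points with weights $w : U \to \mathbb{R}_{\ge 0}$, for each $e\in X$ the set $P(e)\subseteq U$ of points that $e$ covers, and an $\ell$-matchoid $\mathcal{M}=\{M_i=(X_i,\mathcal{I}_i)\}_{i=1}^s$, that is, matroids on subsets $X_i\subseteq X$ such that every $e \in X$ lies in at most $\ell$ of the $X_i$. No $M_i$ has loops. A set $S\subseteq X$ is feasible if $S\cap X_i\in\mathcal{I}_i$ for all $i$. In Maximum $(\mathcal{M},z)$-Coverage one seeks a feasible $S$ that maximizes $f_z(S)$, the largest total weight of at most $z$ points of $\bigcup_{e\in S}P(e)$. A kernel is a set $R\subseteq X$ that contains a feasible set $S$ with $f_z(S)\ge f_z(O)$ for every feasible $O\subseteq X$. Algorithms receive $\ell$, $z$, $w$, and for each $e\in X$ the set $P(e)$ and the indices $i$ with $e\in X_i$ explicitly; the matroids are accessible only through independence oracles. Weights are real numbers that may be added and compared. Every elementary operation and every oracle call takes one step, and sorting $k$ items is charged $k(\lceil\log_2 k\rceil+1)+1$ steps. Let $\Gamma_{\ell,z}=\sum_{q=0}^{(z-1)\ell}\ell^q$;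 thus $\Gamma_{1,z}=z$ and $\Gamma_{\ell,z}\le\frac{\ell}{\ell-1}\ell^{(z-1)\ell}$ for $\ell\ge 2$. **Theorem.** There are a computable function $f:\mathbb{N}^2\to\mathbb{N}$ and absolute constants $C,c \in \mathbb{N}$ such that the following hold. 1. (Randomized.) For every $\varepsilon>0$ put $N=4^z\max\{1,e^z\ln(\varepsilon^{-1})\}$ (which is $(4e)^z\ln(\varepsilon^{-1})$ unless $e^z\ln(\varepsilon^{-1})<1$). There is a randomized algorithm that on every instance, with every $z\ge 1$, always outputs a set $R\subseteq X$ with $|R|\le N\,\Gamma_{\ell,z}$, makes at most $C\,n\,N\,\Gamma_{\ell,z}$ independence oracle calls and runs in time at most $$C\,N\,n\log_2 n+f(\ell,z)\max\{1,\ln(\varepsilon^{-1})\}(n+1)(m+1)^{c},$$ and $R$ is a kernel for Maximum $(\mathcal{M},z)$-Coverage with probability at least $1-\varepsilon$. 2. (Deterministic.) Put $N=2^{cz}\log_2^2(\max\{m,2\})$. There is a deterministic algorithm that on every instance, with every $z\ge 1$, outputs a kernel $R$ for Maximum $(\mathcal{M},z)$-Coverage with $|R|\le N\,\Gamma_{\ell,z}$,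 makes at most $C\,n\,N\,\Gamma_{\ell,z}$ independence oracle calls and runs in time at most $$C\,N\,n\log_2 n+f(\ell,z)(n+1)(m+1)^{c}.$$ In both cases $N$ bounds the number of representative sets, and the term $C\,N\,n\log_2 n$ is the time to sort the input by weight for each of them. -/

import Mathlib

open scoped BigOperators

/-! ### Instances of Maximum (M, z)-Coverage -/

/-- The matroids of the collection `M` whose ground set contains the element `e`. -/
noncomputable def matroidsAt {n s : ℕ} (M : Fin s → Matroid (Fin n)) (e : Fin n) :
    Finset (Fin s) := by
  classical exact Finset.univ.filter fun i => e ∈ (M i).E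

/-- A weighted coverage instance: `n` elements, `m` points, an `ℓ`-matchoid of `s` matroids on
subsets of the elements, in which every singleton is feasible; element `e` covers the points
`pts e`, and the points have nonnegative weights. -/
structure CoverageInstance (ℓ n m s : ℕ) where
  M : Fin s → Matroid (Fin n)
  matchoid : ∀ e, (matroidsAt M e).card ≤ ℓ
  loopless : ∀ i, ∀ e ∈ (M i).E, (M i).Indep {e}
  pts : Fin n → Finset (Fin m)
  w : Fin m → ℝ
  w_nonneg : ∀ p, 0 ≤ w p

namespace CoverageInstance

variable {ℓ n m s : ℕ} (I : CoverageInstance ℓ n m s)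

/-- A set of elements is feasible if its trace on each ground set is independent there. -/
def Feasible (S : Finset (Fin n)) : Prop :=
  ∀ i, (I.M i).Indep ((S : Set (Fin n)) ∩ (I.M i).E)

/-- The points covered by `S`. -/
def covered (S : Finset (Fin n)) : Finset (Fin m) := S.biUnion I.pts

/-- The objective: the largest total weight of at most `z` points covered by `S`. -/
noncomputable def value (z : ℕ) (S : Finset (Fin n)) : ℝ :=
  ((I.covered S).powerset.filter fun Z => Z.card ≤ z).sup' ⟨∅, by simp⟩ fun Z => ∑ p ∈ Z, I.w p

/-- `R` is a kernel: it contains a feasible set that is optimal among all feasible sets. -/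
def IsKernel (z : ℕ) (R : Finset (Fin n)) : Prop :=
  ∃ S ⊆ R, I.Feasible S ∧ ∀ O, I.Feasible O → I.value z O ≤ I.value z S

end CoverageInstance

/-! ### A programming language with a cost semantics

Programs are terms of a first-order language over booleans, natural numbers, reals, pairs and
immutable linked lists. The only operations on reals are zero, addition and comparison, those on
naturals are constants, addition, truncated subtraction and comparison. All values are passed by
reference, so each primitive is a constant time operation of a (real) random access machine.
Every loop has a bound that is known when it is entered, so every program terminates. -/

/-- Data types. -/
inductive Ty : Type
  | unit | bool | nat | real
  | prod (a b : Ty)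
  | list (a : Ty)

/-- The values of a data type. -/
@[reducible] def Ty.Val : Ty → Type
  | .unit => Unit
  | .bool => Bool
  | .nat => ℕ
  | .real => ℝ
  | .prod a b => a.Val × b.Val
  | .list a => List a.Val

/-- Programs with input of type `a` and output of type `b`. -/
inductive Prog : Ty → Ty → Type
  | id {a : Ty} : Prog a a
  /-- first `f`, then `g` -/
  | seq {a b c : Ty} (f : Prog a b) (g : Prog b c) : Prog a c
  | unit {a : Ty} : Prog a .unit
  | pair {a b c : Ty} (f : Prog a b) (g : Prog a c) : Prog a (.prod b c)
  | fst {a b : Ty} : Prog (.prod a b) a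
  | snd {a b : Ty} : Prog (.prod a b) b
  | boolConst {a : Ty} (v : Bool) : Prog a .bool
  /-- if `t` then `f` else `g` -/
  | cond {a b : Ty} (t : Prog a .bool) (f g : Prog a b) : Prog a b
  | natConst {a : Ty} (k : ℕ) : Prog a .nat
  | natAdd : Prog (.prod .nat .nat) .nat
  | natSub : Prog (.prod .nat .nat) .nat
  | natLe : Prog (.prod .nat .nat) .bool
  | realZero {a : Ty} : Prog a .real
  | realAdd : Prog (.prod .real .real) .real
  | realLe : Prog (.prod .real .real) .bool
  | nil {a b : Ty} : Prog a (.list b)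
  | cons {a : Ty} : Prog (.prod a (.list a)) (.list a)
  /-- case distinction on a list: `f` if it is empty, otherwise `g` on its head and tail -/
  | uncons {a b c : Ty} (f : Prog a c) (g : Prog (.prod a (.prod b (.list b))) c) :
      Prog (.prod a (.list b)) c
  /-- apply `f` as many times as the number given -/
  | iter {a : Ty} (f : Prog a a) : Prog (.prod .nat a) a
  /-- go through a list from left to right, updating a state -/
  | foldl {a b : Ty} (f : Prog (.prod a b) a) : Prog (.prod a (.list b)) a
  /-- stable sorting by decreasing key -/
  | sort {a : Ty} : Prog (.list (.prod .real a)) (.list (.prod .real a))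
  /-- a query `(i, A)` to the independence oracles: is `A` independent in the `i`-th matroid? -/
  | query : Prog (.prod .nat (.list .nat)) .bool
  /-- a fair coin -/
  | flip {a : Ty} : Prog a .bool

/-- Programs that flip no coins. -/
def Prog.Deterministic : {a b : Ty} → Prog a b → Prop
  | _, _, .seq f g => f.Deterministic ∧ g.Deterministic
  | _, _, .pair f g => f.Deterministic ∧ g.Deterministic
  | _, _, .cond t f g => t.Deterministic ∧ f.Deterministic ∧ g.Deterministic
  | _, _, .uncons f g => f.Deterministic ∧ g.Deterministic
  | _, _, .iter f => f.Deterministic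
  | _, _, .foldl f => f.Deterministic
  | _, _, .flip => False
  | _, _, _ => True

/-- The resources used by a run: the running time, in which an oracle query counts as one step,
and the number of oracle queries. -/
@[ext]
structure Cost where
  time : ℕ
  queries : ℕ

/-- The distribution of the result and of the cost of a (randomized) computation. -/
abbrev Run (α : Type) : Type := PMF (α × Cost)

namespace Run

/-- Return `x` after `t` steps, without queries. -/
noncomputable def ret {α : Type} (t : ℕ) (x : α) : Run α := PMF.pure (x, ⟨t, 0⟩)

/-- Sequential composition; costs add up. -/
noncomputable def bind {α β : Type} (x : Run α) (f : α → Run β) : Run β :=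
  PMF.bind x fun p =>
    (f p.1).map fun r => (r.1, ⟨p.2.time + r.2.time, p.2.queries + r.2.queries⟩)

/-- Charge one further step. -/
noncomputable def tick {α : Type} (x : Run α) : Run α :=
  (ret 1 ()).bind fun _ => x

/-- `k`-fold repetition. -/
noncomputable def iter {α : Type} (f : α → Run α) : ℕ → α → Run α
  | 0, x => ret 0 x
  | k + 1, x => (f x).bind (iter f k)

/-- Left-to-right traversal of a list. -/
noncomputable def foldl {α β : Type} (f : α × β → Run α) : List β → α → Run α
  | [], x => ret 0 x
  | y :: l, x => (f (x, y)).bind (foldl f l)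

end Run

open Classical in
/-- Running a program with the independence oracles `orc`. Every construct costs one step in
addition to the cost of the parts that are executed; sorting a list of length `k` costs
`k * (⌈log₂ k⌉ + 1) + 1` steps, as merge sort does up to a constant factor. -/
noncomputable def Prog.run (orc : ℕ → List ℕ → Bool) :
    {a b : Ty} → Prog a b → a.Val → Run b.Val
  | _, _, .id, x => Run.ret 1 x
  | _, _, .seq f g, x => Run.tick ((f.run orc x).bind fun y => g.run orc y)
  | _, _, .unit, _ => Run.ret 1 ()
  | _, _, .pair f g, x =>
      Run.tick ((f.run orc x).bind fun y => (g.run orc x).bind fun y' => Run.ret 0 (y, y'))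
  | _, _, .fst, x => Run.ret 1 x.1
  | _, _, .snd, x => Run.ret 1 x.2
  | _, _, .boolConst v, _ => Run.ret 1 v
  | _, _, .cond t f g, x =>
      Run.tick ((t.run orc x).bind fun v : Bool => if v then f.run orc x else g.run orc x)
  | _, _, .natConst k, _ => Run.ret 1 k
  | _, _, .natAdd, (x : ℕ × ℕ) => Run.ret 1 (x.1 + x.2)
  | _, _, .natSub, (x : ℕ × ℕ) => Run.ret 1 (x.1 - x.2)
  | _, _, .natLe, (x : ℕ × ℕ) => Run.ret 1 (decide (x.1 ≤ x.2))
  | _, _, .realZero, _ => Run.ret 1 (0 : ℝ)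
  | _, _, .realAdd, (x : ℝ × ℝ) => Run.ret 1 (x.1 + x.2)
  | _, _, .realLe, (x : ℝ × ℝ) => Run.ret 1 (decide (x.1 ≤ x.2))
  | _, _, .nil, _ => Run.ret 1 []
  | _, _, .cons, x => Run.ret 1 (x.1 :: x.2)
  | _, _, .uncons f g, x =>
      Run.tick (match x.2 with
        | [] => f.run orc x.1
        | y :: l => g.run orc (x.1, y, l))
  | _, _, .iter f, x => Run.tick (Run.iter (fun y => f.run orc y) x.1 x.2)
  | _, _, .foldl f, x => Run.tick (Run.foldl (fun y => f.run orc y) x.2 x.1)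
  | _, _, @Prog.sort a, (l : List (ℝ × a.Val)) =>
      Run.ret (l.length * (Nat.clog 2 l.length + 1) + 1)
        (l.mergeSort fun x y => decide (y.1 ≤ x.1))
  | _, _, .query, x => PMF.pure (orc x.1 x.2, ⟨1, 1⟩)
  | _, _, .flip, _ => (PMF.uniformOfFintype Bool).map fun v => (v, ⟨1, 0⟩)

/-! ### Running programs on instances -/

namespace CoverageInstance

variable {ℓ n m s : ℕ} (I : CoverageInstance ℓ n m s)

open Classical in
/-- The independence oracles: `oracle i A` tells whether the set of the elements listed in `A` is
an independent set of the `i`-th matroid. -/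
noncomputable def oracle (i : ℕ) (A : List ℕ) : Bool :=
  decide (∃ h : i < s, (∀ a ∈ A, a < n) ∧ (I.M ⟨i, h⟩).Indep {e : Fin n | (e : ℕ) ∈ A})

/-- The input of an algorithm: `ℓ`, `z`, the weights of the points, and for each element the
indices of the matroids it participates in and the points it covers. -/
abbrev inputTy : Ty :=
  .prod .nat (.prod .nat (.prod (.list .real) (.list (.prod (.list .nat) (.list .nat)))))

/-- The input that encodes an instance; the matroids themselves are not part of it. -/
noncomputable def input (z : ℕ) : inputTy.Val :=
  ((ℓ : ℕ), (z : ℕ), (List.ofFn I.w : List ℝ),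
    (List.ofFn fun e =>
      ((((matroidsAt I.M e).sort (· ≤ ·)).map fun i => (i : ℕ) : List ℕ),
        (((I.pts e).sort (· ≤ ·)).map fun p => (p : ℕ) : List ℕ)) : List (List ℕ × List ℕ)))

/-- The set of elements that an output list stands for. -/
def outputSet (n : ℕ) (out : List ℕ) : Finset (Fin n) :=
  Finset.univ.filter fun e => (e : ℕ) ∈ out

/-- The outcome (output and cost) of the algorithm `P` on the instance, as a distribution. -/
noncomputable def exec (P : Prog inputTy (.list .nat)) (z : ℕ) : PMF (List ℕ × Cost) :=
  P.run I.oracle (I.input z)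

end CoverageInstance

/-! ### The bounds -/

/-- `Γ_{ℓ,z} = ∑_{q=0}^{(z-1)ℓ} ℓ^q`. -/
def Γbound (ℓ z : ℕ) : ℕ := ∑ q ∈ Finset.range ((z - 1) * ℓ + 1), ℓ ^ q

/-- Number of representative sets of the randomized algorithm with failure probability `ε`: this is
`(4e)^z ln(1/ε)` except that at least one hash function is always used. -/
noncomputable def randSets (z : ℕ) (ε : ℝ) : ℝ :=
  4 ^ z * max 1 (Real.exp z * Real.log ε⁻¹)

/-- Number of representative sets of the deterministic algorithm: `2^{cz} log²(m)`. -/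
noncomputable def detSets (c z m : ℕ) : ℝ :=
  2 ^ (c * z) * Real.logb 2 (max m 2 : ℕ) ^ 2

/-- An outcome meets the bounds that belong to `N` representative sets: the output consists of
elements and has size at most `N Γ_{ℓ,z}`; the number of queries is at most `C n N Γ_{ℓ,z}`; the
time is at most `C N n log n` (sorting the elements for each representative set) plus `F n` times
a polynomial in `m` (everything else). -/
def MeetsBounds (ℓ n m z : ℕ) (N F : ℝ) (C c : ℕ) (r : List ℕ × Cost) : Prop :=
  (∀ a ∈ r.1, a < n) ∧
  ((CoverageInstance.outputSet n r.1).card : ℝ) ≤ N * Γbound ℓ z ∧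
  (r.2.queries : ℝ) ≤ C * (n * (N * Γbound ℓ z)) ∧
  (r.2.time : ℝ) ≤ C * (N * (n * Real.logb 2 n)) + F * ((n + 1) * (m + 1) ^ c)

/-! A kernel is obtained as a union of representative sets, one for each specification: a selection
of the points (a mask) and a number `t`. The score of an element is the weight of the `t` heaviest
selected points that it covers. The set of a specification is the output of a search tree. A node
holds the elements contracted so far in each matroid and the remaining candidates by decreasing
score. It outputs its first candidate `v` and has one child for each matroid containing `v`, in
which `v` is contracted and the elements that become loops are discarded. Depth `(z - 1) * ℓ` and
branching at most `ℓ` give at most `Γbound ℓ z` outputs, and one query per child and candidate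
suffices.

Representation (`exists_mem_treeOutput`): let `W ∪ {e}` be feasible with `e ∉ W` and at most `z - 1`
elements in `W`. Follow a path along which the set contracted in each matroid is independent and
spanned by the trace of `W`. The element `e` is never discarded, because `W` does not span it. Hence
the first candidate `v` scores at least as much as `e`. If `W ∪ {v}` is infeasible, then `W` spans
`v` in some matroid, and the path continues with the child that contracts `v` there. An independent
set spanned by `W` in a matroid is no larger than the trace of `W`, so there are at most `W.card *
ℓ` contractions, and the path ends at a `v` that can replace `e`.

Exchange (`Assignment.exchange`): split an optimal set of at most `z` points into shares of the
elements of a feasible set. An element outside the kernel is replaced by a representative for a mask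
that contains its share and avoids all other shares. The new share weighs at least as much and is
still disjoint from the others. It remains to provide the masks.

Randomized: color the points with `Q` colors, where `Q` is a power of two and `z ≤ Q < 2 * z`, and
take all unions of color classes as masks. A coloring is injective on the optimal set with
probability at least `z! / z ^ z`, and then each share can be confined to its original colors. About
`(z ^ z / z!) * ln (1 / ε)` independent colorings all fail with probability at most `ε`.

Deterministic: a modulus of size `O(z² log m)` is injective on any given set of at most `z` points,
because the least common multiple of `1, …, k` is at least `2 ^ k / (k + 1)` (`exists_injOn_mod`).
On the residues, a greedy cover driven by conditional expectations yields a family that separates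
all disjoint pairs of total size at most `z` (`exists_mem_coverFamily`). The number of moduli and
the size of the family are both linear in `log m`, whence the square of the logarithm.

Both algorithms are explicit terms of `Prog`. Each is accompanied by a theorem on its value and a
bound on its cost. -/

/-! ### Deterministic evaluation -/

/-- Total cost of iterating `f`, when a step from `x` costs `c x`. -/
def iterCost {α : Type} (f : α → α) (c : α → ℕ) : ℕ → α → ℕ
  | 0, _ => 0
  | k + 1, x => c x + iterCost f c k (f x)

/-- Total cost of a traversal with step `f`, when a step costs `c`. -/
def foldCost {α β : Type} (f : α → β → α) (c : α → β → ℕ) : List β → α → ℕ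
  | [], _ => 0
  | y :: l, x => c x y + foldCost f c l (f x y)

/-- The invariant is indexed by the number of steps done. After one step the induction hypothesis is
applied to the shifted invariant. -/
theorem iterCost_le {α : Type} {f : α → α} {c : α → ℕ} (Inv : ℕ → α → Prop) {B k : ℕ} {x : α}
    (h0 : Inv 0 x) (hs : ∀ i < k, ∀ y, Inv i y → Inv (i + 1) (f y) ∧ c y ≤ B) :
    iterCost f c k x ≤ k * B := by
  induction k generalizing x Inv with
  | zero => simp [iterCost]
  | succ k ih =>
    have h1 := hs 0 (Nat.succ_pos _) x h0
    have h2 := ih (fun i => Inv (i + 1)) (x := f x) h1.1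
      (fun i hi y hy => hs (i + 1) (by omega) y hy)
    simp only [iterCost]
    linarith [h1.2, h2, Nat.succ_mul k B]

theorem foldCost_le {α β : Type} {f : α → β → α} {c : α → β → ℕ} (Inv : ℕ → α → Prop) {B : ℕ}
    {l : List β} {x : α} (h0 : Inv 0 x)
    (hs : ∀ i < l.length, ∀ y, Inv i y → ∀ b ∈ l, Inv (i + 1) (f y b) ∧ c y b ≤ B) :
    foldCost f c l x ≤ l.length * B := by
  induction l generalizing x Inv with
  | nil => simp [foldCost]
  | cons b l ih =>
    have h1 := hs 0 (Nat.succ_pos _) x h0 b (by simp)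
    have h2 := ih (fun i => Inv (i + 1)) (x := f x b) h1.1
      (fun i hi y hy b' hb' => hs (i + 1) (by simpa using hi) y hy b' (by simp [hb']))
    simp only [foldCost, List.length_cons]
    linarith [h1.2, h2, Nat.succ_mul l.length B]

theorem foldCost_eq_sum {α β : Type} {f : α → β → α} {c : α → β → ℕ} {d : β → ℕ} (l : List β)
    (x : α) (h : ∀ s, ∀ b ∈ l, c s b = d b) : foldCost f c l x = (l.map d).sum := by
  induction l generalizing x with
  | nil => rfl
  | cons b l ih =>
    simp only [foldCost, List.map_cons, List.sum_cons]
    rw [h x b (by simp), ih _ (fun s b hb => h s b (by simp [hb]))]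

theorem foldCost_le_sum {α β : Type} {f : α → β → α} {c : α → β → ℕ} {d : β → ℕ} (l : List β)
    (x : α) (h : ∀ s, ∀ b ∈ l, c s b ≤ d b) : foldCost f c l x ≤ (l.map d).sum := by
  induction l generalizing x with
  | nil => simp [foldCost]
  | cons b l ih =>
    simp only [foldCost, List.map_cons, List.sum_cons]
    exact add_le_add (h x b (by simp)) (ih _ (fun s b hb => h s b (by simp [hb])))

namespace Prog

open Classical in
/-- The result of running a program in which every coin shows `false`. -/
noncomputable def val (orc : ℕ → List ℕ → Bool) : {a b : Ty} → Prog a b → a.Val → b.Val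
  | _, _, .id, x => x
  | _, _, .seq f g, x => g.val orc (f.val orc x)
  | _, _, .unit, _ => ()
  | _, _, .pair f g, x => (f.val orc x, g.val orc x)
  | _, _, .fst, x => x.1
  | _, _, .snd, x => x.2
  | _, _, .boolConst v, _ => v
  | _, _, .cond t f g, x => bif t.val orc x then f.val orc x else g.val orc x
  | _, _, .natConst k, _ => k
  | _, _, .natAdd, (x : ℕ × ℕ) => x.1 + x.2
  | _, _, .natSub, (x : ℕ × ℕ) => x.1 - x.2
  | _, _, .natLe, (x : ℕ × ℕ) => decide (x.1 ≤ x.2)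
  | _, _, .realZero, _ => (0 : ℝ)
  | _, _, .realAdd, (x : ℝ × ℝ) => x.1 + x.2
  | _, _, .realLe, (x : ℝ × ℝ) => decide (x.1 ≤ x.2)
  | _, _, .nil, _ => []
  | _, _, .cons, x => x.1 :: x.2
  | _, _, .uncons f g, x => match x.2 with
        | [] => f.val orc x.1
        | y :: l => g.val orc (x.1, y, l)
  | _, _, .iter f, x => (fun y => f.val orc y)^[x.1] x.2
  | _, _, .foldl f, x => List.foldl (fun s y => f.val orc (s, y)) x.1 x.2
  | _, _, @Prog.sort a, (l : List (ℝ × a.Val)) => l.mergeSort fun x y => decide (y.1 ≤ x.1)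
  | _, _, .query, x => orc x.1 x.2
  | _, _, .flip, _ => false

/-- Cost of a run in which every coin shows `false`; elementary constructs cost `u` and queries
cost `v`. -/
noncomputable def cost (u v : ℕ) (orc : ℕ → List ℕ → Bool) :
    {a b : Ty} → Prog a b → a.Val → ℕ
  | _, _, .seq f g, x => u + (f.cost u v orc x + g.cost u v orc (f.val orc x))
  | _, _, .pair f g, x => u + (f.cost u v orc x + g.cost u v orc x)
  | _, _, .cond t f g, x =>
      u + (t.cost u v orc x + bif t.val orc x then f.cost u v orc x else g.cost u v orc x)
  | _, _, .uncons f g, x => u + (match x.2 with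
        | [] => f.cost u v orc x.1
        | y :: l => g.cost u v orc (x.1, y, l))
  | _, _, .iter f, x => u + iterCost (fun y => f.val orc y) (fun y => f.cost u v orc y) x.1 x.2
  | _, _, .foldl f, x =>
      u + foldCost (fun s y => f.val orc (s, y)) (fun s y => f.cost u v orc (s, y)) x.2 x.1
  | _, _, @Prog.sort a, (l : List (ℝ × a.Val)) => u * (l.length * (Nat.clog 2 l.length + 1) + 1)
  | _, _, .query, _ => v
  | _, _, _, _ => u

/-- Running time of a deterministic program. -/
noncomputable abbrev time (orc : ℕ → List ℕ → Bool) {a b : Ty} (P : Prog a b) (x : a.Val) : ℕ :=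
  P.cost 1 1 orc x

/-- Number of queries of a deterministic program. -/
noncomputable abbrev queries (orc : ℕ → List ℕ → Bool) {a b : Ty} (P : Prog a b) (x : a.Val) : ℕ :=
  P.cost 0 1 orc x

end Prog

/-! ### Runs of coin-free programs are point masses -/

theorem Run.pure_bind {α β : Type} (x : α) (c : Cost) (f : α → Run β) :
    Run.bind (PMF.pure (x, c)) f
      = (f x).map fun r => (r.1, ⟨c.time + r.2.time, c.queries + r.2.queries⟩) := by
  simp [Run.bind, PMF.pure_bind]

theorem Run.pure_bind_pure {α β : Type} (x : α) (c : Cost) {f : α → Run β} {y : β} {d : Cost}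
    (h : f x = PMF.pure (y, d)) :
    Run.bind (PMF.pure (x, c)) f = PMF.pure (y, ⟨c.time + d.time, c.queries + d.queries⟩) := by
  rw [Run.pure_bind, h, PMF.pure_map]

theorem Run.tick_pure {α : Type} (x : α) (c : Cost) :
    Run.tick (PMF.pure (x, c)) = PMF.pure (x, ⟨1 + c.time, c.queries⟩) := by
  rw [Run.tick, Run.ret, Run.pure_bind, PMF.pure_map]; simp

theorem Run.iter_pure {α : Type} {f : α → Run α} {g : α → α} {c d : α → ℕ}
    (h : ∀ x, f x = PMF.pure (g x, ⟨c x, d x⟩)) (k : ℕ) (x : α) :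
    Run.iter f k x = PMF.pure (g^[k] x, ⟨iterCost g c k x, iterCost g d k x⟩) := by
  induction k generalizing x with
  | zero => rfl
  | succ k ih => rw [Run.iter, h, Run.pure_bind_pure _ _ (ih _)]; rfl

theorem Run.foldl_pure {α β : Type} {f : α × β → Run α} {g : α → β → α} {c d : α → β → ℕ}
    (h : ∀ x y, f (x, y) = PMF.pure (g x y, ⟨c x y, d x y⟩)) (l : List β) (x : α) :
    Run.foldl f l x = PMF.pure (l.foldl g x, ⟨foldCost g c l x, foldCost g d l x⟩) := by
  induction l generalizing x with
  | nil => rfl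
  | cons y l ih => rw [Run.foldl, h, Run.pure_bind_pure _ _ (ih _)]; rfl

/-- Every construct except the coin sends point masses to point masses. This reduces the
probabilistic semantics to the functions `val` and `cost`: time is `cost` with unit charges `(1,
1)`, the number of queries is `cost` with `(0, 1)`. -/
theorem Prog.run_eq_pure (orc : ℕ → List ℕ → Bool) {a b : Ty} (P : Prog a b)
    (hP : P.Deterministic) (x : a.Val) :
    P.run orc x = PMF.pure (P.val orc x, ⟨P.time orc x, P.queries orc x⟩) := by
  induction P with
  | seq f g hf hg =>
    rw [Prog.run, hf hP.1, Run.pure_bind_pure _ _ (hg hP.2 _), Run.tick_pure]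
    simp [Prog.val, Prog.cost, Prog.time, Prog.queries]
  | pair f g hf hg =>
    rw [Prog.run, hf hP.1, Run.pure_bind, hg hP.2, Run.pure_bind, Run.ret, PMF.pure_map,
      PMF.pure_map, Run.tick_pure]
    simp [Prog.val, Prog.cost, Prog.time, Prog.queries]
  | cond t f g ht hf hg =>
    rw [Prog.run, ht hP.1, Run.pure_bind]
    cases h : t.val orc x <;>
    simp [h, hf hP.2.1, hg hP.2.2, Run.tick_pure, PMF.pure_map, Prog.val, Prog.cost, Prog.time,
      Prog.queries]
  | uncons f g hf hg =>
    obtain ⟨x, l⟩ := x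
    cases l with
    | nil =>
      simp only [Prog.run]
      rw [hf hP.1, Run.tick_pure]; simp [Prog.val, Prog.cost]
    | cons y l =>
      simp only [Prog.run]
      rw [hg hP.2, Run.tick_pure]; simp [Prog.val, Prog.cost]
  | iter f hf =>
    rw [Prog.run, Run.iter_pure (fun x => hf hP x), Run.tick_pure]
    simp [Prog.val, Prog.cost, Prog.time, Prog.queries]
  | foldl f hf =>
    rw [Prog.run, Run.foldl_pure (fun s y => hf hP (s, y)), Run.tick_pure]
    simp [Prog.val, Prog.cost, Prog.time, Prog.queries]
  | flip => exact hP.elim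
  | _ => first | rfl | simp [Prog.run, Run.ret, Prog.val, Prog.cost]

/-! ### Programs without queries -/

namespace Prog

/-- Programs without oracle queries. -/
def QueryFree : {a b : Ty} → Prog a b → Prop
  | _, _, .seq f g => f.QueryFree ∧ g.QueryFree
  | _, _, .pair f g => f.QueryFree ∧ g.QueryFree
  | _, _, .cond t f g => t.QueryFree ∧ f.QueryFree ∧ g.QueryFree
  | _, _, .uncons f g => f.QueryFree ∧ g.QueryFree
  | _, _, .iter f => f.QueryFree
  | _, _, .foldl f => f.QueryFree
  | _, _, .query => False
  | _, _, _ => True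

theorem iterCost_zero {α : Type} (f : α → α) (k : ℕ) (x : α) : iterCost f (fun _ => 0) k x = 0 := by
  induction k generalizing x with
  | zero => rfl
  | succ k ih => simp [iterCost, ih]

theorem foldCost_zero {α β : Type} (f : α → β → α) (l : List β) (x : α) :
    foldCost f (fun _ _ => 0) l x = 0 := by
  induction l generalizing x with
  | nil => rfl
  | cons y l ih => simp [foldCost, ih]

theorem QueryFree.queries_eq {orc : ℕ → List ℕ → Bool} {a b : Ty} {P : Prog a b}
    (hP : P.QueryFree) (x : a.Val) : P.cost 0 1 orc x = 0 := by
  induction P with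
  | seq f g hf hg => simp [cost, hf hP.1, hg hP.2]
  | pair f g hf hg => simp [cost, hf hP.1, hg hP.2]
  | cond t f g ht hf hg => simp [cost, ht hP.1, hf hP.2.1, hg hP.2.2]
  | uncons f g hf hg =>
    obtain ⟨x, l⟩ := x
    cases l with
    | nil => simp [cost, hf hP.1]
    | cons y l => simp [cost, hg hP.2]
  | iter f hf =>
    simp only [cost, hf hP]; simp [iterCost_zero]
  | foldl f hf =>
    simp only [cost, hf hP]; simp [foldCost_zero]
  | query => exact hP.elim
  | _ => simp [cost]

/-! ### Derived combinators: programs over an environment -/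

variable {e a b c d : Ty}

/-- Traverse a list, with access to the environment. -/
def foldE (init : Prog e a) (lst : Prog e (.list b)) (body : Prog (.prod a (.prod b e)) a) :
    Prog e a :=
  .seq (.pair (.pair init .id) lst)
    (.seq (.foldl (.pair (.seq (.pair (.seq .fst .fst) (.pair .snd (.seq .fst .snd))) body)
      (.seq .fst .snd))) .fst)

/-- Repeat, with access to the environment. -/
def iterE (cnt : Prog e .nat) (init : Prog e a) (body : Prog (.prod a e) a) : Prog e a :=
  .seq (.pair cnt (.pair init .id)) (.seq (.iter (.pair body .snd)) .fst)

variable (orc : ℕ → List ℕ → Bool)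

theorem foldE_aux (body : Prog (.prod a (.prod b e)) a) (l : List b.Val) (s : a.Val) (x : e.Val) :
    List.foldl (fun (s : a.Val × e.Val) (y : b.Val) => (body.val orc (s.1, y, s.2), s.2)) (s, x) l
      = (l.foldl (fun s y => body.val orc (s, y, x)) s, x) := by
  induction l generalizing s with
  | nil => rfl
  | cons y l ih => simp [ih]

theorem foldE_val (init : Prog e a) (lst : Prog e (.list b)) (body : Prog (.prod a (.prod b e)) a)
    (x : e.Val) : (foldE init lst body).val orc x
      = (lst.val orc x).foldl (fun s y => body.val orc (s, y, x)) (init.val orc x) := by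
  simp only [foldE, val]
  rw [foldE_aux]

theorem foldE_cost_aux {u v : ℕ} (body : Prog (.prod a (.prod b e)) a) (l : List b.Val) (s : a.Val)
    (x : e.Val) :
    foldCost (fun (s : a.Val × e.Val) (y : b.Val) => (body.val orc (s.1, y, s.2), s.2))
      (fun s y => body.cost u v orc (s.1, y, s.2) + 14 * u) l (s, x)
      = foldCost (fun s y => body.val orc (s, y, x))
          (fun s y => body.cost u v orc (s, y, x) + 14 * u) l s := by
  induction l generalizing s with
  | nil => rfl
  | cons y l ih => simp [foldCost, ih]

/-- The `14 * u` per entry and the final `7 * u` pay for the projections and pairings that carry the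
environment through the loop. -/
theorem foldE_cost {u v : ℕ} (init : Prog e a) (lst : Prog e (.list b))
    (body : Prog (.prod a (.prod b e)) a) (x : e.Val) : (foldE init lst body).cost u v orc x
      = init.cost u v orc x + lst.cost u v orc x
        + foldCost (fun s y => body.val orc (s, y, x))
          (fun s y => body.cost u v orc (s, y, x) + 14 * u)
          (lst.val orc x) (init.val orc x) + 7 * u := by
  rw [← foldE_cost_aux]
  simp only [foldE, cost, val]
  have : ∀ s : a.Val × e.Val, ∀ y : b.Val,
      u + (u + (u + (u + (u + u) + (u + (u + (u + (u + u))))) + body.cost u v orc (s.1, y, s.2))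
        + (u + (u + u))) = body.cost u v orc (s.1, y, s.2) + 14 * u := by
    intro s y; ring
  simp only [this]
  ring

theorem iterE_aux (body : Prog (.prod a e) a) (k : ℕ) (s : a.Val) (x : e.Val) :
    (fun (s : a.Val × e.Val) => (body.val orc s, s.2))^[k] (s, x)
      = ((fun s => body.val orc (s, x))^[k] s, x) := by
  induction k generalizing s with
  | zero => rfl
  | succ k ih => simp [ih]

theorem iterE_val (cnt : Prog e .nat) (init : Prog e a) (body : Prog (.prod a e) a) (x : e.Val) :
    (iterE cnt init body).val orc x
      = (fun s => body.val orc (s, x))^[cnt.val orc x] (init.val orc x) := by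
  simp only [iterE, val]
  rw [iterE_aux]

theorem iterE_cost {u v : ℕ} (cnt : Prog e .nat) (init : Prog e a) (body : Prog (.prod a e) a)
    (x : e.Val) : (iterE cnt init body).cost u v orc x
      = cnt.cost u v orc x + init.cost u v orc x
        + iterCost (fun s => body.val orc (s, x)) (fun s => body.cost u v orc (s, x) + 2 * u)
          (cnt.val orc x) (init.val orc x) + 7 * u := by
  simp only [iterE, cost, val]
  have : ∀ k s, iterCost (fun (s : a.Val × e.Val) => (body.val orc s, s.2))
      (fun s => u + (body.cost u v orc s + u)) k (s, x)
      = iterCost (fun s => body.val orc (s, x)) (fun s => body.cost u v orc (s, x) + 2 * u) k s := by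
    intro k
    induction k with
    | zero => intro s; rfl
    | succ k ih => intro s; simp only [iterCost, ih]; ring
  rw [this]
  ring

theorem foldE_time_le {init : Prog e a} {lst : Prog e (.list b)}
    {body : Prog (.prod a (.prod b e)) a} {x : e.Val} {ti tl B n : ℕ} (Inv : ℕ → a.Val → Prop)
    (hi : init.cost 1 1 orc x ≤ ti) (hl : lst.cost 1 1 orc x ≤ tl)
    (hn : (lst.val orc x).length ≤ n)
    (h0 : Inv 0 (init.val orc x))
    (hs : ∀ i < (lst.val orc x).length, ∀ s, Inv i s → ∀ y ∈ lst.val orc x,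
      Inv (i + 1) (body.val orc (s, y, x)) ∧ body.cost 1 1 orc (s, y, x) ≤ B) :
    (foldE init lst body).cost 1 1 orc x ≤ ti + tl + n * (B + 14) + 7 := by
  rw [foldE_cost]
  have := foldCost_le (f := fun s y => body.val orc (s, y, x))
    (c := fun s y => body.cost 1 1 orc (s, y, x) + 14 * 1) Inv (B := B + 14) h0
    (fun i hi s hs' y hy => ⟨(hs i hi s hs' y hy).1, by have := (hs i hi s hs' y hy).2; omega⟩)
  have h2 := Nat.mul_le_mul_right (B + 14) hn
  omega

theorem iterE_time_le {cnt : Prog e .nat} {init : Prog e a}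
    {body : Prog (.prod a e) a} {x : e.Val} {tc ti B n : ℕ} (Inv : ℕ → a.Val → Prop)
    (hc : cnt.cost 1 1 orc x ≤ tc) (hi : init.cost 1 1 orc x ≤ ti)
    (hn : cnt.val orc x ≤ n)
    (h0 : Inv 0 (init.val orc x))
    (hs : ∀ i < cnt.val orc x, ∀ s, Inv i s →
      Inv (i + 1) (body.val orc (s, x)) ∧ body.cost 1 1 orc (s, x) ≤ B) :
    (iterE cnt init body).cost 1 1 orc x ≤ tc + ti + n * (B + 2) + 7 := by
  rw [iterE_cost]
  have := iterCost_le (f := fun s => body.val orc (s, x))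
    (c := fun s => body.cost 1 1 orc (s, x) + 2 * 1) Inv (B := B + 2) h0
    (fun i hi s hs' => ⟨(hs i hi s hs').1, by have := (hs i hi s hs').2; omega⟩)
  have h2 := Nat.mul_le_mul_right (B + 2) hn
  omega

/-- Reversal of a list. -/
def revP (l : Prog e (.list a)) : Prog e (.list a) :=
  .seq (.pair .nil l) (.foldl (.seq (.pair .snd .fst) .cons))

theorem foldl_cons_eq {α : Type} (l s : List α) :
    List.foldl (fun s y => y :: s) s l = l.reverse ++ s := by
  induction l generalizing s with
  | nil => rfl
  | cons y l ih => simp [ih]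

theorem revP_val (l : Prog e (.list a)) (x : e.Val) :
    (revP l).val orc x = (l.val orc x).reverse := by
  simp only [revP, val]
  rw [foldl_cons_eq]; simp

theorem revP_cost {u v : ℕ} (l : Prog e (.list a)) (x : e.Val) :
    (revP l).cost u v orc x = l.cost u v orc x + (l.val orc x).length * (5 * u) + 4 * u := by
  simp only [revP, cost, val]
  rw [foldCost_eq_sum (d := fun _ => 5 * u)]
  · simp; ring
  · intros; ring

/-- Map over a list, with access to the environment. -/
def mapE (lst : Prog e (.list b)) (body : Prog (.prod b e) c) : Prog e (.list c) :=
  revP (foldE .nil lst (.seq (.pair (.seq .snd body) .fst) .cons))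

theorem foldl_cons_map {α β : Type} (f : α → β) (l : List α) (s : List β) :
    List.foldl (fun s y => f y :: s) s l = (l.map f).reverse ++ s := by
  induction l generalizing s with
  | nil => rfl
  | cons y l ih => simp [ih]

theorem mapE_val (lst : Prog e (.list b)) (body : Prog (.prod b e) c) (x : e.Val) :
    (mapE lst body).val orc x = (lst.val orc x).map fun y => body.val orc (y, x) := by
  rw [mapE, revP_val, foldE_val]
  simp only [val]
  rw [foldl_cons_map]; simp

theorem mapE_cost {u v : ℕ} (lst : Prog e (.list b)) (body : Prog (.prod b e) c) (x : e.Val) :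
    (mapE lst body).cost u v orc x = lst.cost u v orc x
      + ((lst.val orc x).map fun y => body.cost u v orc (y, x) + 25 * u).sum + 12 * u := by
  have hlen : (List.foldl (fun s y => body.val orc (y, x) :: s) [] (lst.val orc x)).length
      = (lst.val orc x).length := by
    rw [foldl_cons_map]; simp
  rw [mapE, revP_cost, foldE_cost, foldE_val]
  simp only [cost, val]
  rw [hlen, foldCost_eq_sum (d := fun y => body.cost u v orc (y, x) + 20 * u)]
  · have : ∀ l : List b.Val, (l.map fun y => body.cost u v orc (y, x) + 20 * u).sum
        + l.length * (5 * u) = (l.map fun y => body.cost u v orc (y, x) + 25 * u).sum := by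
      intro l
      induction l with
      | nil => simp
      | cons y l ih => simp only [List.map_cons, List.sum_cons, List.length_cons, ← ih]; ring
    rw [← this]; ring
  · intros; ring

theorem sum_map_le {α : Type} {l : List α} {f : α → ℕ} {B n : ℕ} (hn : l.length ≤ n)
    (h : ∀ y ∈ l, f y ≤ B) : (l.map f).sum ≤ n * B := by
  calc (l.map f).sum ≤ l.length * B := by
        simpa using List.sum_le_card_nsmul (l.map f) B (by simpa using h)
    _ ≤ n * B := Nat.mul_le_mul_right _ hn

theorem mapE_time_le {lst : Prog e (.list b)} {body : Prog (.prod b e) c} {x : e.Val}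
    {tl B n : ℕ} (hl : lst.cost 1 1 orc x ≤ tl) (hn : (lst.val orc x).length ≤ n)
    (hB : ∀ y ∈ lst.val orc x, body.cost 1 1 orc (y, x) ≤ B) :
    (mapE lst body).cost 1 1 orc x ≤ tl + n * (B + 25) + 12 := by
  rw [mapE_cost]
  have := sum_map_le (f := fun y => body.cost 1 1 orc (y, x) + 25 * 1) (B := B + 25) hn
    (fun y hy => by have := hB y hy; omega)
  omega

/-- Concatenation of the reversal of a list with another list. -/
def revAppP (l l' : Prog e (.list a)) : Prog e (.list a) :=
  .seq (.pair l' l) (.foldl (.seq (.pair .snd .fst) .cons))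

theorem revAppP_val (l l' : Prog e (.list a)) (x : e.Val) :
    (revAppP l l').val orc x = (l.val orc x).reverse ++ l'.val orc x := by
  simp only [revAppP, val]
  rw [foldl_cons_eq]

theorem revAppP_cost {u v : ℕ} (l l' : Prog e (.list a)) (x : e.Val) :
    (revAppP l l').cost u v orc x
      = l.cost u v orc x + l'.cost u v orc x + (l.val orc x).length * (5 * u) + 3 * u := by
  simp only [revAppP, cost, val]
  rw [foldCost_eq_sum (d := fun _ => 5 * u)]
  · simp; ring
  · intros; ring

/-- Concatenation of the lists computed for the entries of a list. -/
def flatMapE (lst : Prog e (.list b)) (body : Prog (.prod b e) (.list c)) : Prog e (.list c) :=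
  revP (foldE .nil lst (revAppP (.seq .snd body) .fst))

theorem foldl_flatMap {α β : Type} (f : α → List β) (l : List α) (s : List β) :
    List.foldl (fun s y => (f y).reverse ++ s) s l = (l.flatMap f).reverse ++ s := by
  induction l generalizing s with
  | nil => rfl
  | cons y l ih => simp [ih]

theorem flatMapE_val (lst : Prog e (.list b)) (body : Prog (.prod b e) (.list c)) (x : e.Val) :
    (flatMapE lst body).val orc x = (lst.val orc x).flatMap fun y => body.val orc (y, x) := by
  rw [flatMapE, revP_val, foldE_val]
  simp only [val, revAppP_val]
  rw [foldl_flatMap]; simp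

theorem flatMapE_cost {u v : ℕ} (lst : Prog e (.list b)) (body : Prog (.prod b e) (.list c))
    (x : e.Val) :
    (flatMapE lst body).cost u v orc x = lst.cost u v orc x
      + ((lst.val orc x).map fun y => body.cost u v orc (y, x)
        + (body.val orc (y, x)).length * (10 * u) + 20 * u).sum + 12 * u := by
  have hlen : (List.foldl (fun s y => (body.val orc (y, x)).reverse ++ s) [] (lst.val orc x)).length
      = ((lst.val orc x).map fun y => (body.val orc (y, x)).length).sum := by
    rw [foldl_flatMap]; simp
  rw [flatMapE, revP_cost, foldE_cost, foldE_val]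
  simp only [cost, val, revAppP_val, revAppP_cost]
  rw [hlen, foldCost_eq_sum (d := fun y => body.cost u v orc (y, x)
        + (body.val orc (y, x)).length * (5 * u) + 20 * u)]
  · have : ∀ l : List b.Val, (l.map fun y => body.cost u v orc (y, x)
        + (body.val orc (y, x)).length * (5 * u) + 20 * u).sum
        + (l.map fun y => (body.val orc (y, x)).length).sum * (5 * u)
        = (l.map fun y => body.cost u v orc (y, x)
          + (body.val orc (y, x)).length * (10 * u) + 20 * u).sum := by
      intro l
      induction l with
      | nil => simp
      | cons y l ih => simp only [List.map_cons, List.sum_cons, ← ih]; ring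
    rw [← this]; ring
  · intros; ring

theorem flatMapE_time_le {lst : Prog e (.list b)} {body : Prog (.prod b e) (.list c)} {x : e.Val}
    {tl B n k : ℕ} (hl : lst.cost 1 1 orc x ≤ tl) (hn : (lst.val orc x).length ≤ n)
    (hB : ∀ y ∈ lst.val orc x, body.cost 1 1 orc (y, x) ≤ B)
    (hk : ∀ y ∈ lst.val orc x, (body.val orc (y, x)).length ≤ k) :
    (flatMapE lst body).cost 1 1 orc x ≤ tl + n * (B + k * 10 + 20) + 12 := by
  rw [flatMapE_cost]
  have := sum_map_le (f := fun y => body.cost 1 1 orc (y, x)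
        + (body.val orc (y, x)).length * (10 * 1) + 20 * 1) (B := B + k * 10 + 20) hn
    (fun y hy => by have := hB y hy; have := hk y hy; omega)
  omega

/-- The entries of a list that pass a test. -/
def filterE (lst : Prog e (.list b)) (test : Prog (.prod b e) .bool) : Prog e (.list b) :=
  revP (foldE .nil lst (.cond (.seq .snd test)
    (.seq (.pair (.seq .snd .fst) .fst) .cons) .fst))

theorem foldl_filter_eq {α : Type} (p : α → Bool) (l s : List α) :
    List.foldl (fun s y => bif p y then y :: s else s) s l = (l.filter p).reverse ++ s := by
  induction l generalizing s with
  | nil => rfl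
  | cons y l ih =>
    rw [List.foldl_cons, ih, List.filter_cons]
    cases p y <;> simp

theorem filterE_val (lst : Prog e (.list b)) (test : Prog (.prod b e) .bool) (x : e.Val) :
    (filterE lst test).val orc x = (lst.val orc x).filter fun y => test.val orc (y, x) := by
  rw [filterE, revP_val, foldE_val]
  simp only [val]
  rw [foldl_filter_eq]; simp

/-- Only an upper bound, since an entry that fails the test is cheaper than one that is kept and
later reversed. -/
theorem filterE_cost_le {u v : ℕ} (lst : Prog e (.list b)) (test : Prog (.prod b e) .bool)
    (x : e.Val) :
    (filterE lst test).cost u v orc x ≤ lst.cost u v orc x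
      + ((lst.val orc x).map fun y => test.cost u v orc (y, x) + 30 * u).sum + 12 * u := by
  have hlen : (List.foldl (fun s y => bif test.val orc (y, x) then y :: s else s) []
      (lst.val orc x)).length ≤ (lst.val orc x).length := by
    rw [foldl_filter_eq]; simpa using List.length_filter_le _ _
  have hfold := foldCost_le_sum (f := fun s y => bif test.val orc (y, x) then y :: s else s)
    (c := fun s y => u + (u + (u + test.cost u v orc (y, x)) +
        bif test.val orc (y, x) then u + (u + (u + (u + u) + u) + u) else u) + 14 * u)
    (d := fun y => test.cost u v orc (y, x) + 25 * u) (lst.val orc x) []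
    (fun s y _ => by cases test.val orc (y, x) <;> simp only [cond_true, cond_false] <;> linarith)
  have hsum : ∀ l : List b.Val, (l.map fun y => test.cost u v orc (y, x) + 25 * u).sum
        + l.length * (5 * u) = (l.map fun y => test.cost u v orc (y, x) + 30 * u).sum := by
      intro l
      induction l with
      | nil => simp
      | cons y l ih => simp only [List.map_cons, List.sum_cons, List.length_cons, ← ih]; ring
  rw [filterE, revP_cost, foldE_cost, foldE_val]
  simp only [cost, val]
  rw [← hsum]
  have h2 := Nat.mul_le_mul_right (5 * u) hlen
  linarith

theorem filterE_time_le {lst : Prog e (.list b)} {test : Prog (.prod b e) .bool} {x : e.Val}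
    {tl B n : ℕ} (hl : lst.cost 1 1 orc x ≤ tl) (hn : (lst.val orc x).length ≤ n)
    (hB : ∀ y ∈ lst.val orc x, test.cost 1 1 orc (y, x) ≤ B) :
    (filterE lst test).cost 1 1 orc x ≤ tl + n * (B + 30) + 12 := by
  have h0 := filterE_cost_le orc (u := 1) (v := 1) lst test x
  have := sum_map_le (f := fun y => test.cost 1 1 orc (y, x) + 30 * 1) (B := B + 30) hn
    (fun y hy => by have := hB y hy; omega)
  omega

end Prog

namespace Prog

variable {e a b c d : Ty}

/-! ### Arithmetic and list programs -/

/-- Evaluate `f` and push its value onto the environment of `g`. -/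
def letE (f : Prog e a) (g : Prog (.prod a e) b) : Prog e b := .seq (.pair f .id) g

def addP (f g : Prog e .nat) : Prog e .nat := .seq (.pair f g) .natAdd

def subP (f g : Prog e .nat) : Prog e .nat := .seq (.pair f g) .natSub

def leP (f g : Prog e .nat) : Prog e .bool := .seq (.pair f g) .natLe

def consP (f : Prog e a) (g : Prog e (.list a)) : Prog e (.list a) := .seq (.pair f g) .cons

def eqP (f g : Prog e .nat) : Prog e .bool :=
  .seq (.pair f g) (.cond .natLe (leP .snd .fst) (.boolConst false))

def andP (f g : Prog e .bool) : Prog e .bool := .cond f g (.boolConst false)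

def notP (f : Prog e .bool) : Prog e .bool := .cond f (.boolConst false) (.boolConst true)

/-- Repeated addition: the time is proportional to the value of the first factor and independent of
that of the second. The order of the factors therefore matters wherever one of them may be large. -/
def mulP (f g : Prog e .nat) : Prog e .nat :=
  letE g (iterE (.seq .snd f) (.natConst 0) (addP .fst (.seq .snd .fst)))

def powP (f g : Prog e .nat) : Prog e .nat :=
  letE f (iterE (.seq .snd g) (.natConst 1) (mulP (.seq .snd .fst) .fst))

def lengthP (l : Prog e (.list a)) : Prog e .nat :=
  foldE (.natConst 0) l (addP .fst (.natConst 1))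

def tailP : Prog (.list a) (.list a) := .seq (.pair .unit .id) (.uncons .nil (.seq .snd .snd))

def dropP (n : Prog e .nat) (l : Prog e (.list a)) : Prog e (.list a) :=
  iterE n l (.seq .fst tailP)

/-- Entry of a list, with a default value. -/
def nthP (dflt : Prog .unit a) (n : Prog e .nat) (l : Prog e (.list a)) : Prog e a :=
  .seq (.pair .unit (dropP n l)) (.uncons dflt (.seq .snd .fst))

def memP (i : Prog e .nat) (l : Prog e (.list .nat)) : Prog e .bool :=
  letE i (foldE (.boolConst false) (.seq .snd l)
    (.cond (eqP (.seq .snd .fst) (.seq .snd (.seq .snd .fst))) (.boolConst true) .fst))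

/-- The list `0, 1, …, n - 1`. -/
def rangeP (n : Prog e .nat) : Prog e (.list .nat) :=
  revP (.seq (iterE n (.pair (.natConst 0) .nil)
    (.seq .fst (.pair (addP .fst (.natConst 1)) .cons))) .snd)

/-- Attach to each entry of a list its index. -/
def enumP (l : Prog e (.list a)) : Prog e (.list (.prod .nat a)) :=
  revP (.seq (foldE (.pair (.natConst 0) .nil) l
    (.pair (addP (.seq .fst .fst) (.natConst 1))
      (consP (.pair (.seq .fst .fst) (.seq .snd .fst)) (.seq .fst .snd)))) .snd)

variable (orc : ℕ → List ℕ → Bool) (x : e.Val)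

@[simp] theorem letE_val (f : Prog e a) (g : Prog (.prod a e) b) :
    (letE f g).val orc x = g.val orc (f.val orc x, x) := rfl

@[simp] theorem addP_val (f g : Prog e .nat) :
    (addP f g).val orc x = (f.val orc x + g.val orc x : ℕ) := rfl

@[simp] theorem subP_val (f g : Prog e .nat) :
    (subP f g).val orc x = (f.val orc x - g.val orc x : ℕ) := rfl

@[simp] theorem leP_val (f g : Prog e .nat) :
    (leP f g).val orc x = Nat.ble (f.val orc x) (g.val orc x) := by
  change decide ((f.val orc x : ℕ) ≤ g.val orc x) = _
  rw [Bool.eq_iff_iff]; simp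

@[simp] theorem consP_val (f : Prog e a) (g : Prog e (.list a)) :
    (consP f g).val orc x = f.val orc x :: g.val orc x := rfl

@[simp] theorem eqP_val (f g : Prog e .nat) :
    (eqP f g).val orc x = ((f.val orc x : ℕ) == g.val orc x) := by
  change (bif decide ((f.val orc x : ℕ) ≤ g.val orc x) then
    decide ((g.val orc x : ℕ) ≤ f.val orc x) else false) = _
  rcases lt_trichotomy (f.val orc x : ℕ) (g.val orc x) with h | h | h
  · simp [h.le, h.not_ge, h.ne]
  · simp [h]
  · simp [h.le, h.not_ge, h.ne']

@[simp] theorem andP_val (f g : Prog e .bool) :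
    (andP f g).val orc x = (f.val orc x && g.val orc x) := by
  change (bif f.val orc x then g.val orc x else false) = _
  cases f.val orc x <;> rfl

@[simp] theorem notP_val (f : Prog e .bool) : (notP f).val orc x = !f.val orc x := by
  change (bif f.val orc x then false else true) = _
  cases f.val orc x <;> rfl

theorem iterate_add_nat (k n s : ℕ) : (fun s => s + n)^[k] s = s + k * n := by
  induction k generalizing s with
  | zero => simp
  | succ k ih => rw [Function.iterate_succ_apply, ih]; ring

@[simp] theorem mulP_val (f g : Prog e .nat) :
    (mulP f g).val orc x = (f.val orc x * g.val orc x : ℕ) := by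
  rw [mulP, letE_val, iterE_val]
  exact (iterate_add_nat _ _ _).trans (zero_add _)

@[simp] theorem powP_val (f g : Prog e .nat) :
    (powP f g).val orc x = ((f.val orc x : ℕ) ^ (g.val orc x : ℕ) : ℕ) := by
  rw [powP, letE_val, iterE_val]
  have : ∀ k s n : ℕ, (fun s => n * s)^[k] s = n ^ k * s := by
    intro k
    induction k with
    | zero => intro s n; simp
    | succ k ih => intro s n; rw [Function.iterate_succ_apply, ih]; ring
  have h := this (g.val orc x : ℕ) 1 (f.val orc x : ℕ)
  rw [mul_one] at h
  rw [← h]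
  simp only [mulP_val]
  rfl

@[simp] theorem lengthP_val (l : Prog e (.list a)) :
    (lengthP l).val orc x = (l.val orc x).length := by
  rw [lengthP, foldE_val]
  have : ∀ (l : List a.Val) (s : ℕ), List.foldl (fun s _ => s + 1) s l = s + l.length := by
    intro l
    induction l with
    | nil => intro s; rfl
    | cons y l ih => intro s; rw [List.foldl_cons, ih, List.length_cons]; ring
  exact (this _ _).trans (zero_add _)

@[simp] theorem tailP_val (l : List a.Val) : (tailP (a := a)).val orc l = l.tail := by
  cases l <;> rfl

@[simp] theorem dropP_val (n : Prog e .nat) (l : Prog e (.list a)) :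
    (dropP n l).val orc x = (l.val orc x).drop (n.val orc x) := by
  rw [dropP, iterE_val]
  have : ∀ (k : ℕ) (l : List a.Val), (fun s : List a.Val => s.tail)^[k] l = l.drop k := by
    intro k
    induction k with
    | zero => intro l; rfl
    | succ k ih => intro l; rw [Function.iterate_succ_apply, ih]; simp
  rw [← this]
  congr 1
  funext s
  exact tailP_val orc s

@[simp] theorem nthP_val (dflt : Prog .unit a) (n : Prog e .nat) (l : Prog e (.list a)) :
    (nthP dflt n l).val orc x = (l.val orc x).getD (n.val orc x) (dflt.val orc ()) := by
  have h := dropP_val orc x n l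
  simp only [nthP, val]
  rw [h, List.getD_eq_getElem?_getD, ← List.head?_drop]
  cases List.drop (n.val orc x) (l.val orc x) <;> rfl

theorem foldl_mem_eq (i : ℕ) (l : List ℕ) (s : Bool) :
    List.foldl (fun s y => bif y == i then true else s) s l = (s || l.contains i) := by
  induction l generalizing s with
  | nil => simp
  | cons y l ih =>
    rw [List.foldl_cons, ih]
    by_cases h : y = i
    · simp [h]
    · have h' : (y == i) = false := by simpa using h
      simp [h', Ne.symm h]

@[simp] theorem memP_val (i : Prog e .nat) (l : Prog e (.list .nat)) :
    (memP i l).val orc x = (l.val orc x : List ℕ).contains (i.val orc x : ℕ) := by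
  rw [memP, letE_val, foldE_val]
  simp only [val, eqP_val]
  exact (foldl_mem_eq _ _ _).trans (Bool.false_or _)

@[simp] theorem rangeP_val (n : Prog e .nat) :
    (rangeP n).val orc x = List.range (n.val orc x) := by
  have h : ∀ k : ℕ, (fun s : ℕ × List ℕ => (s.1 + 1, s.1 :: s.2))^[k] (0, [])
      = (k, (List.range k).reverse) := by
    intro k
    induction k with
    | zero => rfl
    | succ k ih => rw [Function.iterate_succ_apply', ih]; simp [List.range_succ]
  rw [rangeP, revP_val]
  simp only [val]
  rw [iterE_val]
  change (Prod.snd ((fun s : ℕ × List ℕ => (s.1 + 1, s.1 :: s.2))^[n.val orc x] (0, []))).reverse = _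
  rw [h]; simp

theorem foldl_enum {α : Type} (l : List α) (k : ℕ) (s : List (ℕ × α)) :
    List.foldl (fun (s : ℕ × List (ℕ × α)) y => (s.1 + 1, (s.1, y) :: s.2)) (k, s) l
      = (k + l.length, ((l.zipIdx k).map Prod.swap).reverse ++ s) := by
  induction l generalizing k s with
  | nil => rfl
  | cons y l ih =>
    rw [List.foldl_cons, ih]
    simp [List.zipIdx_cons]
    omega

@[simp] theorem enumP_val (l : Prog e (.list a)) :
    (enumP l).val orc x = (l.val orc x).zipIdx.map Prod.swap := by
  rw [enumP, revP_val]
  simp only [val]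
  rw [foldE_val]
  change (Prod.snd (List.foldl (fun (s : ℕ × List (ℕ × a.Val)) y => (s.1 + 1, (s.1, y) :: s.2))
    (0, []) (l.val orc x))).reverse = _
  rw [foldl_enum]; simp

/-! ### Running times -/

theorem letE_cost (u v : ℕ) (f : Prog e a) (g : Prog (.prod a e) b) :
    (letE f g).cost u v orc x = f.cost u v orc x + g.cost u v orc (f.val orc x, x) + 3 * u := by
  simp only [letE, cost, val]; ring

theorem addP_cost (u v : ℕ) (f g : Prog e .nat) :
    (addP f g).cost u v orc x = f.cost u v orc x + g.cost u v orc x + 3 * u := by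
  simp only [addP, cost]; ring

theorem subP_cost (u v : ℕ) (f g : Prog e .nat) :
    (subP f g).cost u v orc x = f.cost u v orc x + g.cost u v orc x + 3 * u := by
  simp only [subP, cost]; ring

theorem leP_cost (u v : ℕ) (f g : Prog e .nat) :
    (leP f g).cost u v orc x = f.cost u v orc x + g.cost u v orc x + 3 * u := by
  simp only [leP, cost]; ring

theorem consP_cost (u v : ℕ) (f : Prog e a) (g : Prog e (.list a)) :
    (consP f g).cost u v orc x = f.cost u v orc x + g.cost u v orc x + 3 * u := by
  simp only [consP, cost]; ring

theorem eqP_cost_le (f g : Prog e .nat) :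
    (eqP f g).cost 1 1 orc x ≤ f.cost 1 1 orc x + g.cost 1 1 orc x + 9 := by
  simp only [eqP, cost, leP_cost]
  cases natLe.val orc ((f.pair g).val orc x) <;> simp only [cond_true, cond_false] <;> omega

theorem andP_cost_le (f g : Prog e .bool) :
    (andP f g).cost 1 1 orc x ≤ f.cost 1 1 orc x + g.cost 1 1 orc x + 2 := by
  simp only [andP, cost]
  cases f.val orc x <;> simp only [cond_true, cond_false] <;> omega

theorem notP_cost (f : Prog e .bool) :
    (notP f).cost 1 1 orc x = f.cost 1 1 orc x + 2 := by
  simp only [notP, cost]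
  cases f.val orc x <;> simp only [cond_true, cond_false] <;> omega

theorem mulP_cost_le (f g : Prog e .nat) :
    (mulP f g).cost 1 1 orc x
      ≤ f.cost 1 1 orc x + g.cost 1 1 orc x + (f.val orc x : ℕ) * 9 + 13 := by
  rw [mulP, letE_cost]
  have := iterE_time_le (B := 7) orc (cnt := .seq .snd f) (init := .natConst 0)
    (body := addP .fst (.seq .snd .fst)) (x := (g.val orc x, x)) (fun _ _ => True) le_rfl le_rfl
    le_rfl trivial (fun _ _ _ _ => ⟨trivial, by simp only [addP_cost, cost]; omega⟩)
  simp only [cost, val] at this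
  omega

theorem powP_cost_le (f g : Prog e .nat) :
    (powP f g).cost 1 1 orc x
      ≤ f.cost 1 1 orc x + g.cost 1 1 orc x
        + (g.val orc x : ℕ) * ((f.val orc x : ℕ) * 9 + 19) + 13 := by
  rw [powP, letE_cost]
  have := iterE_time_le (B := (f.val orc x : ℕ) * 9 + 17) orc (cnt := .seq .snd g)
    (init := .natConst 1)
    (body := mulP (.seq .snd .fst) .fst) (x := (f.val orc x, x)) (fun _ _ => True) le_rfl le_rfl
    le_rfl trivial (fun _ _ s _ => ⟨trivial, by
      have := mulP_cost_le orc (s, (f.val orc x, x))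
        ((seq snd fst : Prog (.prod .nat (.prod .nat e)) .nat)) fst
      simp only [cost, val] at this
      omega⟩)
  simp only [cost, val, add_assoc, Nat.reduceAdd] at this ⊢
  omega

theorem lengthP_cost_le (l : Prog e (.list a)) :
    (lengthP l).cost 1 1 orc x ≤ l.cost 1 1 orc x + (l.val orc x).length * 19 + 8 := by
  have := foldE_time_le (B := 5) orc (init := .natConst 0) (lst := l)
    (body := addP .fst (.natConst 1)) (x := x) (fun _ _ => True) le_rfl le_rfl
    le_rfl trivial (fun _ _ _ _ _ _ => ⟨trivial, by simp only [addP_cost, cost]; omega⟩)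
  simp only [cost] at this
  rw [lengthP]
  omega

theorem tailP_cost_le (l : List a.Val) : (tailP (a := a)).cost 1 1 orc l ≤ 8 := by
  cases l <;> simp [tailP, cost, val]

theorem dropP_cost_le (n : Prog e .nat) (l : Prog e (.list a)) :
    (dropP n l).cost 1 1 orc x
      ≤ n.cost 1 1 orc x + l.cost 1 1 orc x + (n.val orc x : ℕ) * 12 + 7 := by
  have := iterE_time_le (B := 10) orc (cnt := n) (init := l)
    (body := .seq .fst tailP) (x := x) (fun _ _ => True) le_rfl le_rfl
    le_rfl trivial (fun _ _ s _ => ⟨trivial, by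
      have := tailP_cost_le orc s
      simp only [cost, val]; omega⟩)
  rw [dropP]
  omega

theorem nthP_cost_le (dflt : Prog .unit a) (n : Prog e .nat) (l : Prog e (.list a)) :
    (nthP dflt n l).cost 1 1 orc x
      ≤ n.cost 1 1 orc x + l.cost 1 1 orc x + dflt.cost 1 1 orc () + (n.val orc x : ℕ) * 12 + 14 := by
  have := dropP_cost_le orc x n l
  simp only [nthP, cost, val]
  cases (dropP n l).val orc x <;> simp only <;> omega

theorem memP_cost_le (i : Prog e .nat) (l : Prog e (.list .nat)) :
    (memP i l).cost 1 1 orc x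
      ≤ i.cost 1 1 orc x + l.cost 1 1 orc x + (l.val orc x).length * 35 + 13 := by
  rw [memP, letE_cost]
  have := foldE_time_le (B := 21) orc (init := .boolConst false) (lst := .seq .snd l)
    (body := (.cond (eqP (.seq .snd .fst) (.seq .snd (.seq .snd .fst))) (.boolConst true) .fst))
    (x := (i.val orc x, x)) (fun _ _ => True) le_rfl le_rfl
    le_rfl trivial (fun _ _ s _ y _ => ⟨trivial, by
      have := eqP_cost_le orc (s, y, i.val orc x, x)
        (.seq .snd .fst : Prog (.prod .bool (.prod .nat (.prod .nat e))) .nat)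
        (.seq .snd (.seq .snd .fst))
      simp only [cost] at this ⊢
      cases (eqP (.seq .snd .fst : Prog (.prod .bool (.prod .nat (.prod .nat e))) .nat)
        (.seq .snd (.seq .snd .fst))).val orc (s, y, i.val orc x, x) <;>
        simp only [cond_true, cond_false] <;> omega⟩)
  simp only [cost, val] at this
  omega

theorem rangeP_cost_le (n : Prog e .nat) :
    (rangeP n).cost 1 1 orc x ≤ n.cost 1 1 orc x + (n.val orc x : ℕ) * 16 + 16 := by
  have := iterE_time_le (B := 9) orc (cnt := n) (init := .pair (.natConst 0) .nil)
    (body := (.seq .fst (.pair (addP .fst (.natConst 1)) .cons)))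
    (x := x) (fun _ _ => True) le_rfl le_rfl
    le_rfl trivial (fun _ _ s _ => ⟨trivial, by simp only [cost, addP_cost]; omega⟩)
  have h := rangeP_val orc x n
  rw [rangeP, revP_val] at h
  have h2 := congrArg List.length h
  simp only [List.length_reverse, List.length_range] at h2
  rw [rangeP, revP_cost, h2]
  simp only [cost] at this ⊢
  omega

theorem enumP_cost_le (l : Prog e (.list a)) :
    (enumP l).cost 1 1 orc x ≤ l.cost 1 1 orc x + (l.val orc x).length * 45 + 18 := by
  have := foldE_time_le (B := 26) orc (init := .pair (.natConst 0) .nil) (lst := l)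
    (body := (.pair (addP (.seq .fst .fst) (.natConst 1))
      (consP (.pair (.seq .fst .fst) (.seq .snd .fst)) (.seq .fst .snd))))
    (x := x) (fun _ _ => True) le_rfl le_rfl
    le_rfl trivial (fun _ _ s _ _ _ => ⟨trivial, by
      simp only [cost, addP_cost, consP_cost]; omega⟩)
  have h := enumP_val orc x l
  rw [enumP, revP_val] at h
  have h2 := congrArg List.length h
  simp only [List.length_reverse, List.length_map, List.length_zipIdx] at h2
  rw [enumP, revP_cost, h2]
  simp only [cost] at this ⊢
  omega

/-! ### Absence of coins and queries -/

/-- Decides whether a program flips no coins. -/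
def isDet : {a b : Ty} → Prog a b → Bool
  | _, _, .seq f g => f.isDet && g.isDet
  | _, _, .pair f g => f.isDet && g.isDet
  | _, _, .cond t f g => t.isDet && (f.isDet && g.isDet)
  | _, _, .uncons f g => f.isDet && g.isDet
  | _, _, .iter f => f.isDet
  | _, _, .foldl f => f.isDet
  | _, _, .flip => false
  | _, _, _ => true

/-- Decides whether a program contains no queries. -/
def isQueryFree : {a b : Ty} → Prog a b → Bool
  | _, _, .seq f g => f.isQueryFree && g.isQueryFree
  | _, _, .pair f g => f.isQueryFree && g.isQueryFree
  | _, _, .cond t f g => t.isQueryFree && (f.isQueryFree && g.isQueryFree)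
  | _, _, .uncons f g => f.isQueryFree && g.isQueryFree
  | _, _, .iter f => f.isQueryFree
  | _, _, .foldl f => f.isQueryFree
  | _, _, .query => false
  | _, _, _ => true

theorem deterministic_of_isDet {P : Prog a b} (h : P.isDet = true) : P.Deterministic := by
  induction P <;> simp_all [isDet, Deterministic]

theorem queryFree_of_isQueryFree {P : Prog a b} (h : P.isQueryFree = true) : P.QueryFree := by
  induction P <;> simp_all [isQueryFree, QueryFree]

/-- Through the Boolean test, absence of queries in a concrete program is settled by evaluation. -/
theorem cost_queries_eq_zero {P : Prog a b} (h : P.isQueryFree = true) (x : a.Val) :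
    P.cost 0 1 orc x = 0 :=
  (queryFree_of_isQueryFree h).queries_eq x

end Prog

/-! ### The score of an element -/

/-- The selected points of a list, with their weights. -/
def weighted (w : List ℝ) (mask : List Bool) (pts : List ℕ) : List (ℝ × ℕ) :=
  (pts.filter fun p => mask.getD p false).map fun p => (w.getD p 0, p)

open Classical in
/-- Stable sorting by decreasing key. -/
noncomputable def sortDesc {α : Type} (l : List (ℝ × α)) : List (ℝ × α) :=
  l.mergeSort fun x y => decide (y.1 ≤ x.1)

/-- The sum of the keys of the first `t` entries. -/
def topSum {α : Type} (t : ℕ) (l : List (ℝ × α)) : ℝ := ((l.take t).map Prod.fst).sum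

/-- The total weight of the `t` heaviest selected points in `pts`. -/
noncomputable def score (w : List ℝ) (mask : List Bool) (t : ℕ) (pts : List ℕ) : ℝ :=
  topSum t (sortDesc (weighted w mask pts))

namespace Prog

/-- A selection of the points, and a number of points. -/
abbrev specTy : Ty := .prod (.list .bool) .nat

/-- A specification together with the input of the algorithm. -/
abbrev envTy : Ty := .prod specTy CoverageInstance.inputTy

/-- A list of pairs of a matroid and an element that is contracted in it, and the remaining
candidates with the lists of their matroids. -/
abbrev nodeTy : Ty := .prod (.list (.prod .nat .nat)) (.list (.prod .nat (.list .nat)))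

def weightedP : Prog (.prod (.list .nat) envTy) (.list (.prod .real .nat)) :=
  mapE (filterE .fst (nthP (.boolConst false) .fst (.seq .snd (.seq .snd (.seq .fst .fst)))))
    (.pair (nthP .realZero .fst (.seq .snd (.seq .snd (.seq .snd (.seq .snd (.seq .snd .fst))))))
      .fst)

/-- On an exhausted list the step leaves the sum unchanged, so `t` steps are correct even if fewer
than `t` points are selected. -/
def topStepP {a : Ty} : Prog (.prod .real (.list (.prod .real a))) (.prod .real (.list (.prod .real a))) :=
  .uncons (.pair .id .nil)
    (.pair (.seq (.pair .fst (.seq .snd (.seq .fst .fst))) .realAdd) (.seq .snd .snd))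

def scoreP : Prog (.prod (.list .nat) envTy) .real :=
  .seq (iterE (.seq .snd (.seq .fst .snd)) (.pair .realZero (.seq weightedP .sort))
    (.seq .fst topStepP)) .fst

variable (orc : ℕ → List ℕ → Bool)

theorem weightedP_val (x : (Ty.prod (.list .nat) envTy).Val) :
    weightedP.val orc x = weighted x.2.2.2.2.1 x.2.1.1 x.1 := by
  rw [weightedP, mapE_val, filterE_val]
  simp only [val, nthP_val]
  rfl

theorem weightedP_cost_le (x : (Ty.prod (.list .nat) envTy).Val) {m : ℕ}
    (hm : x.1.length ≤ m) (hp : ∀ p ∈ x.1, (p : ℕ) ≤ m) :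
    weightedP.cost 1 1 orc x ≤ m * (24 * m + 110) + 30 := by
  have hlen : ((filterE .fst (nthP (.boolConst false) .fst (.seq .snd (.seq .snd (.seq .fst .fst)))) :
      Prog (.prod (.list .nat) envTy) (.list .nat)).val orc x).Sublist x.1 := by
    rw [filterE_val]; exact List.filter_sublist
  refine (mapE_time_le orc (B := 12 * m + 32) (n := m) (tl := m * (12 * m + 53) + 14) ?_
    (hlen.length_le.trans hm) ?_).trans ?_
  · refine (filterE_time_le orc (lst := .fst) (x := x) (B := 12 * m + 23) (n := m) le_rfl hm
      ?_).trans ?_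
    · intro (p : ℕ) hp'
      have h := nthP_cost_le orc (p, x) (.boolConst false) .fst
        (.seq .snd (.seq .snd (.seq .fst .fst)) :
          Prog (.prod .nat (.prod (.list .nat) envTy)) (.list .bool))
      have : p ≤ m := hp p hp'
      simp only [cost, val] at h ⊢
      omega
    · simp only [cost]; ring_nf; omega
  · intro (p : ℕ) hp'
    have h := nthP_cost_le orc (p, x) .realZero .fst
      (.seq .snd (.seq .snd (.seq .snd (.seq .snd (.seq .snd .fst)))) :
        Prog (.prod .nat (.prod (.list .nat) envTy)) (.list .real))
    have : p ≤ m := hp p (hlen.subset hp')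
    simp only [cost, val] at h ⊢
    omega
  · ring_nf; omega

theorem topSum_succ {α : Type} (t : ℕ) (l : List (ℝ × α)) :
    topSum (t + 1) l = topSum 1 l + topSum t l.tail := by
  cases l <;> simp [topSum]

theorem topStepP_val {a : Ty} (s : (Ty.prod .real (.list (.prod .real a))).Val) :
    (topStepP (a := a)).val orc s = (s.1 + topSum 1 s.2, s.2.tail) := by
  obtain ⟨s, l⟩ := s
  cases l <;> simp [topStepP, val, topSum]

theorem topStepP_iterate {a : Ty} (t : ℕ) (s : ℝ) (l : List (ℝ × a.Val)) :
    ((topStepP (a := a)).val orc)^[t] (s, l) = (s + topSum t l, l.drop t) := by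
  induction t generalizing s l with
  | zero => simp [topSum]
  | succ t ih =>
    rw [Function.iterate_succ_apply, topStepP_val, ih, topSum_succ t l]; simp [add_assoc]

theorem topStepP_cost_le {a : Ty} (s : (Ty.prod .real (.list (.prod .real a))).Val) :
    (topStepP (a := a)).cost 1 1 orc s ≤ 15 := by
  obtain ⟨s, l⟩ := s
  cases l <;> simp [topStepP, cost]

theorem scoreP_val (x : (Ty.prod (.list .nat) envTy).Val) :
    scoreP.val orc x = score x.2.2.2.2.1 x.2.1.1 x.2.1.2 x.1 := by
  simp only [scoreP, val, iterE_val]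
  rw [weightedP_val]
  refine (congrArg Prod.fst (topStepP_iterate (a := .nat) orc x.2.1.2 0
    (sortDesc (weighted x.2.2.2.2.1 x.2.1.1 x.1)))).trans ?_
  simp [score]

/-- Quadratic in `m`, because the mask and the weights are lists and reading an entry means walking
to it. The sorting of the points is bounded crudely, using that the logarithm of a length is at most
the length. -/
theorem scoreP_cost_le (x : (Ty.prod (.list .nat) envTy).Val) {m : ℕ}
    (hm : x.1.length ≤ m) (hp : ∀ p ∈ x.1, (p : ℕ) ≤ m) :
    scoreP.cost 1 1 orc x ≤ 112 * (m + 1) ^ 2 + 20 * x.2.1.2 := by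
  have h1 := weightedP_cost_le orc x hm hp
  have hlen : (weighted x.2.2.2.2.1 x.2.1.1 x.1).length ≤ m := by
    rw [weighted, List.length_map]; exact (List.length_filter_le _ _).trans hm
  have hsort : (weighted x.2.2.2.2.1 x.2.1.1 x.1).length
      * (Nat.clog 2 (weighted x.2.2.2.2.1 x.2.1.1 x.1).length + 1) ≤ m * (m + 1) :=
    Nat.mul_le_mul hlen (Nat.succ_le_succ (Nat.clog_le_of_le_pow
      (hlen.trans (Nat.lt_two_pow_self).le)))
  have h2 := iterE_time_le (B := 17) orc (cnt := .seq .snd (.seq .fst .snd))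
    (init := .pair .realZero (.seq weightedP .sort))
    (body := .seq .fst topStepP) (x := x) (fun _ _ => True)
    le_rfl le_rfl le_rfl trivial (fun _ _ s _ => ⟨trivial, by
      have := topStepP_cost_le orc s
      simp only [cost, val]
      omega⟩)
  simp only [scoreP, cost, val, weightedP_val] at h2 ⊢
  nlinarith

/-! ### The candidates of a specification -/

/-- All elements with the lists of their matroids, keyed by score. -/
def scoredP : Prog envTy (.list (.prod .real (.prod .nat (.list .nat)))) :=
  mapE (enumP (.seq .snd (.seq .snd (.seq .snd .snd))))
    (.pair (.seq (.pair (.seq .fst (.seq .snd .snd)) .snd) scoreP)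
      (.pair (.seq .fst .fst) (.seq .fst (.seq .snd .fst))))

/-- All elements with the lists of their matroids, by decreasing score. -/
def candidatesP : Prog envTy (.list (.prod .nat (.list .nat))) :=
  mapE (.seq scoredP .sort) (.seq .fst .snd)

end Prog

/-- All elements with the lists of their matroids, keyed by score. -/
noncomputable def scored (w : List ℝ) (mask : List Bool) (t : ℕ) (els : List (List ℕ × List ℕ)) :
    List (ℝ × ℕ × List ℕ) :=
  els.zipIdx.map fun y => (score w mask t y.1.2, y.2, y.1.1)

/-- All elements with the lists of their matroids, by decreasing score. -/
noncomputable def candidates (w : List ℝ) (mask : List Bool) (t : ℕ)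
    (els : List (List ℕ × List ℕ)) : List (ℕ × List ℕ) :=
  (sortDesc (scored w mask t els)).map Prod.snd

namespace Prog

variable (orc : ℕ → List ℕ → Bool)

theorem scoredP_val (x : envTy.Val) :
    scoredP.val orc x = scored x.2.2.2.1 x.1.1 x.1.2 x.2.2.2.2 := by
  rw [scoredP, mapE_val, enumP_val]
  simp only [val, scoreP_val]
  rw [List.map_map]
  rfl

theorem candidatesP_val (x : envTy.Val) :
    candidatesP.val orc x = candidates x.2.2.2.1 x.1.1 x.1.2 x.2.2.2.2 := by
  rw [candidatesP, mapE_val]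
  simp only [val, scoredP_val]
  rfl

theorem sortDesc_length {α : Type} (l : List (ℝ × α)) : (sortDesc l).length = l.length := by
  simp [sortDesc]

theorem scored_length (w : List ℝ) (mask : List Bool) (t : ℕ) (els : List (List ℕ × List ℕ)) :
    (scored w mask t els).length = els.length := by simp [scored]

/-- Sorting the elements is kept as a separate summand, as it is the only cost that is not linear in
`n`. -/
theorem candidatesP_cost_le (x : envTy.Val) {n m : ℕ} (hn : x.2.2.2.2.length = n)
    (hm : ∀ y ∈ x.2.2.2.2, y.2.length ≤ m ∧ ∀ p ∈ y.2, (p : ℕ) ≤ m) :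
    candidatesP.cost 1 1 orc x ≤ n * (Nat.clog 2 n + 1)
        + (n + 1) * (112 * (m + 1) ^ 2 + 20 * x.1.2 + 150) := by
  have hs : scoredP.cost 1 1 orc x ≤ n * (112 * (m + 1) ^ 2 + 20 * x.1.2 + 95) + 45 := by
    have he := enumP_cost_le orc x (.seq .snd (.seq .snd (.seq .snd .snd)))
    refine (mapE_time_le orc (B := 112 * (m + 1) ^ 2 + 20 * x.1.2 + 23) (n := n) he
      ?_ ?_).trans ?_
    · rw [enumP_val]; simp [val, hn]
    · intro y hy
      rw [enumP_val, List.mem_map] at hy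
      obtain ⟨⟨⟨ms, pts⟩, i⟩, hy', rfl⟩ := hy
      have hmem : (ms, pts) ∈ x.2.2.2.2 := List.fst_mem_of_mem_zipIdx hy'
      obtain ⟨h1, h2⟩ := hm _ hmem
      have := scoreP_cost_le orc (pts, x) h1 h2
      simp only [cost, val, Prod.swap] at this ⊢
      omega
    · simp only [cost, val, hn]
      ring_nf; omega
  refine (mapE_time_le orc (B := 3) (n := n) le_rfl ?_ ?_).trans ?_
  · simp only [val, scoredP_val]
    exact ((sortDesc_length _).trans (scored_length ..)).trans hn |>.le
  · intro y _; simp only [cost]; omega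
  · simp only [cost, scoredP_val, scored_length, hn]
    ring_nf at hs ⊢
    omega

end Prog

/-! ### The search tree -/

/-- Contracted elements with their matroids, and the remaining candidates. -/
abbrev SearchNode : Type := List (ℕ × ℕ) × List (ℕ × List ℕ)

/-- The elements contracted in the `i`-th matroid. -/
def contracted (i : ℕ) (B : List (ℕ × ℕ)) : List ℕ := (B.filter fun b => b.1 == i).map Prod.snd

/-- Contract `v` in the `i`-th matroid. -/
def childNode (orc : ℕ → List ℕ → Bool) (B : List (ℕ × ℕ)) (v : ℕ) (l : List (ℕ × List ℕ))
    (i : ℕ) : SearchNode :=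
  ((i, v) :: B, l.filter fun c =>
    bif c.2.contains i then orc i (c.1 :: v :: contracted i B) else true)

/-- The children of a node arise by contracting the first candidate in one of its matroids. -/
def childNodes (orc : ℕ → List ℕ → Bool) : SearchNode → List SearchNode
  | (_, []) => []
  | (B, c :: l) => c.2.map (childNode orc B c.1 l)

/-- The first candidate of a node. -/
def headCandidate : SearchNode → List ℕ
  | (_, []) => []
  | (_, c :: _) => [c.1]

/-- Output the first candidates of all nodes of a level. -/
def collect (st : List ℕ × List SearchNode) : List ℕ :=
  (st.2.flatMap headCandidate).reverse ++ st.1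

/-- Pass to the next level of the search tree. -/
def nextLevel (orc : ℕ → List ℕ → Bool) (st : List ℕ × List SearchNode) :
    List ℕ × List SearchNode :=
  (collect st, st.2.flatMap (childNodes orc))

/-- The first candidates of all nodes of depth at most `D`. -/
def treeOutput (orc : ℕ → List ℕ → Bool) (D : ℕ) (cands : List (ℕ × List ℕ)) : List ℕ :=
  collect ((nextLevel orc)^[D] ([], [([], cands)]))

namespace Prog

/-- The environment of the program for a child: matroid, contracted elements, first candidate,
other candidates. -/
abbrev childTy : Ty :=
  .prod .nat (.prod (.list (.prod .nat .nat))
    (.prod (.prod .nat (.list .nat)) (.list (.prod .nat (.list .nat)))))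

def queryListP : Prog childTy (.list .nat) :=
  consP (.seq .snd (.seq .snd (.seq .fst .fst)))
    (mapE (filterE (.seq .snd .fst) (eqP (.seq .fst .fst) (.seq .snd .fst))) (.seq .fst .snd))

def childTestP : Prog (.prod (.prod .nat (.list .nat)) (.prod (.list .nat) childTy)) .bool :=
  .cond (memP (.seq .snd (.seq .snd .fst)) (.seq .fst .snd))
    (.seq (.pair (.seq .snd (.seq .snd .fst)) (consP (.seq .fst .fst) (.seq .snd .fst))) .query)
    (.boolConst true)

def childP : Prog childTy nodeTy :=
  .pair (consP (.pair .fst (.seq .snd (.seq .snd (.seq .fst .fst)))) (.seq .snd .fst))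
    (letE queryListP (filterE (.seq .snd (.seq .snd (.seq .snd .snd))) childTestP))

def childrenP : Prog nodeTy (.list nodeTy) :=
  .uncons .nil (mapE (.seq .snd (.seq .fst .snd)) childP)

def headP : Prog nodeTy (.list .nat) :=
  .uncons .nil (consP (.seq .snd (.seq .fst .fst)) .nil)

def collectP : Prog (.prod (.list .nat) (.list nodeTy)) (.list .nat) :=
  revAppP (flatMapE .snd (.seq .fst headP)) .fst

def levelP : Prog (.prod (.list .nat) (.list nodeTy)) (.prod (.list .nat) (.list nodeTy)) :=
  .pair collectP (flatMapE .snd (.seq .fst childrenP))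

/-- The depth `(z - 1) * ℓ` of the search tree. -/
def depthP : Prog envTy .nat :=
  mulP (subP (.seq .snd (.seq .snd .fst)) (.natConst 1)) (.seq .snd .fst)

def treeP : Prog envTy (.list .nat) :=
  .seq (iterE depthP
    (.pair .nil (consP (.pair .nil candidatesP) .nil)) (.seq .fst levelP)) collectP

variable (orc : ℕ → List ℕ → Bool)

theorem queryListP_val (x : childTy.Val) :
    queryListP.val orc x = x.2.2.1.1 :: contracted x.1 x.2.1 := by
  rw [queryListP, consP_val, mapE_val, filterE_val]
  simp only [val, eqP_val]
  rfl

theorem childTestP_val (x : (Ty.prod (.prod .nat (.list .nat)) (.prod (.list .nat) childTy)).Val) :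
    childTestP.val orc x = bif List.contains (α := ℕ) x.1.2 x.2.2.1
      then orc x.2.2.1 (x.1.1 :: x.2.1) else true := by
  simp only [childTestP, val, memP_val, consP_val]

theorem childP_val (x : childTy.Val) :
    childP.val orc x = childNode orc x.2.1 x.2.2.1.1 x.2.2.2 x.1 := by
  simp only [childP, val, consP_val, letE_val, filterE_val, queryListP_val, childTestP_val]
  rfl

theorem childrenP_val (x : nodeTy.Val) : childrenP.val orc x = childNodes orc x := by
  obtain ⟨B, l⟩ := x
  cases l with
  | nil => rfl
  | cons c l =>
    simp only [childrenP, val, mapE_val, childP_val]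
    rfl

theorem headP_val (x : nodeTy.Val) : headP.val orc x = headCandidate x := by
  obtain ⟨B, l⟩ := x
  cases l <;> rfl

theorem collectP_val (x : (Ty.prod (.list .nat) (.list nodeTy)).Val) :
    collectP.val orc x = collect x := by
  simp only [collectP, revAppP_val, flatMapE_val, val, headP_val]
  rfl

theorem levelP_val (x : (Ty.prod (.list .nat) (.list nodeTy)).Val) :
    levelP.val orc x = nextLevel orc x := by
  simp only [levelP, val, flatMapE_val, childrenP_val, collectP_val]
  rfl

theorem depthP_val (x : envTy.Val) {ℓ z : ℕ} (hℓ : x.2.1 = ℓ) (hz : x.2.2.1 = z) :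
    depthP.val orc x = (z - 1) * ℓ := by
  subst hℓ hz
  simp only [depthP, mulP_val, subP_val]
  rfl

theorem treeP_val (x : envTy.Val) {ℓ z : ℕ} (hℓ : x.2.1 = ℓ) (hz : x.2.2.1 = z) :
    treeP.val orc x = treeOutput orc ((z - 1) * ℓ)
      (candidates x.2.2.2.1 x.1.1 x.1.2 x.2.2.2.2) := by
  simp only [treeP, val, collectP_val, iterE_val, levelP_val, depthP_val orc x hℓ hz, consP_val,
    candidatesP_val]
  rfl

end Prog

/-! ### Sizes of the levels -/

/-- A node of depth `d`, with at most `n` candidates, each of which is in at most `ℓ` matroids. -/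
structure NodeBounds (ℓ n d : ℕ) (x : SearchNode) : Prop where
  depth : x.1.length = d
  size : x.2.length ≤ n
  matroids : ∀ c ∈ x.2, c.2.length ≤ ℓ

/-- Bounds for a level of the search tree. -/
structure LevelBounds (ℓ n d : ℕ) (st : List ℕ × List SearchNode) : Prop where
  nodes : ∀ x ∈ st.2, NodeBounds ℓ n d x
  width : st.2.length ≤ ℓ ^ d
  output : st.1.length ≤ ∑ q ∈ Finset.range d, ℓ ^ q

variable {ℓ n d : ℕ}

theorem NodeBounds.childNode {orc : ℕ → List ℕ → Bool} {B : List (ℕ × ℕ)} {c : ℕ × List ℕ}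
    {l : List (ℕ × List ℕ)} (h : NodeBounds ℓ n d (B, c :: l)) (i : ℕ) :
    NodeBounds ℓ n (d + 1) (childNode orc B c.1 l i) := by
  have hs : List.Sublist (_root_.childNode orc B c.1 l i).2 l := List.filter_sublist
  exact ⟨by have := h.depth; simpa [_root_.childNode] using this,
    hs.length_le.trans ((Nat.le_succ _).trans h.size),
    fun y hy => h.matroids y (List.mem_cons_of_mem _ (hs.subset hy))⟩

theorem NodeBounds.of_mem_childNodes {orc : ℕ → List ℕ → Bool} {x y : SearchNode}
    (h : NodeBounds ℓ n d x) (hy : y ∈ childNodes orc x) : NodeBounds ℓ n (d + 1) y := by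
  obtain ⟨B, l⟩ := x
  cases l with
  | nil => simp [childNodes] at hy
  | cons c l =>
    obtain ⟨i, -, rfl⟩ := List.mem_map.1 hy
    exact h.childNode i

theorem NodeBounds.childNodes_length_le {orc : ℕ → List ℕ → Bool} {x : SearchNode}
    (h : NodeBounds ℓ n d x) : (childNodes orc x).length ≤ ℓ := by
  obtain ⟨B, l⟩ := x
  cases l with
  | nil => simp [childNodes]
  | cons c l => simpa [childNodes] using h.matroids c (by simp)

theorem headCandidate_length_le (x : SearchNode) : (headCandidate x).length ≤ 1 := by
  obtain ⟨B, l⟩ := x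
  cases l <;> simp [headCandidate]

theorem length_flatMap_le {α β : Type} {l : List α} {f : α → List β} {k w : ℕ}
    (hl : l.length ≤ w) (h : ∀ x ∈ l, (f x).length ≤ k) : (l.flatMap f).length ≤ w * k := by
  rw [List.length_flatMap]
  exact Prog.sum_map_le hl h

theorem LevelBounds.collect_length_le {st : List ℕ × List SearchNode} (h : LevelBounds ℓ n d st) :
    (collect st).length ≤ ∑ q ∈ Finset.range (d + 1), ℓ ^ q := by
  have := length_flatMap_le h.width (fun x _ => headCandidate_length_le x)
  have h2 := h.output
  rw [Finset.sum_range_succ, collect, List.length_append, List.length_reverse]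
  omega

theorem LevelBounds.nextLevel {orc : ℕ → List ℕ → Bool} {st : List ℕ × List SearchNode}
    (h : LevelBounds ℓ n d st) : LevelBounds ℓ n (d + 1) (nextLevel orc st) where
  nodes y hy := by
    obtain ⟨x, hx, hy⟩ := List.mem_flatMap.1 hy
    exact (h.nodes x hx).of_mem_childNodes hy
  width := by
    rw [pow_succ]
    exact length_flatMap_le h.width fun x hx => (h.nodes x hx).childNodes_length_le
  output := h.collect_length_le

theorem LevelBounds.root {cands : List (ℕ × List ℕ)} (hn : cands.length ≤ n)
    (hℓ : ∀ c ∈ cands, c.2.length ≤ ℓ) : LevelBounds ℓ n 0 ([], [([], cands)]) where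
  nodes x hx := by
    obtain rfl := List.mem_singleton.1 hx
    exact ⟨rfl, hn, hℓ⟩
  width := by simp
  output := by simp

theorem LevelBounds.iterate {orc : ℕ → List ℕ → Bool} {st : List ℕ × List SearchNode}
    (h : LevelBounds ℓ n 0 st) (k : ℕ) : LevelBounds ℓ n k ((_root_.nextLevel orc)^[k] st) := by
  induction k with
  | zero => exact h
  | succ k ih => rw [Function.iterate_succ_apply']; exact ih.nextLevel

/-- Each node contributes at most one element, and there are at most `ℓ ^ d` nodes of depth `d`; the
sum over all depths up to `(z - 1) * ℓ` is `Γbound ℓ z`. -/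
theorem treeOutput_length_le (orc : ℕ → List ℕ → Bool) (z : ℕ) {cands : List (ℕ × List ℕ)}
    (hℓ : ∀ c ∈ cands, c.2.length ≤ ℓ) :
    (treeOutput orc ((z - 1) * ℓ) cands).length ≤ Γbound ℓ z :=
  ((LevelBounds.root le_rfl hℓ).iterate _).collect_length_le

theorem treeOutput_subset {orc : ℕ → List ℕ → Bool} {D : ℕ} {cands : List (ℕ × List ℕ)} :
    ∀ v ∈ treeOutput orc D cands, ∃ c ∈ cands, c.1 = v := by
  have key : ∀ k, (∀ v ∈ ((nextLevel orc)^[k] ([], [([], cands)])).1, ∃ c ∈ cands, c.1 = v) ∧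
      ∀ x ∈ ((nextLevel orc)^[k] ([], [([], cands)])).2, ∀ c ∈ x.2, c ∈ cands := by
    intro k
    induction k with
    | zero => simp
    | succ k ih =>
      rw [Function.iterate_succ_apply']
      refine ⟨?_, ?_⟩
      · intro v hv
        rcases List.mem_append.1 hv with hv | hv
        · obtain ⟨⟨B, l⟩, hx, hv⟩ := List.mem_flatMap.1 (List.mem_reverse.1 hv)
          cases l with
          | nil => simp [headCandidate] at hv
          | cons c l => exact ⟨c, ih.2 _ hx c (by simp), (List.mem_singleton.1 hv).symm⟩
        · exact ih.1 v hv
      · intro y hy c hc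
        obtain ⟨⟨B, l⟩, hx, hy⟩ := List.mem_flatMap.1 hy
        cases l with
        | nil => simp [childNodes] at hy
        | cons c' l =>
          obtain ⟨i, -, rfl⟩ := List.mem_map.1 hy
          exact ih.2 _ hx c (List.mem_cons_of_mem _ (List.mem_of_mem_filter hc))
  have h := (key (D + 1)).1
  rwa [Function.iterate_succ_apply'] at h

/-! ### Cost of the search tree -/

/-- The bound may vary with the step. For the levels of the tree this preserves the geometric sum,
which a uniform bound would lose. -/
theorem iterCost_le_sum {α : Type} {f : α → α} {c : α → ℕ} (Inv : ℕ → α → Prop) {B : ℕ → ℕ}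
    {k : ℕ} {x : α} (h0 : Inv 0 x)
    (hs : ∀ i < k, ∀ y, Inv i y → Inv (i + 1) (f y) ∧ c y ≤ B i) :
    iterCost f c k x ≤ ∑ i ∈ Finset.range k, B i := by
  induction k generalizing x Inv B with
  | zero => simp [iterCost]
  | succ k ih =>
    have h1 := hs 0 (Nat.succ_pos _) x h0
    have h2 := ih (fun i => Inv (i + 1)) (x := f x) (B := fun i => B (i + 1)) h1.1
      (fun i hi y hy => hs (i + 1) (by omega) y hy)
    rw [Finset.sum_range_succ']
    simp only [iterCost]
    linarith [h1.2, h2]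

namespace Prog

variable (orc : ℕ → List ℕ → Bool)

theorem childTestP_queries_le (x : (Ty.prod (.prod .nat (.list .nat)) (.prod (.list .nat) childTy)).Val) :
    childTestP.cost 0 1 orc x ≤ 1 := by
  have hmem : (memP (.seq .snd (.seq .snd .fst)) (.seq .fst .snd) :
    Prog (.prod (.prod .nat (.list .nat)) (.prod (.list .nat) childTy)) .bool).cost 0 1 orc x = 0 :=
    cost_queries_eq_zero orc (by decide) x
  simp only [childTestP, cost, hmem, consP_cost]
  cases (memP (.seq .snd (.seq .snd .fst)) (.seq .fst .snd) :
    Prog (.prod (.prod .nat (.list .nat)) (.prod (.list .nat) childTy)) .bool).val orc x <;> simp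

theorem queryListP_isQueryFree : queryListP.isQueryFree = true := by decide

theorem candidatesP_isQueryFree : candidatesP.isQueryFree = true := by decide

theorem collectP_isQueryFree : collectP.isQueryFree = true := by decide

theorem childP_queries_le (x : childTy.Val) : childP.cost 0 1 orc x ≤ x.2.2.2.length := by
  have hq := cost_queries_eq_zero orc queryListP_isQueryFree x
  have hf := filterE_cost_le (u := 0) (v := 1) orc
    (.seq .snd (.seq .snd (.seq .snd .snd)) : Prog (.prod (.list .nat) childTy) _) childTestP
    (queryListP.val orc x, x)
  have hs := sum_map_le (f := fun y => childTestP.cost 0 1 orc (y, queryListP.val orc x, x) + 30 * 0)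
    (l := x.2.2.2) (B := 1) le_rfl (fun y _ => childTestP_queries_le orc _)
  simp only [cost, val] at hf hs
  simp only [childP, cost, consP_cost, letE_cost, hq]
  omega

theorem childrenP_queries_le (x : nodeTy.Val) (h : NodeBounds ℓ n d x) :
    childrenP.cost 0 1 orc x ≤ ℓ * n := by
  obtain ⟨B, l⟩ := x
  cases l with
  | nil => simp [childrenP, cost]
  | cons c l =>
    simp only [childrenP, cost, mapE_cost, val, mul_zero, zero_add, add_zero]
    have hc : c.2.length ≤ ℓ := h.matroids c (by simp)
    have hl : l.length ≤ n := (Nat.le_succ _).trans h.size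
    exact sum_map_le hc fun y _ => (childP_queries_le orc (y, B, c, l)).trans hl

theorem levelP_queries_le (st : List ℕ × List SearchNode) (h : LevelBounds ℓ n d st) :
    levelP.cost 0 1 orc st ≤ n * ℓ ^ (d + 1) := by
  have hc := cost_queries_eq_zero orc collectP_isQueryFree st
  simp only [levelP, cost, flatMapE_cost, hc, val, mul_zero, zero_add, add_zero]
  refine le_trans ?_ (le_of_eq (by ring : ℓ ^ d * (ℓ * n) = n * ℓ ^ (d + 1)))
  exact sum_map_le h.width fun y hy => childrenP_queries_le orc y (h.nodes y hy)

theorem levelBounds_candidates (x : envTy.Val) (hn : x.2.2.2.2.length = n)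
    (hℓ : ∀ y ∈ x.2.2.2.2, y.1.length ≤ ℓ) :
    LevelBounds ℓ n 0 ([], [([], candidates x.2.2.2.1 x.1.1 x.1.2 x.2.2.2.2)]) := by
  refine LevelBounds.root ?_ ?_
  · rw [candidates, List.length_map, sortDesc_length, scored_length, hn]
  · intro c hc
    obtain ⟨y, hy, rfl⟩ := List.mem_map.1 hc
    rw [sortDesc, List.mem_mergeSort] at hy
    obtain ⟨y', hy', rfl⟩ := List.mem_map.1 hy
    exact hℓ _ (List.fst_mem_of_mem_zipIdx hy')

/-- Building level `d + 1` needs at most one query per candidate for each of at most `ℓ ^ (d + 1)`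
children. Summed over `d` this is `n` times `Γbound ℓ z` without its first term. -/
theorem treeP_queries_le (x : envTy.Val) {z : ℕ} (hℓ : x.2.1 = ℓ) (hz : x.2.2.1 = z)
    (hn : x.2.2.2.2.length = n) (hmat : ∀ y ∈ x.2.2.2.2, y.1.length ≤ ℓ) :
    treeP.cost 0 1 orc x ≤ n * Γbound ℓ z := by
  have hc := cost_queries_eq_zero orc collectP_isQueryFree
  have hcand := cost_queries_eq_zero orc candidatesP_isQueryFree x
  have hm : depthP.cost 0 1 orc x = 0 := cost_queries_eq_zero orc (by decide) x
  have := iterCost_le_sum (f := fun y : (Ty.prod (.list .nat) (.list nodeTy)).Val => levelP.val orc y)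
    (c := fun y => 0 + (0 + levelP.cost 0 1 orc y) + 2 * 0)
    (LevelBounds ℓ n) (B := fun d => n * ℓ ^ (d + 1))
    (k := (z - 1) * ℓ) (levelBounds_candidates x hn hmat)
    (fun i _ y hy => ⟨by rw [levelP_val]; exact hy.nextLevel, by
      have := levelP_queries_le orc y hy; omega⟩)
  have h2 : treeP.cost 0 1 orc x = iterCost
    (fun y : (Ty.prod (.list .nat) (.list nodeTy)).Val => levelP.val orc y)
    (fun y => 0 + (0 + levelP.cost 0 1 orc y) + 2 * 0) ((z - 1) * ℓ)
      ([], [([], candidates x.2.2.2.1 x.1.1 x.1.2 x.2.2.2.2)]) := by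
    simp only [treeP, cost, iterE_cost, hc, hm, hcand, consP_cost, val, depthP_val orc x hℓ hz,
      consP_val, candidatesP_val]
    simp only [mul_zero, zero_add, add_zero]
  rw [h2, Γbound, Finset.sum_range_succ', mul_add, Finset.mul_sum]
  exact this.trans (Nat.le_add_right _ _)

theorem childP_cost_le {B : List (ℕ × ℕ)} {c : ℕ × List ℕ} {l : List (ℕ × List ℕ)}
    (h : NodeBounds ℓ n d (B, c :: l)) (i : ℕ) :
    childP.cost 1 1 orc (i, B, c, l) ≤ 200 * ((ℓ + 1) * (n + 1) * (d + 1)) := by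
  have hf : (filterE (.seq .snd .fst) (eqP (.seq .fst .fst) (.seq .snd .fst)) :
      Prog childTy _).cost 1 1 orc (i, B, c, l) ≤ 3 + d * (15 + 30) + 12 := by
    refine filterE_time_le orc (by simp [cost]) h.depth.le fun y _ => ?_
    refine (eqP_cost_le orc _ _ _).trans ?_
    simp [cost]
  have hlen : ((filterE (.seq .snd .fst) (eqP (.seq .fst .fst) (.seq .snd .fst)) :
      Prog childTy _).val orc (i, B, c, l)).length ≤ d := by
    rw [filterE_val]
    exact (List.length_filter_le _ _).trans h.depth.le
  have hm := mapE_time_le (B := 3) orc (body := .seq .fst .snd) hf hlen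
    (fun y _ => by simp [cost])
  have hq : queryListP.cost 1 1 orc (i, B, c, l) ≤ 80 * d + 50 := by
    simp only [queryListP, consP_cost, cost]
    omega
  have ht := filterE_time_le (B := 35 * ℓ + 40) (n := n) orc
    (lst := .seq .snd (.seq .snd (.seq .snd .snd))) (test := childTestP)
    (x := (queryListP.val orc (i, B, c, l), i, B, c, l)) le_rfl ((Nat.le_succ _).trans h.size)
    (fun y hy => by
      have hm := memP_cost_le orc (y, queryListP.val orc (i, B, c, l), i, B, c, l)
        (.seq .snd (.seq .snd .fst) : Prog (.prod (.prod .nat (.list .nat))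
          (.prod (.list .nat) childTy)) .nat) (.seq .fst .snd)
      have hy' : List.length y.2 ≤ ℓ := h.matroids y (List.mem_cons_of_mem _ hy)
      simp only [cost, val] at hm
      simp only [childTestP, cost, consP_cost]
      cases (memP (.seq .snd (.seq .snd .fst)) (.seq .fst .snd) :
        Prog (.prod (.prod .nat (.list .nat)) (.prod (.list .nat) childTy)) .bool).val orc
          (y, queryListP.val orc (i, B, c, l), i, B, c, l) <;>
        simp only [cond_true, cond_false] <;> omega)
  simp only [childP, cost, consP_cost, letE_cost] at ht ⊢
  ring_nf at ht ⊢
  omega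

theorem childrenP_cost_le (x : nodeTy.Val) (h : NodeBounds ℓ n d x) :
    childrenP.cost 1 1 orc x ≤ 300 * ((ℓ + 1) ^ 2 * (n + 1) * (d + 1)) := by
  obtain ⟨B, l⟩ := x
  cases l with
  | nil =>
    simp only [childrenP, cost]
    have : 1 ≤ (ℓ + 1) ^ 2 * (n + 1) * (d + 1) := Nat.succ_le_of_lt (by positivity)
    omega
  | cons c l =>
    simp only [childrenP, cost]
    have := mapE_time_le orc (lst := .seq .snd (.seq .fst .snd)) (body := childP) (x := (B, c, l))
      le_rfl (h.matroids c (by simp)) (fun y _ => childP_cost_le orc h y)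
    simp only [cost] at this
    ring_nf at this ⊢
    omega

theorem headP_cost_le (x : nodeTy.Val) : headP.cost 1 1 orc x ≤ 10 := by
  obtain ⟨B, l⟩ := x
  cases l <;> simp [headP, cost, consP_cost]

theorem collectP_cost_le (st : (Ty.prod (.list .nat) (.list nodeTy)).Val) :
    collectP.cost 1 1 orc st ≤ 60 * st.2.length + 20 := by
  have h1 := flatMapE_time_le (B := 12) (k := 1) orc
    (lst := (.snd : Prog (.prod (.list .nat) (.list nodeTy)) (.list nodeTy)))
    (body := .seq .fst headP)
    (x := st) (tl := 1) le_rfl le_rfl (fun y _ => by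
      have := headP_cost_le orc y; simp only [cost, val]; omega)
    (fun y _ => by simp only [val, headP_val]; exact headCandidate_length_le _)
  have h2 : ((flatMapE .snd (.seq .fst headP) : Prog (.prod (.list .nat) (.list nodeTy)) _).val
      orc st).length ≤ st.2.length := by
    simp only [flatMapE_val, val, headP_val]
    exact (length_flatMap_le le_rfl fun x _ => headCandidate_length_le x).trans (mul_one _).le
  simp only [val] at h1
  simp only [collectP, revAppP_cost, cost]
  omega

theorem levelP_cost_le (st : (Ty.prod (.list .nat) (.list nodeTy)).Val) (h : LevelBounds ℓ n d st) :
    levelP.cost 1 1 orc st ≤ 500 * ((ℓ + 1) ^ (d + 2) * (n + 1) * (d + 1)) := by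
  have h0 := collectP_cost_le orc st
  have h1 := flatMapE_time_le (k := ℓ) orc
    (lst := (.snd : Prog (.prod (.list .nat) (.list nodeTy)) (.list nodeTy)))
    (body := .seq .fst childrenP)
    (x := st) (B := 300 * ((ℓ + 1) ^ 2 * (n + 1) * (d + 1)) + 2) le_rfl le_rfl (fun y hy => by
      have := childrenP_cost_le orc y (h.nodes y hy); simp only [cost, val]; omega)
    (fun y hy => by
      simp only [val, childrenP_val]; exact (h.nodes y hy).childNodes_length_le)
  have h2 : st.2.length ≤ (ℓ + 1) ^ d :=
    h.width.trans (Nat.pow_le_pow_left (Nat.le_succ _) _)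
  have h3 : 1 ≤ (ℓ + 1) ^ d := Nat.one_le_pow _ _ (Nat.succ_pos _)
  have h4 : ℓ + 1 ≤ (ℓ + 1) ^ 2 * (n + 1) * (d + 1) := by
    calc ℓ + 1 ≤ (ℓ + 1) ^ 2 := Nat.le_self_pow (by norm_num) _
      _ ≤ (ℓ + 1) ^ 2 * ((n + 1) * (d + 1)) := Nat.le_mul_of_pos_right _ (by positivity)
      _ = _ := by ring
  set Y := (ℓ + 1) ^ 2 * (n + 1) * (d + 1)
  have h5 : (ℓ + 1) ^ (d + 2) * (n + 1) * (d + 1) = (ℓ + 1) ^ d * Y := by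
    simp only [Y]; ring
  rw [h5]
  simp only [levelP, cost, val] at h1 ⊢
  have h6 : st.2.length * (300 * Y + 2 + ℓ * 10 + 20) ≤ (ℓ + 1) ^ d * (332 * Y) :=
    Nat.mul_le_mul h2 (by omega)
  have h7 : (ℓ + 1) ^ d ≤ (ℓ + 1) ^ d * Y := Nat.le_mul_of_pos_right _ (by omega)
  have h8 : (ℓ + 1) ^ d * (332 * Y) = 332 * ((ℓ + 1) ^ d * Y) := by ring
  omega

/-- The running time of a search tree, apart from sorting and up to factors depending on the size
of the instance. -/
def treeBound (ℓ z t : ℕ) : ℕ := 1000 * ((ℓ + 1) ^ (z * ℓ + 2) * (z * ℓ + 1) ^ 2) + 20 * t + 9 * z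

theorem depthP_cost_le (x : envTy.Val) {z : ℕ} (hz : x.2.2.1 = z) :
    depthP.cost 1 1 orc x ≤ 9 * z + 30 := by
  have hmul := mulP_cost_le orc x (subP (.seq .snd (.seq .snd .fst)) (.natConst 1))
    (.seq .snd .fst : Prog envTy .nat)
  have h2 : (subP (.seq .snd (.seq .snd .fst)) (.natConst 1) : Prog envTy .nat).val orc x = z - 1 := by
    rw [← hz]; rfl
  rw [h2] at hmul
  simp only [cost, subP_cost] at hmul
  rw [depthP]
  omega

/-- The depth is at most `z * ℓ`, the width of a level is at most a power of `ℓ + 1` with about that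
exponent, and the work per node is linear in `n`. All of this goes into `treeBound`; only sorting
the candidates is left outside. -/
theorem treeP_cost_le (x : envTy.Val) {m z : ℕ} (hℓ : x.2.1 = ℓ) (hz : x.2.2.1 = z)
    (hn : x.2.2.2.2.length = n) (hmat : ∀ y ∈ x.2.2.2.2, y.1.length ≤ ℓ)
    (hm : ∀ y ∈ x.2.2.2.2, y.2.length ≤ m ∧ ∀ p ∈ y.2, (p : ℕ) ≤ m) :
    treeP.cost 1 1 orc x ≤ n * (Nat.clog 2 n + 1)
      + (n + 1) * (m + 1) ^ 2 * treeBound ℓ z x.1.2 := by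
  have hcand := candidatesP_cost_le orc x hn hm
  have hdep := depthP_cost_le orc x hz
  have hval := depthP_val orc x hℓ hz
  set D := (z - 1) * ℓ with hD
  have hDle : D ≤ z * ℓ := Nat.mul_le_mul_right _ (Nat.sub_le _ _)
  set E := z * ℓ
  set Y := (ℓ + 1) ^ (E + 2) with hY
  have hlev : ∀ i < D, (ℓ + 1) ^ (i + 2) * (n + 1) * (i + 1) ≤ Y * (n + 1) * (E + 1) :=
    fun i hi => Nat.mul_le_mul (Nat.mul_le_mul_right _
      (Nat.pow_le_pow_right (Nat.succ_pos _) (by omega))) (by omega)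
  have hit := iterE_time_le orc (B := 500 * (Y * (n + 1) * (E + 1)) + 2) (n := E)
    (cnt := depthP)
    (init := .pair .nil (consP (.pair .nil candidatesP) .nil)) (body := .seq .fst levelP)
    (x := x) (LevelBounds ℓ n) hdep le_rfl (by rw [hval]; exact hDle)
    (by simp only [val, consP_val, candidatesP_val]; exact levelBounds_candidates x hn hmat)
    (fun i hi st hst => ⟨by simp only [val, levelP_val]; exact hst.nextLevel, by
      rw [hval] at hi
      have h1 := levelP_cost_le orc st hst
      have h2 := hlev i hi
      simp only [cost, val]
      omega⟩)
  have hfin : ∀ st, LevelBounds ℓ n D st → collectP.cost 1 1 orc st ≤ 60 * Y + 20 := by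
    intro st hst
    refine (collectP_cost_le orc st).trans ?_
    have h1 : st.2.length ≤ Y := hst.width.trans
      ((Nat.pow_le_pow_left (Nat.le_succ _) _).trans
        (Nat.pow_le_pow_right (Nat.succ_pos _) (by omega)))
    omega
  have hfin' := hfin _ ((levelBounds_candidates x hn hmat).iterate (orc := orc) D)
  have hst : (iterE depthP
    (.pair .nil (consP (.pair .nil candidatesP) .nil)) (.seq .fst levelP)).val orc x
      = (nextLevel orc)^[D] ([], [([], candidates x.2.2.2.1 x.1.1 x.1.2 x.2.2.2.2)]) := by
    simp only [val, iterE_val, levelP_val, hval, consP_val, candidatesP_val]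
  rw [← hst] at hfin'
  simp only [cost, consP_cost] at hit
  simp only [treeP, cost]
  generalize candidatesP.cost 1 1 orc x = c1 at *
  generalize (iterE depthP (.pair .nil (consP (.pair .nil candidatesP) .nil))
    (.seq .fst levelP)).cost 1 1 orc x = c2 at *
  generalize collectP.cost 1 1 orc _ = c3 at *
  generalize n * (Nat.clog 2 n + 1) = S at *
  have ht : ∃ t : ℕ, t = x.1.2 := ⟨_, rfl⟩
  obtain ⟨t, ht⟩ := ht
  rw [← ht] at hcand ⊢
  have hM1 : 1 ≤ (m + 1) ^ 2 := Nat.one_le_pow _ _ (Nat.succ_pos _)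
  have hY1 : 1 ≤ Y := Nat.one_le_pow _ _ (Nat.succ_pos _)
  generalize (m + 1) ^ 2 = M at *
  have hW : E * (500 * (Y * (n + 1) * (E + 1))) ≤ 500 * ((n + 1) * M * (Y * (E + 1) ^ 2)) := by
    calc E * (500 * (Y * (n + 1) * (E + 1))) = 500 * ((n + 1) * 1 * (Y * ((E + 1) * E))) := by ring
      _ ≤ 500 * ((n + 1) * M * (Y * ((E + 1) * (E + 1)))) := by gcongr; omega
      _ = _ := by ring
  have hV : E + Y + n + 1 ≤ 3 * ((n + 1) * M * (Y * (E + 1) ^ 2)) := by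
    have a1 : n + 1 ≤ (n + 1) * M * (Y * (E + 1) ^ 2) := by
      rw [mul_assoc]; exact Nat.le_mul_of_pos_right _ (by positivity)
    have a2 : Y ≤ (n + 1) * M * (Y * (E + 1) ^ 2) := by
      calc Y = 1 * 1 * (Y * 1) := by ring
        _ ≤ _ := by gcongr <;> first | omega | exact Nat.one_le_pow _ _ (Nat.succ_pos _)
    have a3 : E + 1 ≤ (n + 1) * M * (Y * (E + 1) ^ 2) := by
      calc E + 1 = 1 * 1 * (1 * (E + 1)) := by ring
        _ ≤ 1 * 1 * (1 * (E + 1) ^ 2) := by gcongr; exact Nat.le_self_pow (by norm_num) _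
        _ ≤ _ := by gcongr; omega
    omega
  have hU : (n + 1) * M ≤ (n + 1) * M * (Y * (E + 1) ^ 2) :=
    Nat.le_mul_of_pos_right _ (by positivity)
  have hT : (n + 1) * (112 * M + 20 * t + 150) ≤ 262 * ((n + 1) * M) + (n + 1) * M * (20 * t) := by
    nlinarith [Nat.zero_le (n * (M - 1)), Nat.zero_le t, mul_le_mul (le_refl (n + 1)) hM1
      (Nat.zero_le _) (Nat.zero_le _), mul_le_mul (le_refl ((n + 1) * t)) hM1
      (Nat.zero_le _) (Nat.zero_le _)]
  have hz' : 9 * z ≤ (n + 1) * M * (9 * z) := Nat.le_mul_of_pos_left _ (by positivity)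
  have : (n + 1) * M * treeBound ℓ z t = 1000 * ((n + 1) * M * (Y * (E + 1) ^ 2))
    + (n + 1) * M * (20 * t) + (n + 1) * M * (9 * z) := by
    simp only [treeBound]; ring
  rw [this]
  have e1 : E * (500 * (Y * (n + 1) * (E + 1)) + 2 + 2)
    = E * (500 * (Y * (n + 1) * (E + 1))) + 4 * E := by ring
  rw [e1] at hit
  omega

end Prog

/-! ### Correctness of the search tree -/

namespace CoverageInstance

variable {ℓ n m s : ℕ} (I : CoverageInstance ℓ n m s)

/-- The list of the matroids of an element. -/
noncomputable def matroidList (e : Fin n) : List ℕ :=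
  ((matroidsAt I.M e).sort (· ≤ ·)).map Fin.val

/-- The list of the points that an element covers. -/
noncomputable def pointList (e : Fin n) : List ℕ := ((I.pts e).sort (· ≤ ·)).map Fin.val

theorem input_eq (z : ℕ) : I.input z = ((ℓ : ℕ), (z : ℕ), (List.ofFn I.w : List ℝ),
    (List.ofFn fun e => (I.matroidList e, I.pointList e))) := by
  simp [input, matroidList, pointList, List.map_eq_flatMap]

theorem mem_matroidsAt {e : Fin n} {i : Fin s} : i ∈ matroidsAt I.M e ↔ e ∈ (I.M i).E := by
  simp [matroidsAt]

theorem mem_matroidList {e : Fin n} {i : ℕ} :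
    i ∈ I.matroidList e ↔ ∃ h : i < s, e ∈ (I.M ⟨i, h⟩).E := by
  simp only [matroidList, List.mem_map, Finset.mem_sort, mem_matroidsAt]
  constructor
  · rintro ⟨j, hj, rfl⟩; exact ⟨j.2, hj⟩
  · rintro ⟨h, hi⟩; exact ⟨⟨i, h⟩, hi, rfl⟩

theorem matroidList_length_le (e : Fin n) : (I.matroidList e).length ≤ ℓ := by
  simpa [matroidList] using I.matchoid e

theorem Feasible.mono {I : CoverageInstance ℓ n m s} {S T : Finset (Fin n)} (hT : I.Feasible T)
    (h : S ⊆ T) : I.Feasible S := fun i =>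
  (hT i).subset (Set.inter_subset_inter_left _ (by exact_mod_cast h))

/-- The set of elements that a list stands for. -/
def listSet (n : ℕ) (A : List ℕ) : Set (Fin n) := {e | (e : ℕ) ∈ A}

theorem listSet_cons (e : Fin n) (A : List ℕ) : listSet n (e :: A) = insert e (listSet n A) := by
  ext x; simp [listSet, Fin.ext_iff]

theorem oracle_eq_true {i : Fin s} {A : List ℕ} :
    I.oracle i A = true ↔ (∀ a ∈ A, a < n) ∧ (I.M i).Indep (listSet n A) := by
  simp [oracle, listSet]

/-- A node of the search tree that is compatible with the exchange of `e` in `insert e W`. -/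
structure Compatible (W : Finset (Fin n)) (e : Fin n) (cands : List (ℕ × List ℕ))
    (x : SearchNode) : Prop where
  sublist : x.2.Sublist cands
  mem : ((e : ℕ), I.matroidList e) ∈ x.2
  bounds : ∀ b ∈ x.1, b.1 < s ∧ b.2 < n
  nodup : ∀ i, (contracted i x.1).Nodup
  indep : ∀ i : Fin s, (I.M i).Indep (listSet n (contracted i x.1))
  subset : ∀ i : Fin s, listSet n (contracted i x.1) ⊆ (I.M i).closure (W ∩ (I.M i).E)
  fresh : ∀ c ∈ x.2, ∀ i, c.1 ∉ contracted i x.1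
  insert_indep : ∀ v : Fin n, (v : ℕ) ∈ x.2.map Prod.fst → ∀ i : Fin s, v ∈ (I.M i).E →
    (I.M i).Indep (insert v (listSet n (contracted i x.1)))

theorem contracted_cons (i j v : ℕ) (B : List (ℕ × ℕ)) :
    contracted j ((i, v) :: B) = if i = j then v :: contracted j B else contracted j B := by
  by_cases h : i = j <;> simp [contracted, h]

theorem contracted_lt {B : List (ℕ × ℕ)} (hB : ∀ b ∈ B, b.1 < s ∧ b.2 < n) (i : ℕ) :
    ∀ a ∈ contracted i B, a < n := by
  intro a ha
  obtain ⟨b, hb, rfl⟩ := List.mem_map.1 ha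
  exact (hB b (List.mem_of_mem_filter hb)).2

variable {I} {W : Finset (Fin n)} {e : Fin n} {cands : List (ℕ × List ℕ)}

theorem not_mem_closure (hW : I.Feasible (insert e W)) (heW : e ∉ W) {i : Fin s}
    (hei : e ∈ (I.M i).E) : e ∉ (I.M i).closure (W ∩ (I.M i).E) := by
  have h := hW i
  rw [Finset.coe_insert, Set.insert_inter_of_mem hei] at h
  have h2 := (Matroid.Indep.insert_indep_iff_of_notMem (h.subset (Set.subset_insert _ _))
    (by simp [heW])).1 h
  exact h2.2

/-- The matroid found here is the branch to follow in the tree: it is one in which `W` blocks `v`.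
-/
theorem exists_mem_closure (hW : I.Feasible W) {v : Fin n} (hv : ¬ I.Feasible (insert v W)) :
    ∃ i : Fin s, v ∈ (I.M i).E ∧ v ∈ (I.M i).closure (W ∩ (I.M i).E) := by
  simp only [Feasible, not_forall] at hv
  obtain ⟨i, hi⟩ := hv
  by_cases hvi : v ∈ (I.M i).E
  · refine ⟨i, hvi, ?_⟩
    rw [Finset.coe_insert, Set.insert_inter_of_mem hvi] at hi
    by_contra hcl
    exact hi ((hW i).insert_indep_iff.2 (Or.inl ⟨hvi, hcl⟩))
  · rw [Finset.coe_insert, Set.insert_inter_of_notMem hvi] at hi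
    exact absurd (hW i) hi

theorem Compatible.root (hmem : ((e : ℕ), I.matroidList e) ∈ cands) :
    I.Compatible W e cands ([], cands) where
  sublist := List.Sublist.refl _
  mem := hmem
  bounds := by simp
  nodup := by simp [contracted]
  indep i := by simp [contracted, listSet]
  subset i := by simp [contracted, listSet]
  fresh := by simp [contracted]
  insert_indep v _ i hv := by
    have : listSet n (contracted i []) = ∅ := by simp [contracted, listSet]
    rw [this, insert_empty_eq]
    exact I.loopless i v hv

/-- Since `W` spans `v` in the `i`-th matroid, the enlarged contracted set is still spanned by `W`.
As `W` does not span `e`, neither does that set, so `e` survives the filter. The filter itself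
guarantees that each surviving candidate extends the enlarged set independently, which is what the
next contraction will need. -/
theorem Compatible.child (hW : I.Feasible (insert e W)) (heW : e ∉ W)
    (hnd : cands.Pairwise fun c c' => c.1 ≠ c'.1) (hc : ∀ c ∈ cands, ∃ v : Fin n, c = ((v : ℕ), I.matroidList v))
    {B : List (ℕ × ℕ)} {v : Fin n} {l : List (ℕ × List ℕ)}
    (h : I.Compatible W e cands (B, ((v : ℕ), I.matroidList v) :: l)) (hve : v ≠ e) {i : Fin s}
    (hvi : v ∈ (I.M i).E) (hcl : v ∈ (I.M i).closure (W ∩ (I.M i).E)) :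
    I.Compatible W e cands (childNode I.oracle B v l i) := by
  have hlt := contracted_lt h.bounds
  have hpw := hnd.sublist h.sublist
  have hsub : List.Sublist (childNode I.oracle B v l i).2 l := List.filter_sublist
  have hvB : (I.M i).Indep (insert v (listSet n (contracted i B))) :=
    h.insert_indep v (by simp) i hvi
  have hcl' : insert v (listSet n (contracted i B)) ⊆ (I.M i).closure (W ∩ (I.M i).E) :=
    Set.insert_subset hcl (h.subset i)
  have hBi : ∀ j : Fin s, listSet n (contracted j (childNode I.oracle B v l i).1)
      = if i = j then insert v (listSet n (contracted j B)) else listSet n (contracted j B) := by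
    intro j
    simp only [childNode, contracted_cons, ← Fin.ext_iff]
    split
    · rw [listSet_cons]
    · rfl
  refine ⟨hsub.trans ((List.sublist_cons_self _ _).trans h.sublist), ?_, ?_, ?_, ?_, ?_, ?_, ?_⟩
  · have hel : ((e : ℕ), I.matroidList e) ∈ l := by
      rcases List.mem_cons.1 h.mem with h' | h'
      · exact absurd (Fin.ext (congrArg Prod.fst h')).symm hve
      · exact h'
    refine List.mem_filter.2 ⟨hel, ?_⟩
    by_cases hei : (I.matroidList e).contains (i : ℕ)
    · rw [hei, cond_true, oracle_eq_true]
      have hei' : e ∈ (I.M i).E := by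
        obtain ⟨_, h'⟩ := I.mem_matroidList.1 (List.contains_iff_mem.1 hei)
        exact h'
      refine ⟨?_, ?_⟩
      · intro a ha
        rcases List.mem_cons.1 ha with rfl | ha
        · exact e.2
        rcases List.mem_cons.1 ha with rfl | ha
        · exact v.2
        · exact hlt _ _ ha
      · rw [listSet_cons, listSet_cons]
        -- If the contracted elements together with `v` spanned `e`, then so would `W`.
        refine hvB.insert_indep_iff.2 (Or.inl ⟨hei', fun h' => not_mem_closure hW heW hei' ?_⟩)
        exact (I.M i).closure_subset_closure_of_subset_closure hcl' h'
    · rw [Bool.not_eq_true] at hei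
      rw [hei]; rfl
  · intro b hb
    rcases List.mem_cons.1 hb with rfl | hb
    · exact ⟨i.2, v.2⟩
    · exact h.bounds b hb
  · intro j
    simp only [childNode, contracted_cons]
    split
    · exact List.nodup_cons.2 ⟨h.fresh ((v : ℕ), I.matroidList v) (by simp) j, h.nodup j⟩
    · exact h.nodup j
  · intro j
    rw [hBi]
    split
    · next hij => subst hij; exact hvB
    · exact h.indep j
  · intro j
    rw [hBi]
    split
    · next hij => subst hij; exact hcl'
    · exact h.subset j
  · intro c hc' j
    have hcl : c ∈ l := hsub.subset hc'
    -- Candidates have distinct names, so an element is contracted at most once in a matroid. This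
    -- keeps the lists free of repetitions, so that their lengths are cardinalities.
    have hne : (v : ℕ) ≠ c.1 := (List.pairwise_cons.1 hpw).1 c hcl
    have := h.fresh c (List.mem_cons_of_mem _ hcl) j
    simp only [childNode, contracted_cons]
    split
    · simp only [List.mem_cons, not_or]; exact ⟨hne.symm, this⟩
    · exact this
  · intro u hu j huj
    obtain ⟨c, hcm, hcu⟩ := List.mem_map.1 hu
    have hcl : c ∈ l := hsub.subset hcm
    obtain ⟨u', rfl⟩ := hc c (h.sublist.subset (List.mem_cons_of_mem _ hcl))
    obtain rfl : u' = u := Fin.ext hcu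
    rw [hBi]
    split
    · next hij =>
      subst hij
      have htest := (List.mem_filter.1 hcm).2
      have hcon : (I.matroidList u').contains (i : ℕ) = true :=
        List.contains_iff_mem.2 (I.mem_matroidList.2 ⟨i.2, huj⟩)
      rw [hcon, cond_true, oracle_eq_true, listSet_cons, listSet_cons] at htest
      exact htest.2
    · exact h.insert_indep u' (List.mem_map.2 ⟨_, List.mem_cons_of_mem _ hcl, rfl⟩) j huj

theorem card_listSet {A : List ℕ} (hA : A.Nodup) (hlt : ∀ a ∈ A, a < n) :
    (listSet n A).encard = A.length := by
  have h : (A.toFinset : Set ℕ) = Fin.val '' listSet n A := by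
    ext a
    simp only [List.coe_toFinset, Set.mem_ofPred_eq, Set.mem_image, listSet]
    exact ⟨fun ha => ⟨⟨a, hlt a ha⟩, ha, rfl⟩, by rintro ⟨x, hx, rfl⟩; exact hx⟩
  rw [← Fin.val_injective.encard_image (listSet n A), ← h, Set.encard_coe_eq_coe_finsetCard,
    List.toFinset_card_of_nodup hA]

theorem sum_contracted_length {B : List (ℕ × ℕ)} (hB : ∀ b ∈ B, b.1 < s) :
    ∑ i : Fin s, (contracted i B).length = B.length := by
  induction B with
  | nil => simp [contracted]
  | cons b B ih =>
    have hb := hB b (by simp)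
    have : ∀ i : Fin s, (contracted i (b :: B)).length
        = (if i = ⟨b.1, hb⟩ then 1 else 0) + (contracted i B).length := by
      intro i
      obtain ⟨b1, b2⟩ := b
      rw [contracted_cons]
      by_cases h : b1 = i
      · rw [if_pos h, if_pos (Fin.ext h.symm)]; simp [add_comm]
      · rw [if_neg h, if_neg (fun h' => h (congrArg Fin.val h').symm)]; simp
    rw [Finset.sum_congr rfl fun i _ => this i, Finset.sum_add_distrib,
      ih fun b hb => hB b (by simp [hb])]
    simp [add_comm]

/-- In each matroid the contracted elements form an independent set in the closure of the trace of
`W`, so there are at most as many of them as elements in this trace. Every element of `W` lies in at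
most `ℓ` traces. -/
theorem Compatible.length_le {x : SearchNode} (h : I.Compatible W e cands x) :
    x.1.length ≤ W.card * ℓ := by
  classical
  rw [← sum_contracted_length fun b hb => (h.bounds b hb).1]
  have h1 : ∀ i : Fin s, (contracted i x.1).length ≤ (W.filter fun v => v ∈ (I.M i).E).card := by
    intro i
    have h2 := (h.indep i).encard_le_eRk_of_subset (h.subset i)
    rw [card_listSet (h.nodup i) (contracted_lt h.bounds i), Matroid.eRk_closure_eq] at h2
    have h3 := h2.trans ((I.M i).eRk_le_encard _)
    have h4 : ((W : Set (Fin n)) ∩ (I.M i).E) = ((W.filter fun v => v ∈ (I.M i).E : Finset _) : Set _) := by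
      ext v; simp
    rw [h4, Set.encard_coe_eq_coe_finsetCard] at h3
    exact_mod_cast h3
  calc ∑ i : Fin s, (contracted i x.1).length
      ≤ ∑ i : Fin s, (W.filter fun v => v ∈ (I.M i).E).card := Finset.sum_le_sum fun i _ => h1 i
    -- Double counting of the incidences between `W` and the matroids.
    _ = ∑ v ∈ W, (matroidsAt I.M v).card := by
        simp only [Finset.card_filter, matroidsAt]
        rw [Finset.sum_comm]
    _ ≤ ∑ v ∈ W, ℓ := Finset.sum_le_sum fun v _ => I.matchoid v
    _ = W.card * ℓ := by simp

/-- The first candidate `v` precedes `e` or equals it, so its key is no smaller. Either `v` can be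
exchanged for `e`, or some matroid blocks it and the corresponding child is again compatible. -/
theorem Compatible.step (hW : I.Feasible (insert e W)) (heW : e ∉ W)
    (hnd : cands.Pairwise fun c c' => c.1 ≠ c'.1)
    (hc : ∀ c ∈ cands, ∃ v : Fin n, c = ((v : ℕ), I.matroidList v)) {key : Fin n → ℝ}
    (hkey : cands.Pairwise fun c c' => ∀ v v' : Fin n, (v : ℕ) = c.1 → (v' : ℕ) = c'.1 →
      key v' ≤ key v) {x : SearchNode} (h : I.Compatible W e cands x) :
    (∃ v : Fin n, (v : ℕ) ∈ headCandidate x ∧ I.Feasible (insert v W) ∧ key e ≤ key v) ∨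
      ∃ y ∈ childNodes I.oracle x, y.1.length = x.1.length + 1 ∧ I.Compatible W e cands y := by
  obtain ⟨B, l⟩ := x
  cases l with
  | nil => exact absurd h.mem (by simp)
  | cons c l =>
    obtain ⟨v, rfl⟩ := hc c (h.sublist.subset (by simp))
    by_cases hve : v = e
    · subst hve
      exact Or.inl ⟨v, by simp [headCandidate], hW, le_rfl⟩
    have hle : key e ≤ key v := by
      have hp := List.pairwise_cons.1 (hkey.sublist h.sublist)
      rcases List.mem_cons.1 h.mem with h' | h'
      · exact absurd (Fin.ext (congrArg Prod.fst h')).symm hve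
      · exact hp.1 _ h' v e rfl rfl
    by_cases hf : I.Feasible (insert v W)
    · exact Or.inl ⟨v, by simp [headCandidate], hf, hle⟩
    · obtain ⟨i, hvi, hcl⟩ := exists_mem_closure (hW.mono (Finset.subset_insert _ _)) hf
      refine Or.inr ⟨childNode I.oracle B v l i, ?_, by simp [childNode],
        h.child hW heW hnd hc hve hvi hcl⟩
      exact List.mem_map.2 ⟨i, I.mem_matroidList.2 ⟨i.2, hvi⟩, rfl⟩

/-- A compatible path grows by one contraction per level as long as no exchange is found, but the
number of contractions is bounded by `W.card * ℓ`. -/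
theorem exists_mem_treeOutput (hW : I.Feasible (insert e W)) (heW : e ∉ W)
    (hnd : cands.Pairwise fun c c' => c.1 ≠ c'.1)
    (hc : ∀ c ∈ cands, ∃ v : Fin n, c = ((v : ℕ), I.matroidList v)) {key : Fin n → ℝ}
    (hkey : cands.Pairwise fun c c' => ∀ v v' : Fin n, (v : ℕ) = c.1 → (v' : ℕ) = c'.1 →
      key v' ≤ key v) (hmem : ((e : ℕ), I.matroidList e) ∈ cands) {D : ℕ} (hD : W.card * ℓ ≤ D) :
    ∃ v : Fin n, (v : ℕ) ∈ treeOutput I.oracle D cands ∧ I.Feasible (insert v W) ∧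
      key e ≤ key v := by
  have key' : ∀ k,
      (∃ v : Fin n, (v : ℕ) ∈ ((nextLevel I.oracle)^[k] ([], [([], cands)])).1 ∧
        I.Feasible (insert v W) ∧ key e ≤ key v) ∨
      ∃ x ∈ ((nextLevel I.oracle)^[k] ([], [([], cands)])).2, x.1.length = k ∧
        I.Compatible W e cands x := by
    intro k
    induction k with
    | zero => exact Or.inr ⟨([], cands), by simp, rfl, Compatible.root hmem⟩
    | succ k ih =>
      rw [Function.iterate_succ_apply']
      rcases ih with ⟨v, hv, h⟩ | ⟨x, hx, hlen, h⟩
      · exact Or.inl ⟨v, List.mem_append_right _ hv, h⟩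
      · rcases h.step hW heW hnd hc hkey with ⟨v, hv, h⟩ | ⟨y, hy, hylen, h⟩
        · exact Or.inl ⟨v, List.mem_append_left _
            (List.mem_reverse.2 (List.mem_flatMap.2 ⟨x, hx, hv⟩)), h⟩
        · exact Or.inr ⟨y, List.mem_flatMap.2 ⟨x, hx, hy⟩, by omega, h⟩
  -- The tree outputs the first candidates of the levels `0, …, D`, which is the first component
  -- after `D + 1` level steps. A compatible node at depth `D + 1` would have too many contractions.
  have h := key' (D + 1)
  rw [Function.iterate_succ_apply'] at h
  rcases h with h | ⟨x, -, hlen, h⟩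
  · exact h
  · have := h.length_le
    omega

end CoverageInstance

/-! ### Scores -/

theorem sum_take_tail_le {l : List ℝ} {a : ℝ} (h : (a :: l).Pairwise fun x y => y ≤ x)
    (h0 : ∀ x ∈ a :: l, 0 ≤ x) (t : ℕ) : (l.take t).sum ≤ ((a :: l).take t).sum := by
  induction l generalizing a t with
  | nil =>
    cases t with
    | zero => simp
    | succ t => simpa using h0 a (by simp)
  | cons b l ih =>
    cases t with
    | zero => simp
    | succ t =>
      have h1 := ih (List.pairwise_cons.1 h).2 (fun x hx => h0 x (List.mem_cons_of_mem _ hx)) t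
      have h2 := (List.pairwise_cons.1 h).1 b (by simp)
      rw [List.take_succ_cons, List.take_succ_cons, List.sum_cons, List.sum_cons]
      linarith

/-- Dropping an entry of a decreasing list cannot increase the sum of a prefix. Nonnegativity is
needed because the prefix may be longer than the sublist. -/
theorem sum_sublist_le_sum_take {l s : List ℝ} (h : l.Pairwise fun x y => y ≤ x)
    (h0 : ∀ x ∈ l, 0 ≤ x) (hs : s.Sublist l) {t : ℕ} (ht : s.length ≤ t) :
    s.sum ≤ (l.take t).sum := by
  induction hs generalizing t with
  | slnil => simp
  | cons a hs ih =>
    exact (ih (List.pairwise_cons.1 h).2 (fun x hx => h0 x (List.mem_cons_of_mem _ hx)) ht).trans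
      (sum_take_tail_le h h0 t)
  | cons_cons a hs ih =>
    cases t with
    | zero => simp at ht
    | succ t =>
      rw [List.take_succ_cons, List.sum_cons, List.sum_cons]
      exact add_le_add le_rfl (ih (List.pairwise_cons.1 h).2
        (fun x hx => h0 x (List.mem_cons_of_mem _ hx)) (by simpa using ht))

theorem exists_map_eq {α β : Type} {f : α → β} {l : List β} (h : ∀ y ∈ l, ∃ x, f x = y) :
    ∃ l' : List α, l'.map f = l := by
  induction l with
  | nil => exact ⟨[], rfl⟩
  | cons y l ih =>
    obtain ⟨x, rfl⟩ := h y (by simp)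
    obtain ⟨l', rfl⟩ := ih fun y hy => h y (List.mem_cons_of_mem _ hy)
    exact ⟨x :: l', rfl⟩

theorem sortDesc_perm {α : Type} (l : List (ℝ × α)) : (sortDesc l).Perm l :=
  List.mergeSort_perm _ _

theorem sortDesc_pairwise {α : Type} (l : List (ℝ × α)) :
    (sortDesc l).Pairwise fun x y => y.1 ≤ x.1 := by
  have := List.pairwise_mergeSort (le := fun x y : ℝ × α => decide (y.1 ≤ x.1))
    (fun a b c hab hbc => by
      simp only [decide_eq_true_eq] at *
      exact hbc.trans hab)
    (fun a b => by
      simp only [Bool.or_eq_true, decide_eq_true_eq]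
      exact le_total _ _) l
  refine List.Pairwise.imp ?_ (by
    unfold sortDesc
    convert this)
  intro a b h
  simpa using h

namespace CoverageInstance

variable {ℓ n m s : ℕ} (I : CoverageInstance ℓ n m s)

/-- The total weight of the `t` heaviest selected points that `e` covers. -/
noncomputable def elementScore (mask : List Bool) (t : ℕ) (e : Fin n) : ℝ :=
  score (List.ofFn I.w) mask t (I.pointList e)

theorem getD_ofFn_w (p : Fin m) : (List.ofFn I.w).getD p 0 = I.w p := by
  simp [List.getD_eq_getElem?_getD]

/-- One list of points serves all `t` at once: the scores are its prefix sums. From it follow both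
halves of the characterization of the score as the largest weight of at most `t` selected points
that `e` covers. -/
theorem exists_sorted_points (mask : List Bool) (e : Fin n) : ∃ S : List (Fin m), S.Nodup ∧
    (∀ p, p ∈ S ↔ p ∈ I.pts e ∧ mask.getD p false = true) ∧
    (S.map I.w).Pairwise (fun x y => y ≤ x) ∧
    ∀ t, I.elementScore mask t e = ((S.take t).map I.w).sum := by
  set f : Fin m → ℝ × ℕ := fun p => (I.w p, (p : ℕ)) with hf
  have hfinj : Function.Injective f := fun p q h => Fin.ext (congrArg Prod.snd h)
  have hL : weighted (List.ofFn I.w) mask (I.pointList e)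
      = (((I.pts e).sort (· ≤ ·)).filter fun p : Fin m => mask.getD (p : ℕ) false).map f := by
    rw [weighted, pointList, List.filter_map, List.map_map]
    refine List.map_congr_left fun p _ => ?_
    simp only [Function.comp, hf, getD_ofFn_w]
  have hperm := sortDesc_perm (weighted (List.ofFn I.w) mask (I.pointList e))
  obtain ⟨S, hS⟩ := exists_map_eq (f := f)
    (l := sortDesc (weighted (List.ofFn I.w) mask (I.pointList e))) (fun y hy => by
      have := hperm.subset hy
      rw [hL] at this
      obtain ⟨p, -, rfl⟩ := List.mem_map.1 this
      exact ⟨p, rfl⟩)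
  have hpw := sortDesc_pairwise (weighted (List.ofFn I.w) mask (I.pointList e))
  rw [hL] at hperm
  rw [hL] at hpw hS
  rw [← hS] at hperm hpw
  have hperm' := (List.map_perm_map_iff hfinj).1 hperm
  refine ⟨S, hperm'.nodup_iff.2 ((Finset.sort_nodup _ _).filter _), fun p => ?_, ?_, fun t => ?_⟩
  · rw [hperm'.mem_iff, List.mem_filter, Finset.mem_sort]
  · rw [List.pairwise_map] at hpw ⊢
    exact hpw
  · rw [elementScore, score, topSum, hL, ← hS, ← List.map_take, List.map_map]
    rfl

theorem exists_sum_eq_elementScore (mask : List Bool) (t : ℕ) (e : Fin n) :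
    ∃ T ⊆ I.pts e, (∀ p ∈ T, mask.getD p false = true) ∧ T.card ≤ t ∧
      ∑ p ∈ T, I.w p = I.elementScore mask t e := by
  obtain ⟨S, hnd, hmem, -, hsum⟩ := I.exists_sorted_points mask e
  have hnd' : (S.take t).Nodup := hnd.sublist (List.take_sublist _ _)
  have hsub : ∀ p ∈ (S.take t).toFinset, p ∈ S := fun p hp =>
    List.mem_of_mem_take (List.mem_toFinset.1 hp)
  refine ⟨(S.take t).toFinset, fun p hp => ((hmem p).1 (hsub p hp)).1,
    fun p hp => ((hmem p).1 (hsub p hp)).2, ?_, ?_⟩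
  · rw [List.toFinset_card_of_nodup hnd']; simp
  · rw [hsum, List.sum_toFinset _ hnd']

theorem sum_le_elementScore {mask : List Bool} {t : ℕ} {e : Fin n} {T : Finset (Fin m)}
    (hT : T ⊆ I.pts e) (hmask : ∀ p ∈ T, mask.getD p false = true) (ht : T.card ≤ t) :
    ∑ p ∈ T, I.w p ≤ I.elementScore mask t e := by
  obtain ⟨S, hnd, hmem, hpw, hsum⟩ := I.exists_sorted_points mask e
  have hnd' : (S.filter (· ∈ T)).Nodup := hnd.filter _
  have hTS : (S.filter (· ∈ T)).toFinset = T := by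
    ext p
    simp only [List.mem_toFinset, List.mem_filter, decide_eq_true_eq]
    exact ⟨fun h => h.2, fun h => ⟨(hmem p).2 ⟨hT h, hmask p h⟩, h⟩⟩
  rw [← hTS, List.sum_toFinset _ hnd', hsum, List.map_take]
  refine sum_sublist_le_sum_take hpw ?_ (List.filter_sublist.map _) ?_
  · intro x hx
    obtain ⟨p, -, rfl⟩ := List.mem_map.1 hx
    exact I.w_nonneg p
  · rw [List.length_map, ← List.toFinset_card_of_nodup hnd', hTS]; exact ht

/-- The candidates of a specification for the instance. -/
noncomputable def candidateList (mask : List Bool) (t : ℕ) : List (ℕ × List ℕ) :=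
  candidates (List.ofFn I.w) mask t (List.ofFn fun e => (I.matroidList e, I.pointList e))

theorem scored_eq (mask : List Bool) (t : ℕ) :
    scored (List.ofFn I.w) mask t (List.ofFn fun e => (I.matroidList e, I.pointList e))
      = List.ofFn fun e => (I.elementScore mask t e, (e : ℕ), I.matroidList e) := by
  apply List.ext_getElem
  · simp [scored]
  · intro i h1 h2
    simp [scored, elementScore]

theorem mem_sorted {mask : List Bool} {t : ℕ} {y : ℝ × ℕ × List ℕ} :
    y ∈ sortDesc (scored (List.ofFn I.w) mask t
      (List.ofFn fun e => (I.matroidList e, I.pointList e))) ↔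
      ∃ e, (I.elementScore mask t e, (e : ℕ), I.matroidList e) = y := by
  rw [(sortDesc_perm _).mem_iff, scored_eq, List.mem_ofFn]

theorem mem_candidateList {mask : List Bool} {t : ℕ} {c : ℕ × List ℕ} :
    c ∈ I.candidateList mask t ↔ ∃ e : Fin n, c = ((e : ℕ), I.matroidList e) := by
  simp only [candidateList, candidates, List.mem_map, mem_sorted]
  constructor
  · rintro ⟨_, ⟨e, rfl⟩, rfl⟩; exact ⟨e, rfl⟩
  · rintro ⟨e, rfl⟩; exact ⟨_, ⟨e, rfl⟩, rfl⟩

theorem candidateList_pairwise_ne (mask : List Bool) (t : ℕ) :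
    (I.candidateList mask t).Pairwise fun c c' => c.1 ≠ c'.1 := by
  rw [← List.pairwise_map (f := Prod.fst) (R := (· ≠ ·))]
  change List.Nodup _
  rw [candidateList, candidates, List.map_map,
    ((sortDesc_perm _).map _).nodup_iff, scored_eq, List.map_ofFn, List.nodup_ofFn]
  exact Fin.val_injective

theorem candidateList_pairwise_score (mask : List Bool) (t : ℕ) :
    (I.candidateList mask t).Pairwise fun c c' => ∀ v v' : Fin n, (v : ℕ) = c.1 →
      (v' : ℕ) = c'.1 → I.elementScore mask t v' ≤ I.elementScore mask t v := by
  rw [candidateList, candidates, List.pairwise_map]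
  refine (sortDesc_pairwise _).imp_of_mem ?_
  intro a b ha hb hab v v' hv hv'
  obtain ⟨e, rfl⟩ := I.mem_sorted.1 ha
  obtain ⟨e', rfl⟩ := I.mem_sorted.1 hb
  obtain rfl : v = e := Fin.ext hv
  obtain rfl : v' = e' := Fin.ext hv'
  exact hab

/-- The output of the search tree of a specification. -/
noncomputable def specOutput (z : ℕ) (mask : List Bool) (t : ℕ) : List ℕ :=
  treeOutput I.oracle ((z - 1) * ℓ) (I.candidateList mask t)

theorem exists_mem_specOutput {z : ℕ} (mask : List Bool) (t : ℕ) {W : Finset (Fin n)} {e : Fin n}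
    (hW : I.Feasible (insert e W)) (heW : e ∉ W) (hz : W.card ≤ z - 1) :
    ∃ v : Fin n, (v : ℕ) ∈ I.specOutput z mask t ∧ I.Feasible (insert v W) ∧
      I.elementScore mask t e ≤ I.elementScore mask t v :=
  exists_mem_treeOutput hW heW (I.candidateList_pairwise_ne mask t)
    (fun _ hc => I.mem_candidateList.1 hc) (I.candidateList_pairwise_score mask t)
    (I.mem_candidateList.2 ⟨e, rfl⟩) (Nat.mul_le_mul_right _ hz)

theorem specOutput_lt {z : ℕ} {mask : List Bool} {t : ℕ} : ∀ v ∈ I.specOutput z mask t, v < n := by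
  intro v hv
  obtain ⟨c, hc, rfl⟩ := treeOutput_subset v hv
  obtain ⟨e, rfl⟩ := I.mem_candidateList.1 hc
  exact e.2

theorem specOutput_length_le (z : ℕ) (mask : List Bool) (t : ℕ) :
    (I.specOutput z mask t).length ≤ Γbound ℓ z := by
  refine treeOutput_length_le _ _ fun c hc => ?_
  obtain ⟨e, rfl⟩ := I.mem_candidateList.1 hc
  exact I.matroidList_length_le e

/-! ### Exchanges -/

/-- Points that are assigned to elements which cover them. -/
structure Assignment (K : Finset (Fin n)) (b : Fin n → ℕ) (g : Fin n → Fin n)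
    (T : Fin n → Finset (Fin m)) : Prop where
  feasible : I.Feasible (K.image g)
  subset : ∀ j ∈ K, T j ⊆ I.pts (g j)
  card_le : ∀ j ∈ K, (T j).card ≤ b j
  disjoint : (K : Set (Fin n)).PairwiseDisjoint T

variable {I} {K : Finset (Fin n)} {b : Fin n → ℕ} {z : ℕ} {R : Finset (Fin n)}
  {specs : List (List Bool × ℕ)}

/-- Induction on the number of indices whose element lies outside `R`. For such an index `j`, the
mask contains the share of `j` and avoids all others. A representative `v` in `R` takes the place of
`g j`, and its best selected points become the new share, which is no lighter and is disjoint from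
the other shares. `Inv` abstracts what guarantees that suitable masks remain available after an
exchange. -/
theorem Assignment.exchange {Inv : (Fin n → Finset (Fin m)) → Prop} (hK : K.card ≤ z)
    (hR : ∀ sp ∈ specs, ∀ v : Fin n, (v : ℕ) ∈ I.specOutput z sp.1 sp.2 → v ∈ R)
    (hInv : ∀ T, Inv T → (∀ j ∈ K, (T j).card ≤ b j) → (K : Set (Fin n)).PairwiseDisjoint T →
      ∀ j ∈ K, ∃ mask, (mask, b j) ∈ specs ∧ (∀ p ∈ T j, mask.getD p false = true) ∧
        (∀ i ∈ K, i ≠ j → ∀ p ∈ T i, mask.getD p false = false) ∧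
        ∀ T' : Finset (Fin m), (∀ p ∈ T', mask.getD p false = true) → Inv (Function.update T j T'))
    {g : Fin n → Fin n} {T : Fin n → Finset (Fin m)} (h : I.Assignment K b g T) (hT : Inv T)
    (hg : ∀ j ∈ K, g j ∉ R → ∀ i ∈ K, g i = g j → i = j) :
    ∃ g' T', I.Assignment K b g' T' ∧ (∀ j ∈ K, g' j ∈ R) ∧
      ∑ j ∈ K, ∑ p ∈ T j, I.w p ≤ ∑ j ∈ K, ∑ p ∈ T' j, I.w p := by
  induction hN : (K.filter fun j => g j ∉ R).card using Nat.strong_induction_on generalizing g T with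
  | _ N ih =>
  by_cases hall : ∀ j ∈ K, g j ∈ R
  · exact ⟨g, T, h, hall, le_rfl⟩
  push Not at hall
  obtain ⟨j, hj, hjR⟩ := hall
  obtain ⟨mask, hspec, hTj, hTi, hInv'⟩ := hInv T hT h.card_le h.disjoint j hj
  set W := (K.erase j).image g with hWdef
  have hKW : ∀ v, (K.image (Function.update g j v)) = insert v W := by
    intro v
    ext x
    simp only [hWdef, Finset.mem_image, Finset.mem_insert, Finset.mem_erase]
    constructor
    · rintro ⟨i, hi, rfl⟩
      by_cases hij : i = j
      · subst hij; left; simp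
      · right; exact ⟨i, ⟨hij, hi⟩, by simp [hij]⟩
    · rintro (rfl | ⟨i, ⟨hij, hi⟩, rfl⟩)
      · exact ⟨j, hj, by simp⟩
      · exact ⟨i, hi, by simp [hij]⟩
  have hins : I.Feasible (insert (g j) W) := by
    rw [← hKW, Function.update_eq_self]; exact h.feasible
  -- An element outside `R` belongs to a single index, so removing the index removes the element.
  have hnot : g j ∉ W := by
    rintro hmem
    obtain ⟨i, hi, hij⟩ := Finset.mem_image.1 hmem
    exact (Finset.mem_erase.1 hi).1 (hg j hj hjR i (Finset.mem_erase.1 hi).2 hij)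
  have hcard : W.card ≤ z - 1 := by
    refine Finset.card_image_le.trans ?_
    rw [Finset.card_erase_of_mem hj]; omega
  obtain ⟨v, hv, hvW, hle⟩ := I.exists_mem_specOutput mask (b j) hins hnot hcard
  have hvR : v ∈ R := hR _ hspec v hv
  obtain ⟨T', hT', hmask', hcard', hsum'⟩ := I.exists_sum_eq_elementScore mask (b j) v
  -- The old share is one of the sets of selected points over which the score of `g j` is the
  -- maximum.
  have hwle : ∑ p ∈ T j, I.w p ≤ ∑ p ∈ T', I.w p := by
    rw [hsum']
    exact (I.sum_le_elementScore (h.subset j hj) hTj (h.card_le j hj)).trans hle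
  have hnew : I.Assignment K b (Function.update g j v) (Function.update T j T') := by
    refine ⟨by rw [hKW]; exact hvW, ?_, ?_, ?_⟩
    · intro i hi
      by_cases hij : i = j
      · subst hij; simpa using hT'
      · simpa [hij] using h.subset i hi
    · intro i hi
      by_cases hij : i = j
      · subst hij; simpa using hcard'
      · simpa [hij] using h.card_le i hi
    · have hdis : ∀ i ∈ K, i ≠ j → Disjoint (T i) T' := by
        intro i hi hij
        rw [Finset.disjoint_left]
        intro p hp hp'
        have h1 := hTi i hi hij p hp
        rw [hmask' p hp'] at h1
        cases h1
      intro i hi i' hi' hne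
      simp only [Function.onFun]
      by_cases hij : i = j
      · subst hij
        simpa [hne.symm] using (hdis i' hi' hne.symm).symm
      · by_cases hij' : i' = j
        · subst hij'
          simpa [hij] using hdis i hi hij
        · simpa [hij, hij'] using h.disjoint hi hi' hne
  have hlt : (K.filter fun i => Function.update g j v i ∉ R).card < N := by
    rw [← hN]
    refine Finset.card_lt_card (Finset.ssubset_iff_of_subset ?_ |>.2 ⟨j, ?_, ?_⟩)
    · intro i hi
      rw [Finset.mem_filter] at hi ⊢
      by_cases hij : i = j
      · subst hij; simp [hvR] at hi
      · simpa [hij] using hi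
    · exact Finset.mem_filter.2 ⟨hj, hjR⟩
    · simp [hvR]
  -- The new element `v` may already belong to another index. This is harmless: `v` lies in `R`, and
  -- injectivity is only required at elements outside `R`.
  obtain ⟨g', T'', h1, h2, h3⟩ := ih _ hlt hnew (hInv' T' hmask') (by
    intro i hi hiR i' hi' heq
    by_cases hij : i = j
    · subst hij; simp [hvR] at hiR
    · rw [Function.update_of_ne hij] at hiR heq
      by_cases hij' : i' = j
      · subst hij'
        rw [Function.update_self] at heq
        rw [← heq] at hiR
        exact absurd hvR hiR
      · rw [Function.update_of_ne hij'] at heq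
        exact hg i hi hiR i' hi' heq) rfl
  refine ⟨g', T'', h1, h2, le_trans ?_ h3⟩
  refine Finset.sum_le_sum fun i hi => ?_
  by_cases hij : i = j
  · subst hij; simpa using hwle
  · simp [hij]

/-! ### Kernels -/

variable (I) in
/-- At most `z` points that a feasible set covers, of the largest possible weight. -/
def OptimalPoints (z : ℕ) (Z : Finset (Fin m)) : Prop :=
  Z.card ≤ z ∧ (∃ O, I.Feasible O ∧ Z ⊆ I.covered O) ∧
    ∀ O, I.Feasible O → I.value z O ≤ ∑ p ∈ Z, I.w p

variable (I) in
theorem sum_le_value {S : Finset (Fin n)} {Z : Finset (Fin m)} (hZ : Z ⊆ I.covered S)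
    (hz : Z.card ≤ z) : ∑ p ∈ Z, I.w p ≤ I.value z S :=
  Finset.le_sup' (fun Z => ∑ p ∈ Z, I.w p)
    (Finset.mem_filter.2 ⟨Finset.mem_powerset.2 hZ, hz⟩)

variable (I) in
theorem exists_optimalPoints (z : ℕ) : ∃ Z, I.OptimalPoints z Z := by
  classical
  have hempty : I.Feasible ∅ := fun i => by simp
  obtain ⟨O, hO, hmax⟩ := Finset.exists_max_image
    ((Finset.univ : Finset (Finset (Fin n))).filter fun O => I.Feasible O) (I.value z)
    ⟨∅, by simp [hempty]⟩
  obtain ⟨Z, hZ, hval⟩ := Finset.exists_mem_eq_sup'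
    (s := (I.covered O).powerset.filter fun Z => Z.card ≤ z) ⟨∅, by simp⟩
    fun Z => ∑ p ∈ Z, I.w p
  rw [Finset.mem_filter, Finset.mem_powerset] at hZ
  refine ⟨Z, hZ.2, ⟨O, (Finset.mem_filter.1 hO).2, hZ.1⟩, fun O' hO' => ?_⟩
  rw [← hval]
  exact hmax O' (by simp [hO'])

/-- Every point of `Z` is charged to one element of a feasible set that covers it. Discarding the
elements without a charge leaves at most `z` of them, with disjoint shares whose union is `Z`. After
the exchange the shares still have at most `z` points in total and weigh no less. -/
theorem OptimalPoints.isKernel {Z : Finset (Fin m)} (hZ : I.OptimalPoints z Z)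
    (hR : ∀ sp ∈ specs, ∀ v : Fin n, (v : ℕ) ∈ I.specOutput z sp.1 sp.2 → v ∈ R)
    (Inv : Finset (Fin n) → (Fin n → Finset (Fin m)) → (Fin n → Finset (Fin m)) → Prop)
    (hInv0 : ∀ K T, Inv K T T)
    (hInv : ∀ (K : Finset (Fin n)) (T₀ T : Fin n → Finset (Fin m)), Inv K T₀ T →
      (∀ j ∈ K, T₀ j ⊆ Z) → (∀ j ∈ K, (T₀ j).Nonempty) →
      ∑ j ∈ K, (T₀ j).card ≤ z → (K : Set (Fin n)).PairwiseDisjoint T₀ →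
      (∀ j ∈ K, (T j).card ≤ (T₀ j).card) → (K : Set (Fin n)).PairwiseDisjoint T →
      ∀ j ∈ K, ∃ mask, (mask, (T₀ j).card) ∈ specs ∧ (∀ p ∈ T j, mask.getD p false = true) ∧
        (∀ i ∈ K, i ≠ j → ∀ p ∈ T i, mask.getD p false = false) ∧
        ∀ T' : Finset (Fin m), (∀ p ∈ T', mask.getD p false = true) →
          Inv K T₀ (Function.update T j T')) :
    I.IsKernel z R := by
  classical
  obtain ⟨hcard, ⟨O, hO, hZO⟩, hmax⟩ := hZ
  have hcov : ∀ p : Z, ∃ e ∈ O, p.1 ∈ I.pts e := fun p => Finset.mem_biUnion.1 (hZO p.2)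
  choose φ hφO hφ using hcov
  set T₀ : Fin n → Finset (Fin m) := fun j => Z.filter fun p => ∃ h : p ∈ Z, φ ⟨p, h⟩ = j with hT₀
  set K := O.filter fun j => (T₀ j).Nonempty with hK
  have hdis : (K : Set (Fin n)).PairwiseDisjoint T₀ := by
    intro i _ j _ hij
    rw [Function.onFun, Finset.disjoint_left]
    intro p hp hp'
    obtain ⟨h, h1⟩ := (Finset.mem_filter.1 hp).2
    obtain ⟨h', h2⟩ := (Finset.mem_filter.1 hp').2
    exact hij (h1.symm.trans h2)
  have hunion : K.biUnion T₀ = Z := by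
    ext p
    rw [Finset.mem_biUnion]
    constructor
    · rintro ⟨j, -, hp⟩; exact (Finset.mem_filter.1 hp).1
    · intro hp
      have hp' : p ∈ T₀ (φ ⟨p, hp⟩) := Finset.mem_filter.2 ⟨hp, hp, rfl⟩
      exact ⟨_, Finset.mem_filter.2 ⟨hφO ⟨p, hp⟩, ⟨p, hp'⟩⟩, hp'⟩
  have hne : ∀ j ∈ K, (T₀ j).Nonempty := fun j hj => (Finset.mem_filter.1 hj).2
  have hsum : ∑ j ∈ K, (T₀ j).card ≤ z := by
    rw [← Finset.card_biUnion (fun i hi j hj hij => hdis hi hj hij), hunion]; exact hcard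
  have hKz : K.card ≤ z := by
    refine le_trans ?_ hsum
    rw [Finset.card_eq_sum_ones]
    exact Finset.sum_le_sum fun j hj => (hne j hj).card_pos
  have hass : I.Assignment K (fun j => (T₀ j).card) id T₀ := by
    refine ⟨?_, ?_, fun j _ => le_rfl, hdis⟩
    · rw [Finset.image_id]; exact hO.mono (Finset.filter_subset _ _)
    · intro j _ p hp
      obtain ⟨h, rfl⟩ := (Finset.mem_filter.1 hp).2
      exact hφ ⟨p, h⟩
  obtain ⟨g, T, h1, h2, h3⟩ := hass.exchange (Inv := Inv K T₀) hKz hR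
    (fun T hT hc hd => hInv K T₀ T hT (fun j _ => Finset.filter_subset _ _) hne hsum hdis hc hd)
    (hInv0 K T₀) (fun j _ _ i _ h => h)
  refine ⟨K.image g, ?_, h1.feasible, fun O' hO' => (hmax O' hO').trans ?_⟩
  · intro x hx
    obtain ⟨j, hj, rfl⟩ := Finset.mem_image.1 hx
    exact h2 j hj
  · rw [← hunion, Finset.sum_biUnion hdis]
    refine h3.trans ?_
    rw [← Finset.sum_biUnion h1.disjoint]
    refine I.sum_le_value ?_ ?_
    · intro p hp
      obtain ⟨j, hj, hp⟩ := Finset.mem_biUnion.1 hp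
      exact Finset.mem_biUnion.2 ⟨g j, Finset.mem_image_of_mem _ hj, h1.subset j hj hp⟩
    · rw [Finset.card_biUnion (fun i hi j hj hij => h1.disjoint hi hj hij)]
      exact (Finset.sum_le_sum h1.card_le).trans hsum

/-- Selections by color classes suffice if the points of an optimal set have distinct colors. -/
theorem OptimalPoints.isKernel_of_injOn {Z : Finset (Fin m)} (hZ : I.OptimalPoints z Z)
    (hR : ∀ sp ∈ specs, ∀ v : Fin n, (v : ℕ) ∈ I.specOutput z sp.1 sp.2 → v ∈ R)
    (χ : Fin m → ℕ) (hχ : Set.InjOn χ Z) {Q : ℕ} (hQ : ∀ p, χ p < Q)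
    (hspec : ∀ C ⊆ Finset.range Q, ∃ mask, (mask, C.card) ∈ specs ∧
      ∀ p : Fin m, mask.getD p false = true ↔ χ p ∈ C) :
    I.IsKernel z R := by
  -- The points of a share may change, but their colors stay within the colors of the original
  -- share. As the coloring is injective on `Z`, the color sets of different shares are disjoint, so
  -- the mask of one share avoids the others.
  refine hZ.isKernel hR (fun K T₀ T => ∀ j ∈ K, ∀ p ∈ T j, χ p ∈ (T₀ j).image χ)
    (fun K T j _ p hp => Finset.mem_image_of_mem _ hp) ?_
  intro K T₀ T hT hZ hne _ hd₀ _ _ j hj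
  obtain ⟨mask, hmem, hmask⟩ := hspec ((T₀ j).image χ) (by
    intro c hc
    obtain ⟨p, -, rfl⟩ := Finset.mem_image.1 hc
    exact Finset.mem_range.2 (hQ p))
  -- By injectivity, the size of the color set is the number of points that the element may be
  -- charged with, so one parameter suffices for both.
  rw [Finset.card_image_of_injOn (hχ.mono (by exact_mod_cast hZ j hj))] at hmem
  refine ⟨mask, hmem, fun p hp => (hmask p).2 (hT j hj p hp), ?_, ?_⟩
  · intro i hi hij p hp
    rw [← Bool.not_eq_true, hmask]
    intro hpj
    obtain ⟨q, hq, hqp⟩ := Finset.mem_image.1 (hT i hi p hp)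
    obtain ⟨q', hq', hqp'⟩ := Finset.mem_image.1 hpj
    have : q = q' := hχ (hZ i hi hq) (hZ j hj hq') (hqp.trans hqp'.symm)
    subst this
    exact Finset.disjoint_left.1 (hd₀ hi hj hij) hq hq'
  · intro T' hT' i hi p hp
    by_cases hij : i = j
    · subst hij
      rw [Function.update_self] at hp
      exact (hmask p).1 (hT' p hp)
    · rw [Function.update_of_ne hij] at hp
      exact hT i hi p hp

/-- Selections that separate all small sets of points suffice. -/
theorem isKernel_of_separating
    (hR : ∀ sp ∈ specs, ∀ v : Fin n, (v : ℕ) ∈ I.specOutput z sp.1 sp.2 → v ∈ R)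
    (hspec : ∀ T Y : Finset (Fin m), Disjoint T Y → T.card + Y.card ≤ z → ∀ t, 1 ≤ t → t ≤ z →
      ∃ mask, (mask, t) ∈ specs ∧ (∀ p ∈ T, mask.getD p false = true) ∧
        ∀ p ∈ Y, mask.getD p false = false) :
    I.IsKernel z R := by
  classical
  obtain ⟨Z, hZ⟩ := I.exists_optimalPoints z
  refine hZ.isKernel hR (fun _ _ _ => True) (fun _ _ => trivial) ?_
  intro K T₀ T _ _ hne hsum _ hc hd j hj
  -- No invariant is needed here: no share ever exceeds its original size, so the current shares
  -- always form a small family that some mask separates.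
  have hle : ∑ i ∈ K, (T i).card ≤ z := (Finset.sum_le_sum hc).trans hsum
  rw [← Finset.add_sum_erase _ _ hj] at hle
  obtain ⟨mask, h1, h2, h3⟩ := hspec (T j) ((K.erase j).biUnion T) (by
      rw [Finset.disjoint_biUnion_right]
      intro i hi
      exact hd hj (Finset.mem_erase.1 hi).2 (Finset.mem_erase.1 hi).1.symm)
    (le_trans (Nat.add_le_add_left Finset.card_biUnion_le _) hle) (T₀ j).card
    (hne j hj).card_pos ((Finset.single_le_sum (f := fun i => (T₀ i).card)
      (fun _ _ => Nat.zero_le _) hj).trans hsum)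
  exact ⟨mask, h1, h2, fun i hi hij p hp => h3 p (Finset.mem_biUnion.2
    ⟨i, Finset.mem_erase.2 ⟨hij, hi⟩, hp⟩), fun _ _ => trivial⟩

end CoverageInstance

/-! ### The program for a list of specifications -/

namespace Prog

/-- Run the search trees of all specifications. -/
def mainP : Prog (.prod (.list specTy) CoverageInstance.inputTy) (.list .nat) :=
  flatMapE .fst (.seq (.pair .fst (.seq .snd .snd)) treeP)

/-- Time for one specification, apart from sorting and up to factors depending on the size of the
instance. -/
def mainBound (ℓ z : ℕ) : ℕ := 2000 * ((ℓ + 1) ^ (z * ℓ + 2) * (z * ℓ + 1) ^ 2) + 49 * z + 100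

theorem Γbound_le (ℓ z : ℕ) : Γbound ℓ z ≤ (ℓ + 1) ^ (z * ℓ + 2) * (z * ℓ + 1) ^ 2 := by
  have hD : (z - 1) * ℓ ≤ z * ℓ := Nat.mul_le_mul_right _ (Nat.sub_le _ _)
  calc Γbound ℓ z ≤ ∑ q ∈ Finset.range ((z - 1) * ℓ + 1), (ℓ + 1) ^ (z * ℓ + 2) :=
        Finset.sum_le_sum fun q hq => (Nat.pow_le_pow_left (Nat.le_succ _) _).trans
          (Nat.pow_le_pow_right (Nat.succ_pos _) (by have := Finset.mem_range.1 hq; omega))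
    _ = ((z - 1) * ℓ + 1) * (ℓ + 1) ^ (z * ℓ + 2) := by simp
    _ ≤ (z * ℓ + 1) ^ 2 * (ℓ + 1) ^ (z * ℓ + 2) :=
        Nat.mul_le_mul_right _ ((Nat.succ_le_succ hD).trans (Nat.le_self_pow (by norm_num) _))
    _ = _ := mul_comm _ _

variable {ℓ n m s : ℕ} (I : CoverageInstance ℓ n m s) (z : ℕ) (specs : List (List Bool × ℕ))

theorem mainP_val : mainP.val I.oracle (specs, I.input z)
    = specs.flatMap fun sp => I.specOutput z sp.1 sp.2 := by
  rw [mainP, flatMapE_val]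
  refine List.flatMap_congr fun sp _ => ?_
  have h := treeP_val I.oracle ((sp, I.input z) : envTy.Val) (ℓ := ℓ) (z := z) rfl rfl
  refine h.trans ?_
  rw [CoverageInstance.input_eq]
  rfl

theorem treeP_queries_le_of_input (sp : List Bool × ℕ) :
    treeP.cost 0 1 I.oracle (sp, I.input z) ≤ n * Γbound ℓ z := by
  rw [CoverageInstance.input_eq]
  refine treeP_queries_le I.oracle _ rfl rfl (by simp) ?_
  intro y hy
  obtain ⟨e, rfl⟩ := List.mem_ofFn.1 hy
  exact I.matroidList_length_le e

theorem mainP_queries_le :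
    mainP.cost 0 1 I.oracle (specs, I.input z) ≤ n * (specs.length * Γbound ℓ z) := by
  rw [mainP, flatMapE_cost]
  simp only [cost, val, mul_zero, zero_add, add_zero]
  refine (sum_map_le le_rfl fun sp _ => treeP_queries_le_of_input I z sp).trans (le_of_eq ?_)
  ring

theorem pointList_bounds (e : Fin n) :
    (I.pointList e).length ≤ m ∧ ∀ p ∈ I.pointList e, p ≤ m := by
  constructor
  · rw [CoverageInstance.pointList, List.length_map, Finset.length_sort]
    simpa using Finset.card_le_univ (I.pts e)
  · intro p hp
    obtain ⟨q, -, rfl⟩ := List.mem_map.1 hp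
    exact q.2.le

/-- The number of points of a specification is only bounded by `2 * z` because a set of colors can
be larger than `z`. -/
theorem treeP_cost_le_of_input (sp : List Bool × ℕ) (hsp : sp.2 ≤ 2 * z) :
    treeP.cost 1 1 I.oracle (sp, I.input z) ≤ n * (Nat.clog 2 n + 1)
      + (n + 1) * (m + 1) ^ 2 * treeBound ℓ z (2 * z) := by
  rw [CoverageInstance.input_eq]
  refine (treeP_cost_le (ℓ := ℓ) (z := z) (n := n) (m := m) I.oracle _ rfl rfl (by simp) ?_ ?_).trans ?_
  · intro y hy
    obtain ⟨e, rfl⟩ := List.mem_ofFn.1 hy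
    exact I.matroidList_length_le e
  · intro y hy
    obtain ⟨e, rfl⟩ := List.mem_ofFn.1 hy
    exact pointList_bounds I e
  · have : treeBound ℓ z sp.2 ≤ treeBound ℓ z (2 * z) := by simp only [treeBound]; omega
    gcongr

theorem mainP_cost_le (hsp : ∀ sp ∈ specs, sp.2 ≤ 2 * z) :
    mainP.cost 1 1 I.oracle (specs, I.input z) ≤ specs.length * (n * (Nat.clog 2 n + 1))
      + (specs.length + 1) * ((n + 1) * (m + 1) ^ 2 * mainBound ℓ z) := by
  have h : mainP.cost 1 1 I.oracle (specs, I.input z) ≤ 1 + specs.length * (n * (Nat.clog 2 n + 1)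
      + (n + 1) * (m + 1) ^ 2 * treeBound ℓ z (2 * z) + 6 + Γbound ℓ z * 10 + 20) + 12 :=
    flatMapE_time_le (k := Γbound ℓ z) I.oracle
    (lst := (.fst : Prog (.prod (.list specTy) CoverageInstance.inputTy) (.list specTy)))
    (body := .seq (.pair .fst (.seq .snd .snd)) treeP) (x := (specs, I.input z)) (tl := 1)
    (B := n * (Nat.clog 2 n + 1) + (n + 1) * (m + 1) ^ 2 * treeBound ℓ z (2 * z) + 6) le_rfl le_rfl
    (fun sp hs => by
      have := treeP_cost_le_of_input I z sp (hsp sp hs)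
      simp only [cost, val]
      omega)
    (fun sp hs => by
      have h := treeP_val I.oracle ((sp, I.input z) : envTy.Val) (ℓ := ℓ) (z := z) rfl rfl
      simp only [val]
      rw [h, CoverageInstance.input_eq]
      exact I.specOutput_length_le z sp.1 sp.2)
  refine h.trans ?_
  have hΓ := Γbound_le ℓ z
  have hmain : treeBound ℓ z (2 * z) + (10 * Γbound ℓ z + 26) ≤ mainBound ℓ z := by
    simp only [treeBound, mainBound]; omega
  have hA : 1 ≤ (n + 1) * (m + 1) ^ 2 := Nat.succ_le_of_lt (by positivity)
  generalize (n + 1) * (m + 1) ^ 2 = A at *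
  generalize n * (Nat.clog 2 n + 1) = S at *
  have h1 : S + A * treeBound ℓ z (2 * z) + 6 + Γbound ℓ z * 10 + 20 ≤ S + A * mainBound ℓ z := by
    have := Nat.mul_le_mul_left A hmain
    have h2 := Nat.mul_le_mul_right (10 * Γbound ℓ z + 26) hA
    rw [mul_add] at this
    omega
  have h3 : 13 ≤ A * mainBound ℓ z := by
    have := Nat.mul_le_mul_right (mainBound ℓ z) hA
    have : 100 ≤ mainBound ℓ z := by simp only [mainBound]; omega
    omega
  have h4 := Nat.mul_le_mul_left specs.length h1
  rw [mul_add specs.length S (A * mainBound ℓ z)] at h4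
  rw [add_one_mul]
  omega

end Prog

/-! ### Expectations of randomized programs -/

open scoped ENNReal

/-- The expectation of a nonnegative function of the result of a computation. -/
noncomputable def Run.expect {α : Type} (x : Run α) (φ : α → ℝ≥0∞) : ℝ≥0∞ :=
  ∑' r, x r * φ r.1

theorem PMF.tsum_bind_mul {α β : Type} (p : PMF α) (f : α → PMF β) (φ : β → ℝ≥0∞) :
    ∑' b, p.bind f b * φ b = ∑' a, p a * ∑' b, f a b * φ b := by
  simp only [PMF.bind_apply, ← ENNReal.tsum_mul_right, ← ENNReal.tsum_mul_left]
  rw [ENNReal.tsum_comm]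
  simp only [mul_assoc]

theorem PMF.tsum_pure_mul {α : Type} (a : α) (φ : α → ℝ≥0∞) :
    ∑' b, PMF.pure a b * φ b = φ a := by
  rw [tsum_eq_single a]
  · simp
  · intro b hb; simp [PMF.pure_apply, hb]

theorem PMF.tsum_map_mul {α β : Type} (p : PMF α) (f : α → β) (φ : β → ℝ≥0∞) :
    ∑' b, p.map f b * φ b = ∑' a, p a * φ (f a) := by
  rw [PMF.map, PMF.tsum_bind_mul]
  simp only [Function.comp, PMF.tsum_pure_mul]

namespace Run

variable {α β : Type}

theorem expect_pure (a : α) (c : Cost) (φ : α → ℝ≥0∞) : expect (PMF.pure (a, c)) φ = φ a :=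
  PMF.tsum_pure_mul _ _

theorem expect_bind (x : Run α) (f : α → Run β) (φ : β → ℝ≥0∞) :
    (x.bind f).expect φ = x.expect fun a => (f a).expect φ := by
  unfold expect Run.bind
  rw [PMF.tsum_bind_mul]
  simp only [PMF.tsum_map_mul]

theorem expect_tick (x : Run α) (φ : α → ℝ≥0∞) : x.tick.expect φ = x.expect φ := by
  rw [tick, expect_bind, ret, expect_pure]

theorem expect_ret (t : ℕ) (a : α) (φ : α → ℝ≥0∞) : (ret t a).expect φ = φ a := expect_pure _ _ _

/-- The comparison is required on the support only, so facts that hold for every possible outcome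
may be used inside an expectation. -/
theorem expect_mono (x : Run α) {φ ψ : α → ℝ≥0∞} (h : ∀ r ∈ x.support, φ r.1 ≤ ψ r.1) :
    x.expect φ ≤ x.expect ψ := by
  refine ENNReal.tsum_le_tsum fun r => ?_
  by_cases hr : r ∈ x.support
  · exact mul_le_mul_right (h r hr) _
  · rw [PMF.mem_support_iff, not_not] at hr
    simp [hr]

theorem expect_const (x : Run α) (c : ℝ≥0∞) : (x.expect fun _ => c) = c := by
  rw [expect, ENNReal.tsum_mul_right, PMF.tsum_coe, one_mul]

theorem expect_mul_const (x : Run α) (φ : α → ℝ≥0∞) (c : ℝ≥0∞) :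
    (x.expect fun a => φ a * c) = x.expect φ * c := by
  simp only [expect, ← mul_assoc, ENNReal.tsum_mul_right]

theorem expect_add (x : Run α) (φ ψ : α → ℝ≥0∞) :
    (x.expect fun a => φ a + ψ a) = x.expect φ + x.expect ψ := by
  simp only [expect, mul_add, ENNReal.tsum_add]

theorem toOuterMeasure_eq_expect (x : Run α) (A : Set α) :
    x.toOuterMeasure {r | r.1 ∈ A} = x.expect (A.indicator 1) := by
  rw [PMF.toOuterMeasure_apply, expect]
  refine tsum_congr fun r => ?_
  by_cases h : r.1 ∈ A <;> simp [Set.indicator, h]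

end Run

namespace Prog

variable {a b c : Ty} (orc : ℕ → List ℕ → Bool)

/-- The expectation of a nonnegative function of the result of a program. -/
noncomputable def expect (P : Prog a b) (x : a.Val) (φ : b.Val → ℝ≥0∞) : ℝ≥0∞ :=
  (P.run orc x).expect φ

theorem expect_det {P : Prog a b} (hP : P.isDet = true) (x : a.Val) (φ : b.Val → ℝ≥0∞) :
    P.expect orc x φ = φ (P.val orc x) := by
  rw [expect, run_eq_pure orc P (deterministic_of_isDet hP), Run.expect_pure]

theorem expect_seq (f : Prog a b) (g : Prog b c) (x : a.Val) (φ : c.Val → ℝ≥0∞) :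
    (Prog.seq f g).expect orc x φ = f.expect orc x fun y => g.expect orc y φ := by
  simp only [expect, run, Run.expect_tick, Run.expect_bind]

theorem expect_pair (f : Prog a b) (g : Prog a c) (x : a.Val) (φ : (Ty.prod b c).Val → ℝ≥0∞) :
    (Prog.pair f g).expect orc x φ
      = f.expect orc x fun y => g.expect orc x fun y' => φ (y, y') := by
  simp only [expect, run, Run.expect_tick, Run.expect_bind, Run.expect_ret]

theorem expect_cond (t : Prog a .bool) (f g : Prog a b) (x : a.Val) (φ : b.Val → ℝ≥0∞) :
    (Prog.cond t f g).expect orc x φ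
      = t.expect orc x fun v => bif v then f.expect orc x φ else g.expect orc x φ := by
  simp only [expect, run, Run.expect_tick, Run.expect_bind]
  congr 1
  funext v
  cases v <;> rfl

theorem expect_iter_zero (f : Prog a a) (x : a.Val) (φ : a.Val → ℝ≥0∞) :
    (Prog.iter f).expect orc (0, x) φ = φ x := by
  simp only [expect, run, Run.expect_tick, Run.iter, Run.expect_ret]

theorem expect_iter_succ (f : Prog a a) (k : ℕ) (x : a.Val) (φ : a.Val → ℝ≥0∞) :
    (Prog.iter f).expect orc (k + 1, x) φ
      = f.expect orc x fun y => (Prog.iter f).expect orc (k, y) φ := by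
  simp only [expect, run, Run.expect_tick, Run.iter, Run.expect_bind]

theorem expect_flip (x : a.Val) (φ : Bool → ℝ≥0∞) :
    (Prog.flip (a := a)).expect orc x φ = (φ false + φ true) / 2 := by
  have h : (Prog.flip (a := a)).run orc x
    = (PMF.uniformOfFintype Bool).map fun v => (v, (⟨1, 0⟩ : Cost)) := rfl
  rw [expect, Run.expect, h, PMF.tsum_map_mul, tsum_fintype]
  simp only [PMF.uniformOfFintype_apply, Fintype.card_bool, Fintype.sum_bool]
  rw [← mul_add, add_comm, mul_comm, ENNReal.div_eq_inv_mul, mul_comm]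
  simp

/-! ### Guarantees for every possible outcome -/

/-- All possible results satisfy `post`, within `t` steps and with at most `q` queries. -/
def Ensures (P : Prog a b) (x : a.Val) (post : b.Val → Prop) (t q : ℕ) : Prop :=
  ∀ r ∈ (P.run orc x).support, post r.1 ∧ r.2.time ≤ t ∧ r.2.queries ≤ q

theorem mem_support_bind {α β : Type} {x : Run α} {f : α → Run β} {r : β × Cost}
    (hr : r ∈ (x.bind f).support) : ∃ p ∈ x.support, ∃ q ∈ (f p.1).support,
      r = (q.1, ⟨p.2.time + q.2.time, p.2.queries + q.2.queries⟩) := by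
  rw [Run.bind, PMF.mem_support_bind_iff] at hr
  obtain ⟨p, hp, hr⟩ := hr
  rw [PMF.mem_support_map_iff] at hr
  obtain ⟨q, hq, rfl⟩ := hr
  exact ⟨p, hp, q, hq, rfl⟩

theorem mem_support_tick {α : Type} {x : Run α} {r : α × Cost} (hr : r ∈ x.tick.support) :
    ∃ q ∈ x.support, r = (q.1, ⟨1 + q.2.time, q.2.queries⟩) := by
  obtain ⟨p, hp, q, hq, rfl⟩ := mem_support_bind hr
  rw [Run.ret, PMF.support_pure, Set.mem_singleton_iff] at hp
  subst hp
  exact ⟨q, hq, by simp⟩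

variable {orc}

theorem Ensures.mono {P : Prog a b} {x : a.Val} {post post' : b.Val → Prop} {t t' q : ℕ}
    (h : P.Ensures orc x post t q) (hp : ∀ y, post y → post' y) (ht : t ≤ t') :
    P.Ensures orc x post' t' q := fun r hr =>
  ⟨hp _ (h r hr).1, (h r hr).2.1.trans ht, (h r hr).2.2⟩

theorem ensures_det {P : Prog a b} (hP : P.isDet = true) (x : a.Val) {post : b.Val → Prop}
    (h : post (P.val orc x)) {t q : ℕ} (ht : P.cost 1 1 orc x ≤ t) (hq : P.cost 0 1 orc x ≤ q) :
    P.Ensures orc x post t q := by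
  intro r hr
  rw [run_eq_pure orc P (deterministic_of_isDet hP), PMF.support_pure,
    Set.mem_singleton_iff] at hr
  subst hr
  exact ⟨h, ht, hq⟩

theorem Ensures.seq {f : Prog a b} {g : Prog b c} {x : a.Val} {post : b.Val → Prop}
    {post' : c.Val → Prop} {t t' q q' : ℕ} (hf : f.Ensures orc x post t q)
    (hg : ∀ y, post y → g.Ensures orc y post' t' q') :
    (Prog.seq f g).Ensures orc x post' (t + t' + 1) (q + q') := by
  intro r hr
  rw [Prog.run] at hr
  obtain ⟨r', hr', rfl⟩ := mem_support_tick hr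
  obtain ⟨p, hp, u, hu, rfl⟩ := mem_support_bind hr'
  have h1 := hf p hp
  have h2 := hg _ h1.1 u hu
  exact ⟨h2.1, by simp only; omega, by simp only; omega⟩

theorem Ensures.pair {f : Prog a b} {g : Prog a c} {x : a.Val} {post : b.Val → Prop}
    {post' : c.Val → Prop} {t t' q q' : ℕ} (hf : f.Ensures orc x post t q)
    (hg : g.Ensures orc x post' t' q') :
    (Prog.pair f g).Ensures orc x (fun y => post y.1 ∧ post' y.2) (t + t' + 1) (q + q') := by
  intro r hr
  rw [Prog.run] at hr
  obtain ⟨r', hr', rfl⟩ := mem_support_tick hr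
  obtain ⟨p, hp, u, hu, rfl⟩ := mem_support_bind hr'
  obtain ⟨u', hu', u'', hu'', rfl⟩ := mem_support_bind hu
  rw [Run.ret, PMF.support_pure, Set.mem_singleton_iff] at hu''
  subst hu''
  have h1 := hf p hp
  have h2 := hg u' hu'
  exact ⟨⟨h1.1, h2.1⟩, by simp only; omega, by simp only; omega⟩

theorem Ensures.cond {u : Prog a .bool} {f g : Prog a b} {x : a.Val} {post : b.Val → Prop}
    {t t' q q' : ℕ} (hu : u.Ensures orc x (fun _ => True) t q) (hf : f.Ensures orc x post t' q')
    (hg : g.Ensures orc x post t' q') :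
    (Prog.cond u f g).Ensures orc x post (t + t' + 1) (q + q') := by
  intro r hr
  rw [Prog.run] at hr
  obtain ⟨r', hr', rfl⟩ := mem_support_tick hr
  obtain ⟨p, hp, v, hv, rfl⟩ := mem_support_bind hr'
  have h1 := hu p hp
  have h2 : post v.1 ∧ v.2.time ≤ t' ∧ v.2.queries ≤ q' := by
    cases h : p.1
    · rw [h] at hv; exact hg v hv
    · rw [h] at hv; exact hf v hv
  exact ⟨h2.1, by simp only; omega, by simp only; omega⟩

theorem ensures_flip (x : a.Val) : (Prog.flip (a := a)).Ensures orc x (fun _ => True) 1 0 := by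
  intro r hr
  have h : (Prog.flip (a := a)).run orc x
    = (PMF.uniformOfFintype Bool).map fun v => (v, (⟨1, 0⟩ : Cost)) := rfl
  rw [h, PMF.mem_support_map_iff] at hr
  obtain ⟨v, -, rfl⟩ := hr
  exact ⟨trivial, le_rfl, le_rfl⟩

theorem Ensures.iter {f : Prog a a} {x : (Ty.prod .nat a).Val} {t : ℕ} (Inv : ℕ → a.Val → Prop)
    (h0 : Inv 0 x.2) (hf : ∀ i < (x.1 : ℕ), ∀ y, Inv i y → f.Ensures orc y (Inv (i + 1)) t 0) :
    (Prog.iter f).Ensures orc x (Inv x.1) (x.1 * t + 1) 0 := by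
  have key : ∀ (k : ℕ) (Inv : ℕ → a.Val → Prop) (x : a.Val), Inv 0 x →
      (∀ i < k, ∀ y, Inv i y → f.Ensures orc y (Inv (i + 1)) t 0) →
      ∀ r ∈ (Run.iter (fun y => f.run orc y) k x).support,
        Inv k r.1 ∧ r.2.time ≤ k * t ∧ r.2.queries ≤ 0 := by
    intro k
    induction k with
    | zero =>
      intro Inv x h0 _ r hr
      rw [Run.iter, Run.ret, PMF.support_pure, Set.mem_singleton_iff] at hr
      subst hr
      exact ⟨h0, by simp, le_rfl⟩
    | succ k ih =>
      intro Inv x h0 hf r hr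
      obtain ⟨p, hp, q, hq, rfl⟩ := mem_support_bind hr
      have h1 := hf 0 (Nat.succ_pos _) x h0 p hp
      have h2 := ih (fun i => Inv (i + 1)) p.1 h1.1
        (fun i hi y hy => hf (i + 1) (by omega) y hy) q hq
      refine ⟨h2.1, ?_, by simp only; omega⟩
      simp only
      rw [Nat.succ_mul]
      omega
  intro r hr
  rw [Prog.run] at hr
  obtain ⟨r', hr', rfl⟩ := mem_support_tick hr
  have h := key x.1 Inv x.2 h0 hf r' hr'
  exact ⟨h.1, by simp only; omega, h.2.2⟩

/-! ### Random colorings -/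

/-- A uniformly random number with the given number of binary digits. -/
def colorP : Prog .nat .nat :=
  .seq (.pair .id (.natConst 0))
    (.iter (.cond .flip (addP (addP .id .id) (.natConst 1)) (addP .id .id)))

/-- The results of several executions of a program. -/
def replicateP (f : Prog a b) : Prog (.prod .nat a) (.list b) :=
  .seq (.seq (.pair .fst (.pair .snd .nil)) (.iter (.pair .fst (consP (.seq .fst f) .snd)))) .snd

/-- A random coloring of the given number of points, with colors of the given number of digits. -/
def coloringP : Prog (.prod .nat .nat) (.list .nat) := replicateP colorP

/-- Several random colorings. -/
def coloringsP : Prog (.prod .nat (.prod .nat .nat)) (.list (.list .nat)) := replicateP coloringP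

variable (orc)

theorem expect_addP (f g : Prog a .nat) (hf : f.isDet = true) (hg : g.isDet = true) (x : a.Val)
    (φ : ℕ → ℝ≥0∞) :
    (addP f g).expect orc x φ = φ ((f.val orc x : ℕ) + (g.val orc x : ℕ) : ℕ) := by
  rw [expect_det orc (by simp [addP, isDet, hf, hg])]
  rfl

theorem expect_consP (f : Prog a b) (g : Prog a (.list b)) (x : a.Val)
    (φ : List b.Val → ℝ≥0∞) : (consP f g).expect orc x φ
      = f.expect orc x fun y => g.expect orc x fun l => φ (y :: l) := by
  rw [consP, expect_seq, expect_pair]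
  congr 1; funext y; congr 1; funext l
  exact expect_det orc rfl _ _

/-- The state `c` consists of the leading binary digits; with `j` flips to go the result is uniform
on the `2 ^ j` numbers starting at `2 ^ j * c`. -/
theorem expect_colorP_iter (j c : ℕ) (φ : ℕ → ℝ≥0∞) :
    (Prog.iter (.cond .flip (addP (addP .id .id) (.natConst 1)) (addP .id .id)) :
      Prog (.prod .nat .nat) .nat).expect orc (j, c) φ
      = (∑ i ∈ Finset.range (2 ^ j), φ (2 ^ j * c + i)) / 2 ^ j := by
  induction j generalizing c with
  | zero => rw [expect_iter_zero]; simp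
  | succ j ih =>
    rw [expect_iter_succ, expect_cond, expect_flip]
    simp only [cond_true, cond_false]
    rw [expect_addP orc _ _ rfl rfl, expect_addP orc _ _ rfl rfl]
    simp only [val, addP_val]
    rw [ih, ih, ← ENNReal.add_div, pow_succ, mul_two, Finset.sum_range_add, ENNReal.div_eq_inv_mul,
      ENNReal.div_eq_inv_mul, ENNReal.div_eq_inv_mul, ← mul_assoc]
    congr 1
    · rw [pow_succ, ENNReal.mul_inv (by simp) (by simp), mul_comm]
    · congr 1
      · refine Finset.sum_congr rfl fun i _ => ?_
        congr 1; ring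
      · refine Finset.sum_congr rfl fun i _ => ?_
        congr 1; ring

theorem expect_colorP (j : ℕ) (φ : ℕ → ℝ≥0∞) :
    colorP.expect orc j φ = (∑ i ∈ Finset.range (2 ^ j), φ i) / 2 ^ j := by
  rw [colorP, expect_seq, expect_det orc rfl]
  refine (expect_colorP_iter orc j 0 φ).trans ?_
  simp

theorem expect_coloring_step (x : (Ty.prod .nat (.list .nat)).Val)
    (φ : (Ty.prod .nat (.list .nat)).Val → ℝ≥0∞) :
    (Prog.pair .fst (consP (.seq .fst colorP) .snd) :
      Prog (.prod .nat (.list .nat)) _).expect orc x φ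
      = (∑ i ∈ Finset.range (2 ^ (x.1 : ℕ)), φ (x.1, i :: x.2)) / 2 ^ (x.1 : ℕ) := by
  rw [expect_pair, expect_det orc rfl, expect_consP, expect_seq, expect_det orc rfl]
  refine (expect_colorP orc _ _).trans ?_
  simp only [expect_det orc (show (Prog.snd : Prog (.prod .nat (.list .nat)) _).isDet = true from rfl),
    val]

/-- The weight `∏_{e ≤ i < z} (z - i) / z`. -/
noncomputable def injWeight (z e : ℕ) : ℝ≥0∞ :=
  ∏ i ∈ Finset.Ico e z, (((z - i : ℕ) : ℝ≥0∞) / z)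

theorem injWeight_le_one (z e : ℕ) : injWeight z e ≤ 1 := by
  refine Finset.prod_le_one' fun i _ => ?_
  exact ENNReal.div_le_of_le_mul (by rw [one_mul]; exact_mod_cast Nat.sub_le _ _)

theorem injWeight_eq {z e : ℕ} (h : e < z) :
    injWeight z e = (((z - e : ℕ) : ℝ≥0∞) / z) * injWeight z (e + 1) := by
  rw [injWeight, Finset.prod_eq_prod_Ico_succ_bot h, injWeight]

theorem injWeight_mono {z e e' : ℕ} (h : e ≤ e') : injWeight z e ≤ injWeight z e' := by
  refine Finset.prod_le_prod_of_subset_of_le_one' (Finset.Ico_subset_Ico_left h) fun i _ _ => ?_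
  exact ENNReal.div_le_of_le_mul (by rw [one_mul]; exact_mod_cast Nat.sub_le _ _)

theorem injWeight_zero (z : ℕ) :
    injWeight z 0 = ENNReal.ofReal ((z.factorial : ℝ) / (z : ℝ) ^ z) := by
  rcases Nat.eq_zero_or_pos z with rfl | hz
  · simp [injWeight]
  have hz' : (0 : ℝ) < z := by exact_mod_cast hz
  rw [← Nat.descFactorial_self, Nat.descFactorial_eq_prod_range, Nat.cast_prod,
    injWeight, Nat.Ico_zero_eq_range]
  have : ((z : ℝ) ^ z) = ∏ _i ∈ Finset.range z, (z : ℝ) := by simp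
  rw [this, ← Finset.prod_div_distrib, ENNReal.ofReal_prod_of_nonneg (fun i _ => by positivity)]
  refine Finset.prod_congr rfl fun i _ => ?_
  rw [ENNReal.ofReal_div_of_pos hz', ENNReal.ofReal_natCast, ENNReal.ofReal_natCast]

/-- Colors are pushed to the front of the list, so the points are colored from the last to the
first. With `k` points to go, entry `p - k` of `l` is the color of `p`. If the points of `Z` from
`k` on have distinct colors and there are `e` of them, then `injWeight z e` bounds the probability
that the remaining ones become distinct too. -/
theorem le_expect_coloring_iter {Z : Finset ℕ} {z j : ℕ} (hz : 1 ≤ z) (hj : z ≤ 2 ^ j)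
    (hZ : Z.card ≤ z) (k : ℕ) (l : List ℕ)
    (hl : Set.InjOn (fun p => l.getD (p - k) 0) {p | p ∈ Z ∧ k ≤ p}) :
    injWeight z (Z.filter (k ≤ ·)).card ≤
      (Prog.iter (.pair .fst (consP (.seq .fst colorP) .snd)) :
        Prog (.prod .nat (.prod .nat (.list .nat))) _).expect orc (k, (j, l))
        (fun x => Set.indicator {l : List ℕ | Set.InjOn (fun p => l.getD p 0) Z} 1 x.2) := by
  induction k generalizing l with
  | zero =>
    rw [expect_iter_zero, Set.indicator_of_mem]
    · exact injWeight_le_one _ _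
    · simpa using hl
  | succ k ih =>
    rw [expect_iter_succ, expect_coloring_step]
    simp only
    by_cases hk : k ∈ Z
    · have hcard : (Z.filter (k ≤ ·)).card = (Z.filter (k + 1 ≤ ·)).card + 1 := by
        rw [← Finset.card_insert_of_notMem (a := k) (by simp)]
        congr 1
        ext p
        simp only [Finset.mem_filter, Finset.mem_insert]
        constructor
        · rintro ⟨h1, h2⟩
          rcases h2.eq_or_lt with h | h
          · exact .inl h.symm
          · exact .inr ⟨h1, h⟩
        · rintro (rfl | h)
          · exact ⟨hk, le_rfl⟩
          · exact ⟨h.1, by omega⟩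
      set e := (Z.filter (k + 1 ≤ ·)).card with he
      have hez : e < z := by
        have := Finset.card_filter_le Z (k ≤ ·)
        omega
      have hz0 : (z : ℝ≥0∞) ≠ 0 := by exact_mod_cast (by omega : z ≠ 0)
      rw [injWeight_eq hez, ENNReal.le_div_iff_mul_le (by simp) (by simp)]
      -- The colors that the next point has to avoid; at most `e` of them.
      set used := (Z.filter (k + 1 ≤ ·)).image fun p => l.getD (p - (k + 1)) 0 with hused
      have hu : used.card ≤ e := Finset.card_image_le
      rw [hcard] at ih
      calc (((z - e : ℕ) : ℝ≥0∞) / z) * injWeight z (e + 1) * 2 ^ j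
          ≤ injWeight z (e + 1) * ((Finset.range (2 ^ j) \ used).card : ℝ≥0∞) := ?_
        _ = ∑ i ∈ Finset.range (2 ^ j) \ used, injWeight z (e + 1) := by
            rw [Finset.sum_const, nsmul_eq_mul, mul_comm]
        _ ≤ ∑ i ∈ Finset.range (2 ^ j) \ used, _ := Finset.sum_le_sum fun i hi => ih _ ?_
        _ ≤ _ := Finset.sum_le_sum_of_subset Finset.sdiff_subset
      · rw [mul_right_comm, mul_comm]
        refine mul_le_mul_right ?_ _
        rw [← ENNReal.mul_div_right_comm]
        refine ENNReal.div_le_of_le_mul ?_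
        have h1 : 2 ^ j - e ≤ (Finset.range (2 ^ j) \ used).card := by
          have := Finset.le_card_sdiff used (Finset.range (2 ^ j))
          rw [Finset.card_range] at this
          omega
        -- A fresh color has probability at least `(2 ^ j - e) / 2 ^ j`, which is at least `(z - e)
        -- / z` since there are at least `z` colors.
        have h2 : (z - e) * 2 ^ j ≤ (2 ^ j - e) * z := by
          zify [hez.le, hez.le.trans hj]
          nlinarith
        exact_mod_cast h2.trans (Nat.mul_le_mul_right z h1)
      · intro p hp p' hp' h
        have hiu : ∀ q : ℕ, q ∈ Z → k + 1 ≤ q → i ≠ l.getD (q - (k + 1)) 0 := by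
          rintro q hq hq' rfl
          exact (Finset.mem_sdiff.1 hi).2 (Finset.mem_image.2
            ⟨q, Finset.mem_filter.2 ⟨hq, hq'⟩, rfl⟩)
        have h2 : ∀ q : ℕ, k + 1 ≤ q → (i :: l).getD (q - k) 0 = l.getD (q - (k + 1)) 0 :=
          fun q hq => by rw [show q - k = q - (k + 1) + 1 by omega, List.getD_cons_succ]
        have h3 : (i :: l).getD (k - k) 0 = i := by simp
        simp only at h
        rcases hp.2.eq_or_lt with rfl | h4 <;> rcases hp'.2.eq_or_lt with h5 | h5
        · exact h5
        · rw [h3, h2 _ h5] at h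
          exact absurd h (hiu _ hp'.1 h5)
        · rw [← h5, h3, h2 _ h4] at h
          exact absurd h.symm (hiu _ hp.1 h4)
        · rw [h2 _ h4, h2 _ h5] at h
          exact hl ⟨hp.1, h4⟩ ⟨hp'.1, h5⟩ h
    -- The color of a point outside `Z` does not matter: the same bound holds for every choice.
    · have hcard : Z.filter (k + 1 ≤ ·) = Z.filter (k ≤ ·) := by
        refine Finset.filter_congr fun p hp => ⟨fun h => by omega, fun h => ?_⟩
        rcases h.eq_or_lt with h | h
        · exact absurd (h ▸ hp) hk
        · exact h
      rw [hcard, ENNReal.le_div_iff_mul_le (by simp) (by simp)]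
      calc _ = ∑ i ∈ Finset.range (2 ^ j), injWeight z (Z.filter (k ≤ ·)).card := by
            simp [mul_comm (_ ^ _)]
        _ ≤ _ := Finset.sum_le_sum fun i _ => ih _ ?_
      intro p hp p' hp' h
      have h1 : ∀ q : ℕ, q ∈ Z ∧ k ≤ q → k + 1 ≤ q := fun q hq => by
        rcases hq.2.eq_or_lt with h | h
        · exact absurd (h ▸ hq.1) hk
        · exact h
      refine hl ⟨hp.1, h1 p hp⟩ ⟨hp'.1, h1 p' hp'⟩ ?_
      have h2 : ∀ q : ℕ, k + 1 ≤ q → (i :: l).getD (q - k) 0 = l.getD (q - (k + 1)) 0 :=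
        fun q hq => by rw [show q - k = q - (k + 1) + 1 by omega, List.getD_cons_succ]
      simpa only [h2 p (h1 p hp), h2 p' (h1 p' hp')] using h

theorem le_expect_coloringP {Z : Finset ℕ} {z j m : ℕ} (hz : 1 ≤ z) (hj : z ≤ 2 ^ j)
    (hZ : Z.card ≤ z) (hm : ∀ p ∈ Z, p < m) :
    ENNReal.ofReal ((z.factorial : ℝ) / (z : ℝ) ^ z) ≤ coloringP.expect orc (m, j)
      (Set.indicator {l : List ℕ | Set.InjOn (fun p => l.getD p 0) Z} 1) := by
  rw [← injWeight_zero, coloringP, replicateP, expect_seq, expect_seq, expect_det orc rfl]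
  have h : ∀ y, (Prog.snd : Prog (.prod .nat (.list .nat)) _).expect orc y
      (Set.indicator {l : List ℕ | Set.InjOn (fun p => l.getD p 0) Z} 1)
      = Set.indicator {l : List ℕ | Set.InjOn (fun p => l.getD p 0) Z} 1 y.2 :=
    fun y => expect_det orc rfl _ _
  simp only [h]
  refine (injWeight_mono (Nat.zero_le _)).trans
    (le_expect_coloring_iter orc hz hj hZ m [] ?_)
  intro p hp
  exact absurd (hm p hp.1) (by have := hp.2; omega)

/-- Independence of the runs: the probability that all colorings lie in `A` is a power. The second
factor accounts for the colorings already drawn. -/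
theorem expect_coloringsP_iter (A : Set (List ℕ)) (y : (Ty.prod .nat .nat).Val) (K : ℕ)
    (ls : List (List ℕ)) :
    (Prog.iter (.pair .fst (consP (.seq .fst coloringP) .snd)) :
      Prog (.prod .nat (.prod (.prod .nat .nat) (.list (.list .nat)))) _).expect orc (K, (y, ls))
      (fun x => Set.indicator {ls : List (List ℕ) | ∀ l ∈ ls, l ∈ A} 1 x.2)
      = (coloringP.expect orc y (A.indicator 1)) ^ K
        * Set.indicator {ls : List (List ℕ) | ∀ l ∈ ls, l ∈ A} 1 ls := by
  induction K generalizing ls with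
  | zero => rw [expect_iter_zero]; simp
  | succ K ih =>
    have hs : ∀ (x : (Ty.prod (.prod .nat .nat) (.list (.list .nat))).Val) φ,
        (Prog.pair .fst (consP (.seq .fst coloringP) .snd) :
          Prog (.prod (.prod .nat .nat) (.list (.list .nat))) _).expect orc x φ
          = coloringP.expect orc x.1 fun l => φ (x.1, l :: x.2) := by
      intro x φ
      rw [expect_pair, expect_det orc rfl, expect_consP, expect_seq, expect_det orc rfl]
      simp only [expect_det orc
        (show (Prog.snd : Prog (.prod (.prod .nat .nat) (.list (.list .nat))) _).isDet = true
          from rfl), val]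
    rw [expect_iter_succ, hs]
    simp only [ih]
    have : ∀ l : List ℕ, Set.indicator {ls : List (List ℕ) | ∀ l ∈ ls, l ∈ A}
        (1 : List (List ℕ) → ℝ≥0∞) (l :: ls)
        = A.indicator 1 l * Set.indicator {ls : List (List ℕ) | ∀ l ∈ ls, l ∈ A} 1 ls := by
      intro l
      have e : l :: ls ∈ {ls : List (List ℕ) | ∀ l ∈ ls, l ∈ A} ↔ l ∈ A ∧ ls ∈
          {ls : List (List ℕ) | ∀ l ∈ ls, l ∈ A} := List.forall_mem_cons
      by_cases h1 : l ∈ A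
      · rw [Set.indicator_of_mem h1, Pi.one_apply, one_mul]
        by_cases h2 : ls ∈ {ls : List (List ℕ) | ∀ l ∈ ls, l ∈ A}
        · rw [Set.indicator_of_mem h2, Set.indicator_of_mem (e.2 ⟨h1, h2⟩)]; rfl
        · rw [Set.indicator_of_notMem h2, Set.indicator_of_notMem fun h => h2 (e.1 h).2]
      · rw [Set.indicator_of_notMem h1, zero_mul, Set.indicator_of_notMem fun h => h1 (e.1 h).1]
    simp only [this]
    have h3 : (fun l => coloringP.expect orc y (A.indicator 1) ^ K *
        (A.indicator 1 l * Set.indicator {ls : List (List ℕ) | ∀ l ∈ ls, l ∈ A} 1 ls))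
      = fun l => A.indicator 1 l * (coloringP.expect orc y (A.indicator 1) ^ K
        * Set.indicator {ls : List (List ℕ) | ∀ l ∈ ls, l ∈ A} 1 ls) := by
      funext l; ring
    rw [h3]
    refine (Run.expect_mul_const _ _ _).trans ?_
    rw [pow_succ, mul_assoc, mul_left_comm]
    rfl

theorem expect_indicator_compl (P : Prog a b) (x : a.Val) (A : Set b.Val) :
    P.expect orc x (A.indicator 1) + P.expect orc x (Aᶜ.indicator 1) = 1 := by
  rw [expect, expect, ← Run.expect_add]
  refine Eq.trans ?_ (Run.expect_const (P.run orc x) 1)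
  congr 1
  funext y
  by_cases h : y ∈ A <;> simp [h]

/-- One of the random colorings is injective on a given set with large probability. -/
theorem le_expect_coloringsP {Z : Finset ℕ} {z j m K : ℕ} (hz : 1 ≤ z) (hj : z ≤ 2 ^ j)
    (hZ : Z.card ≤ z) (hm : ∀ p ∈ Z, p < m) {ε : ℝ} (hε : 0 < ε)
    (hK : Real.log ε⁻¹ ≤ K * ((z.factorial : ℝ) / (z : ℝ) ^ z)) :
    ENNReal.ofReal (1 - ε) ≤ coloringsP.expect orc (K, (m, j))
      (Set.indicator {ls : List (List ℕ) | ∃ l ∈ ls, Set.InjOn (fun p => l.getD p 0) Z} 1) := by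
  set A : Set (List ℕ) := {l : List ℕ | Set.InjOn (fun p => l.getD p 0) Z} with hA
  set g : ℝ := (z.factorial : ℝ) / (z : ℝ) ^ z with hg
  have hz' : (0 : ℝ) < z := by exact_mod_cast hz
  have hg0 : 0 ≤ g := by positivity
  have hg1 : g ≤ 1 := by
    rw [hg, div_le_one (by positivity)]
    exact_mod_cast Nat.factorial_le_pow z
  have h1 : coloringP.expect orc (m, j) (Aᶜ.indicator 1) ≤ ENNReal.ofReal (1 - g) := by
    have h2 := le_expect_coloringP orc hz hj hZ hm
    have h3 := expect_indicator_compl orc coloringP (m, j) A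
    rw [ENNReal.ofReal_sub _ hg0, ENNReal.ofReal_one]
    refine ENNReal.le_sub_of_add_le_left ENNReal.ofReal_ne_top ?_
    rw [← h3]
    exact add_le_add_left h2 _
  have h4 : coloringsP.expect orc (K, (m, j))
      (Set.indicator {ls : List (List ℕ) | ∃ l ∈ ls, l ∈ A}ᶜ 1) ≤ ENNReal.ofReal ε := by
    have h5 : {ls : List (List ℕ) | ∃ l ∈ ls, l ∈ A}ᶜ = {ls | ∀ l ∈ ls, l ∈ Aᶜ} := by
      ext ls; simp
    rw [h5, coloringsP, replicateP, expect_seq, expect_seq, expect_det orc rfl]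
    have h : ∀ y, (Prog.snd : Prog (.prod (.prod .nat .nat) (.list (.list .nat))) _).expect orc y
        (Set.indicator {ls : List (List ℕ) | ∀ l ∈ ls, l ∈ Aᶜ} 1)
        = Set.indicator {ls : List (List ℕ) | ∀ l ∈ ls, l ∈ Aᶜ} 1 y.2 :=
      fun y => expect_det orc rfl _ _
    simp only [h]
    refine (expect_coloringsP_iter orc Aᶜ (m, j) K []).le.trans ?_
    rw [Set.indicator_of_mem (by simp), Pi.one_apply, mul_one]
    refine (pow_le_pow_left' h1 K).trans ?_
    rw [← ENNReal.ofReal_pow (by linarith)]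
    refine ENNReal.ofReal_le_ofReal ?_
    -- All `K` colorings fail with probability at most `(1 - g) ^ K ≤ exp (-K * g)`, and `K` was
    -- chosen such that this is at most `ε`.
    calc (1 - g) ^ K ≤ Real.exp (-g) ^ K :=
          pow_le_pow_left₀ (by linarith) (Real.one_sub_le_exp_neg g) K
      _ = Real.exp (-(K * g)) := by rw [← Real.exp_nat_mul]; ring_nf
      _ ≤ Real.exp (-Real.log ε⁻¹) := Real.exp_le_exp.2 (by linarith)
      _ = ε := by rw [Real.log_inv, neg_neg, Real.exp_log hε]
  have h6 := expect_indicator_compl orc coloringsP (K, (m, j))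
    {ls : List (List ℕ) | ∃ l ∈ ls, l ∈ A}
  rw [ENNReal.ofReal_sub _ hε.le, ENNReal.ofReal_one, tsub_le_iff_right, ← h6]
  exact add_le_add_right h4 _

variable {orc}

theorem ensures_colorP (j : ℕ) : colorP.Ensures orc j (fun c => (c : ℕ) < 2 ^ j) (j * 15 + 10) 0 := by
  have h0 : (Prog.pair .id (.natConst 0) : Prog .nat (.prod .nat .nat)).Ensures orc j
      (fun y => y = (j, 0)) 3 0 := by
    refine ensures_det ?_ _ ?_ ?_ ?_ <;> rfl
  refine (h0.seq (post' := fun c => (c : ℕ) < 2 ^ j) (t' := j * 15 + 1) (q' := 0)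
    fun y hy => ?_).mono (fun _ h => h) (by omega)
  subst hy
  refine Ensures.iter (x := ((j, 0) : (Ty.prod .nat .nat).Val)) (fun i (c : ℕ) => c < 2 ^ i)
    (by simp) fun i hi c hc => ?_
  refine ((ensures_flip _).cond (t' := 12) (q' := 0) (ensures_det (by rfl) _ ?_ ?_ ?_)
    (ensures_det (by rfl) _ ?_ ?_ ?_)).mono (fun _ h => h) (by omega)
  all_goals simp only [val, pow_succ, cost, addP]
  all_goals omega

theorem ensures_replicateP {f : Prog a b} {x : (Ty.prod .nat a).Val} {post : b.Val → Prop} {t : ℕ}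
    (hf : f.Ensures orc x.2 post t 0) : (replicateP f).Ensures orc x
      (fun l => l.length = x.1 ∧ ∀ c ∈ l, post c) (x.1 * (t + 10) + 10) 0 := by
  have h0 : (Prog.pair .fst (.pair .snd .nil) :
      Prog (.prod .nat a) (.prod .nat (.prod a (.list b)))).Ensures orc x
      (fun y => y = (x.1, (x.2, []))) 5 0 := by
    refine ensures_det ?_ _ ?_ ?_ ?_ <;> rfl
  have h2 : ∀ y : (Ty.prod a (.list b)).Val, y.1 = x.2 → ∀ i, (y.2.length = i ∧
      ∀ c ∈ y.2, post c) → (Prog.pair .fst (consP (.seq .fst f) .snd) :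
        Prog (.prod a (.list b)) (.prod a (.list b))).Ensures orc y
        (fun y' => y'.1 = x.2 ∧ y'.2.length = i + 1 ∧ ∀ c ∈ y'.2, post c) (t + 10) 0 := by
    intro y hy i hi
    have e1 : (Prog.fst : Prog (.prod a (.list b)) a).Ensures orc y (fun u => u = x.2) 1 0 :=
      ensures_det (P := .fst) rfl _ hy le_rfl le_rfl
    have e2 : (Prog.snd : Prog (.prod a (.list b)) (.list b)).Ensures orc y (fun u => u = y.2) 1 0 :=
      by refine ensures_det (P := .snd) rfl _ ?_ le_rfl le_rfl; rfl
    have e3 := e1.seq (g := f) (post' := post) (t' := t) (q' := 0) (fun u hu => by rw [hu]; exact hf)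
    have e4 := (e3.pair e2).seq (g := .cons) (t' := 1) (q' := 0)
      (post' := fun l => l.length = i + 1 ∧ ∀ c ∈ l, post c) (fun u hu => by
        refine ensures_det (P := .cons) rfl _ ?_ le_rfl le_rfl
        simp only [val]
        rw [hu.2]
        refine ⟨by simp [hi.1], fun c hc => ?_⟩
        rcases List.mem_cons.1 hc with rfl | hc
        · exact hu.1
        · exact hi.2 c hc)
    exact (e1.pair e4).mono (fun _ h => h) (by omega)
  have h1 := h0.seq (g := .iter (.pair .fst (consP (.seq .fst f) .snd)))
    (post' := fun y => y.1 = x.2 ∧ y.2.length = x.1 ∧ ∀ c ∈ y.2, post c)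
    (t' := x.1 * (t + 10) + 1) (q' := 0) (fun y hy => by
      subst hy
      exact Ensures.iter (x := ((x.1, (x.2, [])) : (Ty.prod .nat (.prod a (.list b))).Val))
        (fun i y => y.1 = x.2 ∧ y.2.length = i ∧ ∀ c ∈ y.2, post c) (by simp)
        fun i hi y hy => h2 y hy.1 i hy.2)
  refine (h1.seq (g := .snd) (post' := fun l : List b.Val => l.length = x.1 ∧ ∀ c ∈ l, post c)
    (t' := 1) (q' := 0) fun y hy => ?_).mono (fun _ h => h) (by omega)
  exact ensures_det (P := .snd) rfl _ hy.2 le_rfl le_rfl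

theorem ensures_coloringsP (x : (Ty.prod .nat (.prod .nat .nat)).Val) : coloringsP.Ensures orc x
    (fun ls => ls.length = x.1 ∧ ∀ l ∈ ls, l.length = x.2.1 ∧ ∀ c ∈ l, (c : ℕ) < 2 ^ (x.2.2 : ℕ))
    (x.1 * (x.2.1 * ((x.2.2 : ℕ) * 15 + 20) + 20) + 10) 0 :=
  (ensures_replicateP (ensures_replicateP (ensures_colorP _))).mono (fun _ h => h) (by
    rw [show ∀ u : ℕ, u * 15 + 10 + 10 = u * 15 + 20 from fun u => rfl, add_assoc (_ * _) 10 10])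

end Prog

/-! ### Specifications from colorings -/

/-- All lists of booleans of a given length. -/
def boolLists : ℕ → List (List Bool)
  | 0 => [[]]
  | k + 1 => (boolLists k).flatMap fun l => [true :: l, false :: l]

theorem mem_boolLists {k : ℕ} {l : List Bool} : l ∈ boolLists k ↔ l.length = k := by
  induction k generalizing l with
  | zero => simp [boolLists]
  | succ k ih =>
    cases l with
    | nil => simp [boolLists]
    | cons b l => cases b <;> simp [boolLists, ih]

theorem length_boolLists (k : ℕ) : (boolLists k).length = 2 ^ k := by
  induction k with
  | zero => rfl
  | succ k ih => simp [boolLists, ih, pow_succ]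

/-- Select the points whose color is in a set given as a list of booleans. -/
def colorMask (χ : List ℕ) (C : List Bool) : List Bool := χ.map fun c => C.getD c false

/-- The specifications of a coloring: all unions of color classes. -/
def colorSpecs (Q : ℕ) (χ : List ℕ) : List (List Bool × ℕ) :=
  (boolLists Q).map fun C => (colorMask χ C, C.count true)

theorem length_colorSpecs (Q : ℕ) (χ : List ℕ) : (colorSpecs Q χ).length = 2 ^ Q := by
  rw [colorSpecs, List.length_map, length_boolLists]

theorem colorSpecs_snd_le {Q : ℕ} {χ : List ℕ} {sp : List Bool × ℕ} (h : sp ∈ colorSpecs Q χ) :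
    sp.2 ≤ Q := by
  obtain ⟨C, hC, rfl⟩ := List.mem_map.1 h
  exact List.count_le_length.trans (mem_boolLists.1 hC).le

theorem exists_mem_colorSpecs {Q : ℕ} {χ : List ℕ} (hχ : ∀ c ∈ χ, c < Q) {C : Finset ℕ}
    (hC : C ⊆ Finset.range Q) : ∃ mask, (mask, C.card) ∈ colorSpecs Q χ ∧
      ∀ p < χ.length, mask.getD p false = true ↔ χ.getD p 0 ∈ C := by
  refine ⟨_, List.mem_map.2 ⟨(List.range Q).map fun c => decide (c ∈ C),
    mem_boolLists.2 (by simp), Prod.ext rfl ?_⟩, ?_⟩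
  · rw [List.count, List.countP_map]
    simp only [Function.comp_def, beq_true]
    rw [List.countP_eq_length_filter, ← List.toFinset_card_of_nodup (List.nodup_range.filter _)]
    congr 1
    ext c
    simp only [List.toFinset_filter, List.toFinset_range, decide_eq_true_eq, Finset.mem_filter]
    exact ⟨fun h => h.2, fun h => ⟨hC h, h⟩⟩
  · intro p hp
    have h : χ[p] < Q := hχ _ (List.getElem_mem hp)
    simp only [colorMask, List.getD_eq_getElem?_getD, List.getElem?_map, List.getElem?_eq_getElem hp,
      Option.map_some, Option.getD_some, List.getElem?_range h, decide_eq_true_eq]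

namespace Prog

variable {a b c : Ty} {orc : ℕ → List ℕ → Bool}

/-- All lists of booleans of a given length. -/
def boolListsP : Prog .nat (.list (.list .bool)) :=
  iterE .id (.seq (.pair .nil .nil) .cons)
    (flatMapE .fst (consP (consP (.boolConst true) .fst) (consP (consP (.boolConst false) .fst) .nil)))

theorem boolListsP_iterate (k : ℕ) : (fun L : List (List Bool) =>
    L.flatMap fun l => [true :: l, false :: l])^[k] [[]] = boolLists k := by
  induction k with
  | zero => rfl
  | succ k ih => rw [Function.iterate_succ_apply', ih]; rfl

theorem boolListsP_val (k : ℕ) : boolListsP.val orc k = boolLists k := by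
  rw [boolListsP, iterE_val]
  simp only [flatMapE_val, consP_val, val]
  exact boolListsP_iterate k

theorem boolListsP_cost_le (k : ℕ) : boolListsP.cost 1 1 orc k ≤ k * (2 ^ k * 70 + 20) + 15 := by
  have h := iterE_time_le (B := 2 ^ k * 60 + 13) orc (cnt := .id) (init := .seq (.pair .nil .nil) .cons)
    (body := (flatMapE .fst (consP (consP (.boolConst true) .fst)
      (consP (consP (.boolConst false) .fst) .nil)) :
      Prog (.prod (.list (.list .bool)) .nat) (.list (.list .bool))))
    (x := k) (fun i L => L = boolLists i) le_rfl le_rfl le_rfl rfl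
    (fun i (hi : i < k) L hL => by
      subst hL
      refine ⟨?_, ?_⟩
      · simp only [flatMapE_val, consP_val, val]
        rfl
      · refine (flatMapE_time_le (tl := 1) (n := 2 ^ k) (B := 20) (k := 2) orc le_rfl ?_ ?_ ?_).trans ?_
        · exact (length_boolLists i).le.trans (Nat.pow_le_pow_right (by norm_num) hi.le)
        · intro y _; simp only [consP_cost, cost]; omega
        · intro y _; simp only [consP_val, val]; simp
        · omega)
  simp only [cost] at h
  rw [boolListsP]
  refine h.trans ?_
  have : k * (2 ^ k * 60 + 13 + 2) ≤ k * (2 ^ k * 70 + 20) := Nat.mul_le_mul_left _ (by omega)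
  rw [show (Prog.val orc (Prog.id : Prog .nat .nat) k : ℕ) = k from rfl]
  omega

/-- The number of entries `true`. -/
def countTrueP (l : Prog a (.list .bool)) : Prog a .nat :=
  foldE (.natConst 0) l (.cond (.seq .snd .fst) (addP .fst (.natConst 1)) .fst)

theorem countTrueP_val (l : Prog a (.list .bool)) (x : a.Val) :
    (countTrueP l).val orc x = (l.val orc x).count true := by
  rw [countTrueP, foldE_val]
  simp only [val, addP_val]
  have : ∀ (l : List Bool) (s : ℕ), l.foldl (fun s y => bif y then s + 1 else s) s
      = s + l.count true := by
    intro l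
    induction l with
    | nil => intro s; simp
    | cons y l ih => intro s; cases y <;> (simp [ih]; try omega)
  exact (this _ 0).trans (zero_add _)

theorem countTrueP_cost_le (l : Prog a (.list .bool)) (x : a.Val) :
    (countTrueP l).cost 1 1 orc x ≤ l.cost 1 1 orc x + (l.val orc x).length * 23 + 8 := by
  have := foldE_time_le (B := 9) orc (init := .natConst 0) (lst := l)
    (body := .cond (.seq .snd .fst) (addP .fst (.natConst 1)) .fst) (x := x) (fun _ _ => True)
    le_rfl le_rfl le_rfl trivial (fun _ _ s _ y _ => ⟨trivial, by
      simp only [addP_cost, cost, val]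
      cases y <;> simp⟩)
  simp only [cost] at this
  rw [countTrueP]
  omega

/-- The specifications of several colorings. -/
def specsP : Prog (.prod (.list (.list .nat)) .nat) (.list specTy) :=
  flatMapE .fst (mapE (.seq .snd (.seq .snd boolListsP))
    (.pair (mapE (.seq .snd .fst) (nthP (.boolConst false) .fst (.seq .snd .fst))) (countTrueP .fst)))

theorem specsP_isDet : specsP.isDet = true := by decide
theorem specsP_isQueryFree : specsP.isQueryFree = true := by decide

theorem specsP_val (x : (Ty.prod (.list (.list .nat)) .nat).Val) :
    specsP.val orc x = x.1.flatMap (colorSpecs x.2) := by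
  rw [specsP, flatMapE_val]
  simp only [mapE_val, val, nthP_val, countTrueP_val, boolListsP_val]
  rfl

theorem specsP_cost_le (x : (Ty.prod (.list (.list .nat)) .nat).Val) {m : ℕ}
    (hm : ∀ χ ∈ x.1, χ.length = m ∧ ∀ c ∈ χ, (c : ℕ) < x.2) :
    specsP.cost 1 1 orc x ≤ x.1.length * ((m + 1) * (2 ^ (x.2 : ℕ) * (200 * ((x.2 : ℕ) + 1)))) + 20 := by
  obtain ⟨(χs : List (List ℕ)), (Q : ℕ)⟩ := x
  simp only at hm ⊢
  have hin : ∀ χ ∈ χs, ∀ C ∈ boolLists Q,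
      (Prog.pair (mapE (.seq .snd .fst) (nthP (.boolConst false) .fst (.seq .snd .fst)))
        (countTrueP .fst) : Prog (.prod (.list .bool) (.prod (.list .nat) (.prod (.list (.list .nat)) .nat)))
          specTy).cost 1 1 orc (C, (χ, (χs, Q))) ≤ m * (Q * 12 + 44) + Q * 23 + 26 := by
    intro χ hχ C hC
    have h1 := countTrueP_cost_le (orc := orc) (.fst : Prog (.prod (.list .bool)
      (.prod (.list .nat) (.prod (.list (.list .nat)) .nat))) _) (C, (χ, (χs, Q)))
    have h2 := mapE_time_le orc (lst := (.seq .snd .fst : Prog (.prod (.list .bool)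
      (.prod (.list .nat) (.prod (.list (.list .nat)) .nat))) _))
      (body := nthP (.boolConst false) .fst (.seq .snd .fst)) (x := (C, (χ, (χs, Q))))
      (tl := 3) (n := m) (B := Q * 12 + 19) le_rfl (hm χ hχ).1.le (fun (c : ℕ) hc => by
        have := nthP_cost_le orc (c, (C, (χ, (χs, Q)))) (.boolConst false)
          (.fst : Prog (.prod .nat (.prod (.list .bool)
            (.prod (.list .nat) (.prod (.list (.list .nat)) .nat)))) _) (.seq .snd .fst)
        have hc' : (c : ℕ) < Q := (hm χ hχ).2 c hc
        simp only [cost, val] at this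
        omega)
    have h3 : C.length = Q := mem_boolLists.1 hC
    simp only [cost, val, h3, add_assoc, Nat.reduceAdd] at h1 h2 ⊢
    omega
  have hmid : ∀ χ ∈ χs, (mapE (.seq .snd (.seq .snd boolListsP))
    (.pair (mapE (.seq .snd .fst) (nthP (.boolConst false) .fst (.seq .snd .fst))) (countTrueP .fst)) :
      Prog (.prod (.list .nat) (.prod (.list (.list .nat)) .nat)) (.list specTy)).cost 1 1 orc (χ, (χs, Q))
      ≤ Q * (2 ^ Q * 70 + 20) + 20 + 2 ^ Q * (m * (Q * 12 + 44) + Q * 23 + 51) + 12 := by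
    intro χ hχ
    refine (mapE_time_le orc (tl := Q * (2 ^ Q * 70 + 20) + 20) (n := 2 ^ Q)
      (B := m * (Q * 12 + 44) + Q * 23 + 26) ?_ ?_ ?_).trans ?_
    · have := boolListsP_cost_le (orc := orc) Q
      simp only [cost, val]
      omega
    · simp only [val, boolListsP_val]; exact (length_boolLists Q).le
    · intro C hC
      simp only [val, boolListsP_val] at hC
      exact hin χ hχ C hC
    · exact le_of_eq (by ring)
  refine (flatMapE_time_le orc (lst := (.fst : Prog (.prod (.list (.list .nat)) .nat) _)) (tl := 1)
    (x := (χs, Q)) (n := χs.length) (k := 2 ^ Q) le_rfl le_rfl hmid ?_).trans ?_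
  · intro χ _
    simp only [mapE_val, val, boolListsP_val, List.length_map, length_boolLists, le_refl]
  · have hQ : Q < 2 ^ Q := Nat.lt_two_pow_self
    have : Q * (2 ^ Q * 70 + 20) + 20 + 2 ^ Q * (m * (Q * 12 + 44) + Q * 23 + 51) + 12 + 2 ^ Q * 10 + 20
        ≤ (m + 1) * (2 ^ Q * (200 * (Q + 1))) := by
      have e1 : Q * (2 ^ Q * 70 + 20) + 20 + 2 ^ Q * (m * (Q * 12 + 44) + Q * 23 + 51) + 12 + 2 ^ Q * 10 + 20
        = 2 ^ Q * (Q * 93 + 61) + 20 * Q + 52 + m * (2 ^ Q * (Q * 12 + 44)) := by ring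
      have e2 : (m + 1) * (2 ^ Q * (200 * (Q + 1))) = 2 ^ Q * (Q * 200 + 200) +
        m * (2 ^ Q * (Q * 200 + 200)) := by ring
      have e3 : m * (2 ^ Q * (Q * 12 + 44)) ≤ m * (2 ^ Q * (Q * 200 + 200)) :=
        Nat.mul_le_mul_left _ (Nat.mul_le_mul_left _ (by omega))
      have e4 : 2 ^ Q * (Q * 200 + 200) = 2 ^ Q * (Q * 93 + 61) + 2 ^ Q * (Q * 107) + 2 ^ Q * 139 := by
        ring
      omega
    have := Nat.mul_le_mul_left χs.length this
    omega

end Prog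

/-! ### Parameters of the randomized algorithm -/

namespace Prog

variable {a b c : Ty} {orc : ℕ → List ℕ → Bool}

/-- The least power `p` of two that is not smaller than the given number `z`, with its exponent. -/
def logP : Prog .nat (.prod .nat .nat) :=
  iterE .id (.pair (.natConst 0) (.natConst 1))
    (.cond (leP .snd (.seq .fst .snd)) .fst
      (.pair (addP (.seq .fst .fst) (.natConst 1)) (addP (.seq .fst .snd) (.seq .fst .snd))))

/-- Doubling takes place only while the power is below `z`, which gives the upper bound `2 * z - 1`;
after `z` rounds the power has reached `z`. A power of two is used so that coin flips give exactly
uniform colors. -/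
theorem logP_spec {z : ℕ} (hz : 1 ≤ z) : ∃ j : ℕ, logP.val orc z = ((j, 2 ^ j) : ℕ × ℕ) ∧ z ≤ 2 ^ j ∧
    2 ^ j ≤ 2 * z - 1 ∧ j ≤ z := by
  rw [logP, iterE_val]
  simp only [val, addP_val, leP_val]
  have : ∀ k : ℕ, ∃ j : ℕ, (fun s : ℕ × ℕ => bif Nat.ble z s.2 then s else (s.1 + 1, s.2 + s.2))^[k]
      (0, 1) = (j, 2 ^ j) ∧ (z ≤ 2 ^ j ∨ k + 1 ≤ 2 ^ j) ∧ 2 ^ j ≤ 2 * z - 1 ∧ j ≤ k := by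
    intro k
    induction k with
    | zero => exact ⟨0, rfl, .inr le_rfl, by simp; omega, le_rfl⟩
    | succ k ih =>
      obtain ⟨j, h1, h2, h3, h4⟩ := ih
      rw [Function.iterate_succ_apply', h1]
      simp only
      by_cases h : z ≤ 2 ^ j
      · rw [Nat.ble_eq_true_of_le h]
        exact ⟨j, rfl, .inl h, h3, by omega⟩
      · have hb : Nat.ble z (2 ^ j) = false := by
          rw [← Bool.not_eq_true, Nat.ble_eq]; exact h
        rw [hb]
        refine ⟨j + 1, by rw [cond_false, pow_succ, mul_two], ?_, ?_, by omega⟩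
        · right; rw [pow_succ]; omega
        · rw [pow_succ]; omega
  obtain ⟨j, h1, h2, h3, h4⟩ := this z
  exact ⟨j, h1, by omega, h3, h4⟩

theorem logP_cost_le (z : ℕ) : logP.cost 1 1 orc z ≤ z * 27 + 11 := by
  have := iterE_time_le (B := 25) orc (cnt := .id) (init := .pair (.natConst 0) (.natConst 1))
    (body := (.cond (leP .snd (.seq .fst .snd)) .fst
      (.pair (addP (.seq .fst .fst) (.natConst 1)) (addP (.seq .fst .snd) (.seq .fst .snd))) :
      Prog (.prod (.prod .nat .nat) .nat) (.prod .nat .nat))) (x := z) (fun _ _ => True)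
    le_rfl le_rfl le_rfl trivial (fun _ _ s _ => ⟨trivial, by
      simp only [addP_cost, leP_cost, cost]
      cases (leP .snd (.seq .fst .snd)).val orc (s, z) <;> simp⟩)
  rw [logP]
  rw [show (Prog.val orc (Prog.id : Prog .nat .nat) z : ℕ) = z from rfl] at this
  simp only [cost] at this
  omega

/-- The factorial. -/
def factP : Prog .nat .nat :=
  .seq (iterE .id (.pair (.natConst 0) (.natConst 1))
    (.pair (addP (.seq .fst .fst) (.natConst 1))
      (mulP (addP (.seq .fst .fst) (.natConst 1)) (.seq .fst .snd)))) .snd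

theorem factP_iterate (k : ℕ) : (fun s : ℕ × ℕ => (s.1 + 1, (s.1 + 1) * s.2))^[k] (0, 1)
    = (k, k.factorial) := by
  induction k with
  | zero => rfl
  | succ k ih => rw [Function.iterate_succ_apply', ih, Nat.factorial_succ]

theorem factP_val (z : ℕ) : factP.val orc z = z.factorial := by
  rw [factP]
  simp only [val, iterE_val, addP_val, mulP_val]
  exact congrArg Prod.snd (factP_iterate z)

theorem factP_cost_le (z : ℕ) : factP.cost 1 1 orc z ≤ z * (z * 9 + 50) + 20 := by
  have := iterE_time_le (B := z * 9 + 40) orc (cnt := .id)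
    (init := .pair (.natConst 0) (.natConst 1))
    (body := (.pair (addP (.seq .fst .fst) (.natConst 1))
      (mulP (addP (.seq .fst .fst) (.natConst 1)) (.seq .fst .snd)) :
      Prog (.prod (.prod .nat .nat) .nat) (.prod .nat .nat))) (x := z) (fun i s => s.1 = i)
    le_rfl le_rfl le_rfl rfl (fun (i : ℕ) (hi : i < z) s hs => ⟨by
      simp only [val, addP_val]; exact congrArg (· + 1) hs, by
      have := mulP_cost_le orc (s, z) (addP (.seq .fst .fst) (.natConst 1) :
        Prog (.prod (.prod .nat .nat) .nat) .nat) (.seq .fst .snd)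
      simp only [addP_cost, cost, val, addP_val, hs] at this ⊢
      omega⟩)
  rw [factP]
  rw [show (Prog.val orc (Prog.id : Prog .nat .nat) z : ℕ) = z from rfl] at this
  simp only [cost] at this ⊢
  have h2 : z * (z * 9 + 40 + 2) ≤ z * (z * 9 + 50) := Nat.mul_le_mul_left _ (by omega)
  omega

/-- Division of natural numbers, rounded up. -/
def ceilDivP : Prog (.prod .nat .nat) .nat :=
  .seq (iterE .fst (.pair (.natConst 0) .fst)
    (.cond (leP (.seq .fst .snd) (.natConst 0)) .fst
      (.pair (addP (.seq .fst .fst) (.natConst 1)) (subP (.seq .fst .snd) (.seq .snd .snd))))) .fst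

/-- As `D` is positive, each subtraction lowers a nonzero remainder, so `M` rounds empty it. Until
then `K * D + r = M` holds exactly; only the last subtraction may be truncated, which is the
rounding up. -/
theorem ceilDivP_spec (x : (Ty.prod .nat .nat).Val) {M D : ℕ} (hM : x.1 = M) (hD : x.2 = D)
    (hD0 : 1 ≤ D) : ∃ K : ℕ, ceilDivP.val orc x = K ∧ M ≤ K * D ∧ K * D < M + D := by
  rw [ceilDivP]
  simp only [val, iterE_val, addP_val, leP_val, subP_val, hM, hD]
  have : ∀ k : ℕ, ∃ K r : ℕ, (fun s : ℕ × ℕ => bif Nat.ble s.2 0 then s else (s.1 + 1, s.2 - D))^[k]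
      (0, M) = (K, r) ∧ M ≤ K * D + r ∧ r ≤ M - k ∧ K * D < M + D ∧ (r ≠ 0 → K * D + r = M) := by
    intro k
    induction k with
    | zero => exact ⟨0, M, rfl, by omega, by omega, by omega, by omega⟩
    | succ k ih =>
      obtain ⟨K, r, h1, h2, h3, h4, h5⟩ := ih
      rw [Function.iterate_succ_apply', h1]
      simp only
      by_cases h : r = 0
      · subst h
        exact ⟨K, 0, rfl, h2, Nat.zero_le _, h4, by omega⟩
      · have hb : Nat.ble r 0 = false := by
          rw [← Bool.not_eq_true, Nat.ble_eq]; omega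
        rw [hb]
        have := h5 h
        have e : (K + 1) * D = K * D + D := Nat.succ_mul K D
        refine ⟨K + 1, r - D, rfl, ?_, ?_, ?_, ?_⟩ <;> omega
  obtain ⟨K, r, h1, h2, h3, h4, -⟩ := this M
  refine ⟨K, congrArg Prod.fst h1, ?_, h4⟩
  omega

theorem ceilDivP_cost_le (x : (Ty.prod .nat .nat).Val) :
    ceilDivP.cost 1 1 orc x ≤ (x.1 : ℕ) * 30 + 20 := by
  have := iterE_time_le (B := 25) orc (cnt := .fst)
    (init := .pair (.natConst 0) .fst)
    (body := (.cond (leP (.seq .fst .snd) (.natConst 0)) .fst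
      (.pair (addP (.seq .fst .fst) (.natConst 1)) (subP (.seq .fst .snd) (.seq .snd .snd))) :
      Prog (.prod (.prod .nat .nat) (.prod .nat .nat)) (.prod .nat .nat))) (x := x)
    (fun _ _ => True)
    le_rfl le_rfl le_rfl trivial (fun i hi s hs => ⟨trivial, by
      simp only [addP_cost, leP_cost, subP_cost, cost]
      cases (leP (.seq .fst .snd) (.natConst 0)).val orc (s, x) <;> simp⟩)
  rw [ceilDivP]
  simp only [cost, val] at this ⊢
  omega

/-- The number of points of an instance. -/
def pointsP : Prog CoverageInstance.inputTy .nat := lengthP (.seq .snd (.seq .snd .fst))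

/-- The number of colorings, of points, and of digits of a color. -/
def setupP (a b : ℕ) : Prog CoverageInstance.inputTy
    (.prod (.prod .nat (.prod .nat .nat)) .nat) :=
  .seq (.pair pointsP (.seq (.seq .snd .fst) (.pair logP
      (.seq (.pair (mulP (.natConst a) (powP .id .id)) (mulP factP (.natConst b))) ceilDivP))))
    (.pair (.pair (.seq .snd .snd) (.pair .fst (.seq .snd (.seq .fst .fst))))
      (.seq .snd (.seq .fst .snd)))

theorem setupP_isDet (a b : ℕ) : (setupP a b).isDet = true := by
  simp only [setupP, isDet, pointsP, lengthP, foldE, mulP, letE, iterE, powP, addP, logP, factP,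
    ceilDivP, leP, subP, Bool.and_true]

theorem setupP_isQueryFree (a b : ℕ) : (setupP a b).isQueryFree = true := by
  simp only [setupP, isQueryFree, pointsP, lengthP, foldE, mulP, letE, iterE, powP, addP, logP, factP,
    ceilDivP, leP, subP, Bool.and_true]

theorem setupP_spec (a b : ℕ) (hb : 1 ≤ b) (x : CoverageInstance.inputTy.Val) {z m : ℕ} (hz : 1 ≤ z)
    (hxz : x.2.1 = z) (hxm : x.2.2.1.length = m) : ∃ K j : ℕ,
      (setupP a b).val orc x = (((K, (m, j)), 2 ^ j) : (ℕ × ℕ × ℕ) × ℕ) ∧ z ≤ 2 ^ j ∧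
      2 ^ j ≤ 2 * z - 1 ∧ j ≤ z ∧
      z ^ z * a ≤ K * (z.factorial * b) ∧ K * (z.factorial * b) < z ^ z * a + z.factorial * b := by
  obtain ⟨j, h1, h2, h3, h4⟩ := logP_spec (orc := orc) hz
  obtain ⟨K, h5, h6, h7⟩ := ceilDivP_spec (orc := orc) ((a * z ^ z, z.factorial * b) : ℕ × ℕ) rfl rfl
    (Nat.mul_pos z.factorial_pos hb)
  refine ⟨K, j, ?_, h2, h3, h4, by rwa [mul_comm (z ^ z)], by rwa [mul_comm (z ^ z)]⟩
  simp only [setupP, val, pointsP, lengthP_val, hxz, hxm, h1, mulP_val, powP_val, factP_val, h5]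

/-- Time for computing the parameters, up to a factor depending on the size of the instance. -/
def setupBound (z : ℕ) : ℕ := 200 * ((z ^ z + 1) * (z + 1) ^ 2)

/-- The time depends on `a` but not on `b`: the products are formed by iterating over the factors
`a` and `z!`, and the division takes `a * z ^ z` rounds, while `b` occurs only as an addend. -/
theorem setupP_cost_le (a b : ℕ) (x : CoverageInstance.inputTy.Val) {z m : ℕ}
    (hxz : x.2.1 = z) (hxm : x.2.2.1.length = m) :
    (setupP a b).cost 1 1 orc x ≤ (m + 1) * ((a + 1) * setupBound z) := by
  have h1 := lengthP_cost_le orc x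
    (.seq .snd (.seq .snd .fst) : Prog CoverageInstance.inputTy (.list .real))
  have h2 := logP_cost_le (orc := orc) z
  have h3 := mulP_cost_le orc z (.natConst a : Prog .nat .nat) (powP .id .id)
  have h4 := powP_cost_le orc z (.id : Prog .nat .nat) .id
  have h5 := mulP_cost_le orc z factP (.natConst b)
  have h6 := factP_cost_le (orc := orc) z
  have h7 := ceilDivP_cost_le (orc := orc) ((a * z ^ z, z.factorial * b) : ℕ × ℕ)
  have h8 : z.factorial ≤ z ^ z := Nat.factorial_le_pow z
  simp only [setupP, pointsP, cost, val, hxz, hxm, mulP_val, powP_val, factP_val]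
    at h1 h2 h3 h4 h5 h6 h7 ⊢
  have h9 : setupBound z = 200 * (z ^ z * (z + 1) ^ 2) + 200 * (z * z) + 400 * z + 200 := by
    rw [setupBound]; ring
  have h10 : z ^ z ≤ z ^ z * (z + 1) ^ 2 := Nat.le_mul_of_pos_right _ (by positivity)
  have e1 : z * (z * 9 + 50) = 9 * (z * z) + 50 * z := by ring
  have e2 : z * (z * 9 + 19) = 9 * (z * z) + 19 * z := by ring
  have h11 : (30 * z ^ z + 9) * a ≤ a * setupBound z := by
    rw [mul_comm a]; exact Nat.mul_le_mul_right _ (by omega)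
  have e3 : (m + 1) * ((a + 1) * setupBound z) = a * setupBound z + setupBound z
    + m * (a * setupBound z) + m * setupBound z := by ring
  have h13 : m * 200 ≤ m * setupBound z := Nat.mul_le_mul_left _ (by omega)
  have e4 : (30 * z ^ z + 9) * a = a * z ^ z * 30 + 9 * a := by ring
  rw [e3]
  omega

/-! ### The randomized algorithm: success probability and resources -/

/-- The randomized algorithm after the colorings have been chosen. -/
def finishP : Prog (.prod (.list (.list .nat)) (.prod (.prod (.prod .nat (.prod .nat .nat)) .nat)
    CoverageInstance.inputTy)) (.list .nat) :=
  .seq (.pair (.seq (.pair .fst (.seq .snd (.seq .fst .snd))) specsP) (.seq .snd .snd)) mainP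

/-- The randomized algorithm. -/
def randP (a b : ℕ) : Prog CoverageInstance.inputTy (.list .nat) :=
  .seq (.pair (setupP a b) .id) (.seq (.pair (.seq (.seq .fst .fst) coloringsP) .id) finishP)

theorem mainP_isDet : mainP.isDet = true := by decide

theorem finishP_isDet : finishP.isDet = true := by
  simp only [finishP, isDet, specsP_isDet, mainP_isDet, Bool.and_true]

section

variable {ℓ n m s : ℕ} (I : CoverageInstance ℓ n m s) (z : ℕ)

theorem finishP_val (χs : List (List ℕ)) (st : (ℕ × ℕ × ℕ) × ℕ) :
    finishP.val I.oracle (χs, (st, I.input z))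
      = (χs.flatMap (colorSpecs st.2)).flatMap fun sp => I.specOutput z sp.1 sp.2 := by
  refine Eq.trans ?_ (mainP_val I z _)
  simp only [finishP, val]
  rw [specsP_val]

theorem finishP_queries_le (χs : List (List ℕ)) (st : (ℕ × ℕ × ℕ) × ℕ) :
    finishP.cost 0 1 I.oracle (χs, (st, I.input z)) ≤ n * (χs.length * 2 ^ st.2 * Γbound ℓ z) := by
  have h := mainP_queries_le I z (χs.flatMap (colorSpecs st.2))
  have h2 := cost_queries_eq_zero I.oracle specsP_isQueryFree (χs, st.2)
  have h3 : (χs.flatMap (colorSpecs st.2)).length = χs.length * 2 ^ st.2 := by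
    simp [List.length_flatMap, length_colorSpecs]
  rw [h3] at h
  simp only [finishP, cost, val, specsP_val, zero_add]
  rw [h2, zero_add]
  exact (zero_add _).le.trans h

theorem finishP_cost_le (χs : List (List ℕ)) (st : (ℕ × ℕ × ℕ) × ℕ) (hst : st.2 ≤ 2 * z)
    (hχ : ∀ χ ∈ χs, χ.length = m ∧ ∀ c ∈ χ, c < st.2) :
    finishP.cost 1 1 I.oracle (χs, (st, I.input z))
      ≤ χs.length * 2 ^ st.2 * (n * (Nat.clog 2 n + 1))
        + (χs.length * 2 ^ st.2 + 1) * ((n + 1) * (m + 1) ^ 2 * (mainBound ℓ z + 400 * z + 250)) := by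
  have h := mainP_cost_le I z (χs.flatMap (colorSpecs st.2)) (fun sp hsp => by
    obtain ⟨χ, -, h⟩ := List.mem_flatMap.1 hsp
    exact (colorSpecs_snd_le h).trans hst)
  have h2 := specsP_cost_le (orc := I.oracle) ((χs, st.2) : (Ty.prod (.list (.list .nat)) .nat).Val) hχ
  have h3 : (χs.flatMap (colorSpecs st.2)).length = χs.length * 2 ^ st.2 := by
    simp [List.length_flatMap, length_colorSpecs]
  rw [h3] at h
  simp only [finishP, cost, val, specsP_val] at h2 ⊢
  have h4 : χs.length * ((m + 1) * (2 ^ st.2 * (200 * (st.2 + 1)))) + 20 + 15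
      ≤ (χs.length * 2 ^ st.2 + 1) * ((n + 1) * (m + 1) ^ 2 * (400 * z + 250)) := by
    have e1 : 1 ≤ (n + 1) * (m + 1) := Nat.mul_pos (Nat.succ_pos _) (Nat.succ_pos _)
    calc χs.length * ((m + 1) * (2 ^ st.2 * (200 * (st.2 + 1)))) + 20 + 15
        = χs.length * 2 ^ st.2 * ((m + 1) * (200 * (st.2 + 1))) + 1 * 35 := by ring
      _ ≤ χs.length * 2 ^ st.2 * ((n + 1) * (m + 1) ^ 2 * (400 * z + 250))
          + 1 * ((n + 1) * (m + 1) ^ 2 * (400 * z + 250)) := by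
          refine add_le_add (Nat.mul_le_mul_left _ ?_) (Nat.mul_le_mul_left _ ?_)
          · refine Nat.mul_le_mul ?_ (by omega)
            nlinarith
          · have : 1 ≤ (n + 1) * (m + 1) ^ 2 := Nat.mul_pos (Nat.succ_pos _) (by positivity)
            nlinarith
      _ = _ := by ring
  have e : (χs.length * 2 ^ st.2 + 1) * ((n + 1) * (m + 1) ^ 2 * (mainBound ℓ z + 400 * z + 250))
    = (χs.length * 2 ^ st.2 + 1) * ((n + 1) * (m + 1) ^ 2 * mainBound ℓ z)
      + (χs.length * 2 ^ st.2 + 1) * ((n + 1) * (m + 1) ^ 2 * (400 * z + 250)) := by ring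
  rw [e]
  omega

theorem expect_randP (a b : ℕ) {st : (ℕ × ℕ × ℕ) × ℕ}
    (hst : (setupP a b).val I.oracle (I.input z) = st) (φ : List ℕ → ENNReal) :
    (randP a b).expect I.oracle (I.input z) φ = coloringsP.expect I.oracle st.1 fun χs =>
      φ ((χs.flatMap (colorSpecs st.2)).flatMap fun sp => I.specOutput z sp.1 sp.2) := by
  rw [randP, expect_seq, expect_pair, expect_det _ (setupP_isDet a b), hst, expect_det _ rfl,
    expect_seq, expect_pair, expect_seq, expect_det _ rfl]
  refine congrArg (coloringsP.expect I.oracle st.1) (funext fun χs => ?_)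
  rw [expect_det _ rfl, expect_det _ finishP_isDet]
  exact congrArg φ (finishP_val I z χs st)

/-- An optimal set of points is fixed before any coin is flipped; it suffices that one of the
colorings is injective on this single set. -/
theorem le_toOuterMeasure_randP (a b : ℕ) (hb : 1 ≤ b) (hz : 1 ≤ z) {ε : ℝ} (hε : 0 < ε)
    (hab : Real.log ε⁻¹ ≤ a / b) :
    ENNReal.ofReal (1 - ε) ≤ (I.exec (randP a b) z).toOuterMeasure
      {r | I.IsKernel z (CoverageInstance.outputSet n r.1)} := by
  obtain ⟨Z, hZ⟩ := I.exists_optimalPoints z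
  obtain ⟨K, j, h1, h2, h3, -, h5, -⟩ := setupP_spec (orc := I.oracle) a b hb (I.input z) (m := m) hz
    (by rw [CoverageInstance.input_eq]) (by rw [CoverageInstance.input_eq]; simp)
  have hm := Run.toOuterMeasure_eq_expect (I.exec (randP a b) z)
    {out | I.IsKernel z (CoverageInstance.outputSet n out)}
  refine le_trans ?_ hm.ge
  refine le_trans ?_ (expect_randP I z a b h1 _).ge
  set Z' : Finset ℕ := Z.image Fin.val with hZ'
  refine (le_expect_coloringsP I.oracle (Z := Z') (m := m) (K := K) hz h2
    (Finset.card_image_le.trans hZ.1) ?_ hε ?_).trans ?_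
  · intro p hp
    obtain ⟨q, -, rfl⟩ := Finset.mem_image.1 hp
    exact q.2
  · refine hab.trans ?_
    rw [mul_div_assoc', div_le_div_iff₀ (by exact_mod_cast hb)
      (by exact_mod_cast Nat.pow_pos (by omega))]
    have : ((z ^ z * a : ℕ) : ℝ) ≤ ((K * (z.factorial * b) : ℕ) : ℝ) := by exact_mod_cast h5
    push_cast at this
    nlinarith
  -- The lengths of the colorings and the range of the colors are certain, not merely likely, so
  -- they are available on the whole support.
  · refine Run.expect_mono _ fun r hr => ?_
    have hens := (ensures_coloringsP (orc := I.oracle) (K, (m, j)) r hr).1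
    obtain ⟨χs, cst⟩ := r
    simp only at hens ⊢
    by_cases hgood : χs ∈ {ls : List (List ℕ) | ∃ l ∈ ls, Set.InjOn (fun p => l.getD p 0) Z'}
    · rw [Set.indicator_of_mem hgood,
        Set.indicator_of_mem]
      · exact le_rfl
      obtain ⟨χ, hχ, hinj⟩ := hgood
      obtain ⟨hlen, hlt⟩ := hens.2 χ hχ
      refine hZ.isKernel_of_injOn (specs := χs.flatMap (colorSpecs (2 ^ j))) ?_
        (fun p => χ.getD p 0) ?_ (Q := 2 ^ j) ?_ ?_
      · intro sp hsp v hv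
        simp only [CoverageInstance.outputSet, Finset.mem_filter, Finset.mem_univ, true_and]
        exact List.mem_flatMap.2 ⟨sp, hsp, hv⟩
      · intro p hp q hq h
        exact Fin.ext (hinj (Finset.mem_coe.2 (Finset.mem_image_of_mem _ hp))
          (Finset.mem_coe.2 (Finset.mem_image_of_mem _ hq)) h)
      · intro p
        have hp : (p : ℕ) < χ.length := by rw [hlen]; exact p.2
        rw [List.getD_eq_getElem _ _ hp]
        exact hlt _ (List.getElem_mem hp)
      · intro C hC
        obtain ⟨mask, h6, h7⟩ := exists_mem_colorSpecs hlt hC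
        exact ⟨mask, List.mem_flatMap.2 ⟨χ, hχ, h6⟩,
          fun p => h7 p (by rw [hlen]; exact p.2)⟩
    · rw [Set.indicator_of_notMem hgood]
      exact zero_le

theorem randP_time_arith {z j a D K P M n m S T : ℕ} (hz : 1 ≤ z) (h4 : j ≤ z) (hD : 1 ≤ D)
    (hP : 2 * P ≤ 4 ^ z) (hP0 : 1 ≤ P) (h6 : K * D < z ^ z * a + D) :
    (m + 1) * ((a + 1) * S) + 2 + (K * (m * (j * 15 + 20) + 20) + 16
      + (M + (K * P + 1) * ((n + 1) * (m + 1) ^ 2 * (T + 400 * z + 250))) + 1) + 1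
      ≤ M + (a + 1) * (4 ^ z * (z ^ z + 1) * ((n + 1) * (m + 1) ^ 2 *
          (T + S + 600 * z + 500))) := by
  have hK : K ≤ z ^ z * a := by
    by_contra hlt
    have h1 : (z ^ z * a + 1) * D ≤ K * D := Nat.mul_le_mul_right _ (by omega)
    have h2 := Nat.le_mul_of_pos_right (z ^ z * a) hD
    rw [Nat.succ_mul] at h1
    omega
  set W := (a + 1) * (4 ^ z * (z ^ z + 1)) with hW
  set X := (n + 1) * (m + 1) ^ 2 with hX
  have hX1 : m + 1 ≤ X := by
    rw [hX, pow_two]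
    exact (Nat.le_mul_of_pos_right _ (Nat.succ_pos m)).trans (Nat.le_mul_of_pos_left _ (Nat.succ_pos n))
  have hz4 : 1 ≤ 4 ^ z := Nat.one_le_pow _ _ (by norm_num)
  have hKW : K * P + 1 ≤ W := by
    calc K * P + 1 ≤ z ^ z * a * 4 ^ z + 4 ^ z :=
          add_le_add (Nat.mul_le_mul hK (by omega)) hz4
      _ ≤ z ^ z * a * 4 ^ z + 4 ^ z + (4 ^ z * z ^ z + a * 4 ^ z) := Nat.le_add_right _ _
      _ = W := by rw [hW]; ring
  have haW : a + 1 ≤ W := Nat.le_mul_of_pos_right _ (by positivity)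
  have hK2 : K ≤ W := (Nat.le_mul_of_pos_right _ hP0).trans ((Nat.le_succ _).trans hKW)
  have g1 : (m + 1) * ((a + 1) * S) ≤ X * (W * S) :=
    Nat.mul_le_mul hX1 (Nat.mul_le_mul_right _ haW)
  have g2 : K * (m * (j * 15 + 20) + 20) ≤ W * (X * (z * 15 + 20)) := by
    refine Nat.mul_le_mul hK2 (le_trans ?_ (Nat.mul_le_mul_right _ hX1))
    have : m * (j * 15 + 20) ≤ m * (z * 15 + 20) := Nat.mul_le_mul_left _ (by omega)
    rw [Nat.succ_mul]
    omega
  have g3 := Nat.mul_le_mul_right (X * (T + 400 * z + 250)) hKW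
  have g4 : 1 ≤ W * X := Nat.mul_pos (by omega) (by omega)
  have e : (a + 1) * (4 ^ z * (z ^ z + 1) * (X * (T + S + 600 * z + 500)))
    = W * (X * (T + 400 * z + 250)) + X * (W * S) + W * (X * (z * 15 + 20))
      + 185 * (W * X * z) + 230 * (W * X) := by rw [hW]; ring
  rw [e]
  omega

/-- The randomized algorithm runs within its resource bounds. -/
theorem randP_outcome (a b : ℕ) (hb : 1 ≤ b) (hz : 1 ≤ z) {r : List ℕ × Cost}
    (hr : r ∈ (I.exec (randP a b) z).support) : ∃ N : ℕ,
      2 * (N * (z.factorial * b)) ≤ 4 ^ z * (z ^ z * a + z.factorial * b) ∧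
      (∀ v ∈ r.1, v < n) ∧ r.1.length ≤ N * Γbound ℓ z ∧ r.2.queries ≤ n * (N * Γbound ℓ z) ∧
      r.2.time ≤ N * (n * (Nat.clog 2 n + 1))
        + (a + 1) * (4 ^ z * (z ^ z + 1) * ((n + 1) * (m + 1) ^ 2 *
          (mainBound ℓ z + setupBound z + 600 * z + 500))) := by
  obtain ⟨K, j, h1, h2, h3, h4, h5, h6⟩ := setupP_spec (orc := I.oracle) a b hb (I.input z) (m := m) hz
    (by rw [CoverageInstance.input_eq]) (by rw [CoverageInstance.input_eq]; simp)
  have hsc := setupP_cost_le (orc := I.oracle) a b (I.input z) (m := m) (z := z)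
    (by rw [CoverageInstance.input_eq]) (by rw [CoverageInstance.input_eq]; simp)
  set st : (ℕ × ℕ × ℕ) × ℕ := ((K, (m, j)), 2 ^ j) with hst
  have e1 : (Prog.pair (setupP a b) .id).Ensures I.oracle (I.input z)
      (fun y => y = (st, I.input z)) ((m + 1) * ((a + 1) * setupBound z) + 2) 0 := by
    refine ensures_det ?_ _ ?_ ?_ ?_
    · simp only [isDet, setupP_isDet, Bool.and_true]
    · simp only [val, h1]
    · simp only [cost]; omega
    · simp only [cost, cost_queries_eq_zero I.oracle (setupP_isQueryFree a b)]; exact le_rfl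
  have hc := ensures_coloringsP (orc := I.oracle) (K, (m, j))
  have e2 : ∀ y, y = (st, I.input z) →
      (Prog.pair (.seq (.seq .fst .fst) coloringsP) .id : Prog (.prod (.prod (.prod .nat (.prod .nat .nat))
        .nat) CoverageInstance.inputTy) _).Ensures I.oracle y (fun u =>
        (u.1.length = K ∧ ∀ l ∈ u.1, l.length = m ∧ ∀ c ∈ l, (c : ℕ) < 2 ^ j) ∧
          u.2 = (st, I.input z)) (K * (m * (j * 15 + 20) + 20) + 16) 0 := by
    intro y hy
    have e3 : (Prog.seq .fst .fst : Prog (.prod (.prod (.prod .nat (.prod .nat .nat))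
        .nat) CoverageInstance.inputTy) _).Ensures I.oracle y (fun u => u = (K, (m, j))) 3 0 := by
      refine ensures_det rfl _ ?_ le_rfl le_rfl
      rw [hy]; rfl
    have e5 : (Prog.seq (.seq .fst .fst) coloringsP : Prog (.prod (.prod (.prod .nat (.prod .nat .nat))
        .nat) CoverageInstance.inputTy) _).Ensures I.oracle y
        (fun ls => ls.length = K ∧ ∀ l ∈ ls, l.length = m ∧ ∀ c ∈ l, (c : ℕ) < 2 ^ j)
        (3 + (K * (m * (j * 15 + 20) + 20) + 10) + 1) (0 + 0) :=
      e3.seq fun u hu => by subst hu; exact hc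
    have e6 : (Prog.id : Prog (.prod (.prod (.prod .nat (.prod .nat .nat))
        .nat) CoverageInstance.inputTy) _).Ensures I.oracle y (fun u => u = (st, I.input z)) 1 0 :=
      ensures_det rfl _ hy le_rfl le_rfl
    exact (e5.pair e6).mono (fun _ h => h) (by omega)
  have hQ : 2 ^ j ≤ 2 * z := by omega
  have e4 : ∀ u : List (List ℕ) × ((ℕ × ℕ × ℕ) × ℕ) × CoverageInstance.inputTy.Val,
      ((u.1.length = K ∧ ∀ l ∈ u.1, l.length = m ∧ ∀ c ∈ l, (c : ℕ) < 2 ^ j) ∧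
          u.2 = (st, I.input z)) → finishP.Ensures I.oracle u
      (fun out => (∀ v ∈ out, (v : ℕ) < n) ∧ out.length ≤ K * 2 ^ 2 ^ j * Γbound ℓ z)
      (K * 2 ^ 2 ^ j * (n * (Nat.clog 2 n + 1)) + (K * 2 ^ 2 ^ j + 1) *
        ((n + 1) * (m + 1) ^ 2 * (mainBound ℓ z + 400 * z + 250)))
      (n * (K * 2 ^ 2 ^ j * Γbound ℓ z)) := by
    rintro ⟨χs, u⟩ ⟨⟨hK, hχ⟩, rfl⟩
    simp only at hK
    have hc' := finishP_cost_le I z χs st hQ hχ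
    have hq' := finishP_queries_le I z χs st
    rw [hK] at hc' hq'
    refine ensures_det finishP_isDet _ ?_ hc' hq'
    rw [finishP_val]
    constructor
    · intro v hv
      obtain ⟨sp, -, hv⟩ := List.mem_flatMap.1 hv
      exact I.specOutput_lt v hv
    · exact length_flatMap_le (k := Γbound ℓ z)
        (by simp [List.length_flatMap, length_colorSpecs, hst, hK])
        fun sp _ => I.specOutput_length_le z sp.1 sp.2
  obtain ⟨⟨h7, h8⟩, h9, h10⟩ := (e1.seq fun y hy => (e2 y hy).seq e4) r hr
  have hD : 1 ≤ z.factorial * b := Nat.mul_pos z.factorial_pos hb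
  -- There are at most `2 * z - 1` colors, which leaves a factor of two below `4 ^ z`. It will pay
  -- for rounding up the number of colorings.
  have hQ4 : 2 * 2 ^ 2 ^ j ≤ 4 ^ z := by
    calc 2 * 2 ^ 2 ^ j = 2 ^ (2 ^ j + 1) := by rw [pow_succ, mul_comm]
      _ ≤ 2 ^ (2 * z) := Nat.pow_le_pow_right (by norm_num) (by omega)
      _ = 4 ^ z := by rw [pow_mul]; norm_num
  refine ⟨K * 2 ^ 2 ^ j, ?_, h7, h8, by omega, h9.trans ?_⟩
  · calc 2 * (K * 2 ^ 2 ^ j * (z.factorial * b)) = 2 * 2 ^ 2 ^ j * (K * (z.factorial * b)) := by ring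
      _ ≤ _ := Nat.mul_le_mul hQ4 h6.le
  · exact randP_time_arith hz h4 hD hQ4 (Nat.one_le_two_pow) h6

end

end Prog

/-! ### A family of sets that separates all small pairs of disjoint sets -/

/-- Does a list of booleans agree with a pattern? The entries of a pattern tell whether a position
is fixed, and to which value. -/
def agrees : List (Bool × Bool) → List Bool → Bool
  | [], _ => true
  | y :: p, l => (!y.1 || (y.2 == l.headD false)) && agrees p l.tail

/-- The number of fixed positions of a pattern. -/
def fixedCount (p : List (Bool × Bool)) : ℕ := p.countP fun y => y.1

/-- Extend a pattern by one position; the first component bounds the number of positions that may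
still be fixed. -/
def extendPattern (x : ℕ × List (Bool × Bool)) : List (ℕ × List (Bool × Bool)) :=
  bif Nat.ble 1 x.1 then
    [(x.1, (false, false) :: x.2), (x.1 - 1, (true, false) :: x.2), (x.1 - 1, (true, true) :: x.2)]
  else [(x.1, (false, false) :: x.2)]

/-- All patterns of length `k` with at most `z` fixed positions. -/
def patterns (z k : ℕ) : List (ℕ × List (Bool × Bool)) :=
  (fun L : List (ℕ × List (Bool × Bool)) => L.flatMap extendPattern)^[k] [(z, [])]

theorem patterns_succ (z k : ℕ) : patterns z (k + 1) = (patterns z k).flatMap extendPattern :=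
  Function.iterate_succ_apply' ..

theorem length_of_mem_patterns {z k : ℕ} {x : ℕ × List (Bool × Bool)} (h : x ∈ patterns z k) :
    x.2.length = k := by
  induction k generalizing x with
  | zero => simp only [patterns, Function.iterate_zero, id, List.mem_singleton] at h; subst h; rfl
  | succ k ih =>
    rw [patterns_succ, List.mem_flatMap] at h
    obtain ⟨y, hy, h⟩ := h
    have := ih hy
    rw [extendPattern] at h
    cases hb : Nat.ble 1 y.1 <;> rw [hb] at h <;> simp at h
    · subst h; simp [this]
    · rcases h with rfl | rfl | rfl <;> simp [this]

/-- A pattern with remaining budget `x.1` starts with weight `2 ^ x.1`. Its weight doubles at each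
of its fixed positions, so every pattern that agrees ends with the same weight `2 ^ z`. -/
theorem budget_of_mem_patterns {z k : ℕ} {x : ℕ × List (Bool × Bool)} (h : x ∈ patterns z k) :
    x.1 + fixedCount x.2 = z := by
  induction k generalizing x with
  | zero => simp only [patterns, Function.iterate_zero, id, List.mem_singleton] at h; subst h; rfl
  | succ k ih =>
    rw [patterns_succ, List.mem_flatMap] at h
    obtain ⟨y, hy, h⟩ := h
    have := ih hy
    rw [fixedCount] at this
    rw [extendPattern] at h
    cases hb : Nat.ble 1 y.1 <;> rw [hb] at h <;> simp at h
    · subst h; simp [fixedCount, this]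
    · rw [Nat.ble_eq] at hb
      rcases h with rfl | rfl | rfl <;> simp [fixedCount] <;> omega

/-- The value at a free position is meaningless and is normalized to `false`, so that every pattern
is generated in one form only. -/
theorem mem_patterns {z : ℕ} (p : List (Bool × Bool)) (hp : ∀ y ∈ p, y.1 = false → y.2 = false)
    (h : fixedCount p ≤ z) : (z - fixedCount p, p) ∈ patterns z p.length := by
  induction p with
  | nil => simp [patterns, fixedCount]
  | cons y p ih =>
    rw [List.length_cons, patterns_succ, List.mem_flatMap]
    obtain ⟨f, v⟩ := y
    have hle : fixedCount p ≤ fixedCount ((f, v) :: p) := by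
      rw [fixedCount, fixedCount, List.countP_cons]; omega
    refine ⟨_, ih (fun y hy => hp y (by simp [hy])) (hle.trans h), ?_⟩
    rw [extendPattern]
    cases f
    · have hv : v = false := hp (false, v) (by simp) rfl
      subst hv
      have : fixedCount ((false, false) :: p) = fixedCount p := by simp [fixedCount]
      rw [this]
      cases Nat.ble 1 (z - fixedCount p) <;> simp
    · have : fixedCount ((true, v) :: p) = fixedCount p + 1 := by simp [fixedCount]
      rw [this] at h ⊢
      have hb : Nat.ble 1 (z - fixedCount p) = true := by rw [Nat.ble_eq]; omega
      rw [hb]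
      cases v <;> simp <;> omega

/-- The number of extensions of a pattern by `k` positions, of which at most `b` are fixed. -/
def extensionCount : ℕ → ℕ → ℕ
  | 0, _ => 1
  | k + 1, 0 => extensionCount k 0
  | k + 1, b + 1 => extensionCount k (b + 1) + 2 * extensionCount k b

theorem extensionCount_le (k b : ℕ) : extensionCount k b ≤ (2 * k + 1) ^ b := by
  induction k generalizing b with
  | zero => simp [extensionCount]
  | succ k ih =>
    cases b with
    | zero => simpa [extensionCount] using ih 0
    | succ b =>
      rw [extensionCount]
      calc _ ≤ (2 * k + 1) ^ (b + 1) + 2 * (2 * k + 1) ^ b :=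
            add_le_add (ih _) (Nat.mul_le_mul_left _ (ih _))
        _ = (2 * k + 1) ^ b * (2 * (k + 1) + 1) := by ring
        _ ≤ (2 * (k + 1) + 1) ^ b * (2 * (k + 1) + 1) :=
            Nat.mul_le_mul_right _ (Nat.pow_le_pow_left (by omega) _)
        _ = _ := (pow_succ ..).symm

theorem length_iterate_extendPattern (k : ℕ) (L : List (ℕ × List (Bool × Bool))) :
    ((fun L : List (ℕ × List (Bool × Bool)) => L.flatMap extendPattern)^[k] L).length
      = (L.map fun x => extensionCount k x.1).sum := by
  induction k generalizing L with
  | zero => simp [extensionCount]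
  | succ k ih =>
    rw [Function.iterate_succ_apply, ih]
    induction L with
    | nil => rfl
    | cons x L ihL =>
      rw [List.flatMap_cons, List.map_append, List.sum_append, ihL, List.map_cons, List.sum_cons]
      congr 1
      obtain ⟨b, p⟩ := x
      cases b with
      | zero =>
        have : Nat.ble 1 0 = false := rfl
        simp [extendPattern, extensionCount, this]
      | succ b =>
        have : Nat.ble 1 (b + 1) = true := by rw [Nat.ble_eq]; omega
        simp [extendPattern, extensionCount, this]
        omega

theorem length_patterns_le (z k : ℕ) : (patterns z k).length ≤ (2 * k + 1) ^ z := by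
  rw [patterns, length_iterate_extendPattern]
  simpa using extensionCount_le k z

/-! ### Conditional expectations -/

/-- The weight of the patterns whose first position is fixed to `b`. -/
def headWeight (b : Bool) (L : List (ℕ × List (Bool × Bool))) : ℕ :=
  L.foldl (fun s x => bif (x.2.headD (false, false)).1 && ((x.2.headD (false, false)).2 == b)
    then s + x.1 else s) 0

/-- Fix the first position: patterns that disagree are dropped, those that agree double their
weight. -/
def advance (b : Bool) (L : List (ℕ × List (Bool × Bool))) : List (ℕ × List (Bool × Bool)) :=
  L.flatMap fun x => bif (x.2.headD (false, false)).1 then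
    (bif (x.2.headD (false, false)).2 == b then [(x.1 + x.1, x.2.tail)] else [])
    else [(x.1, x.2.tail)]

/-- The value at the first position that keeps more weight. -/
def bestBit (L : List (ℕ × List (Bool × Bool))) : Bool :=
  Nat.ble (headWeight false L) (headWeight true L)

/-- The method of conditional expectations for the weight of the patterns that agree. -/
def greedyBits : ℕ → List (ℕ × List (Bool × Bool)) → List Bool
  | 0, _ => []
  | k + 1, L => bestBit L :: greedyBits k (advance (bestBit L) L)

/-- Total weight. -/
def totalWeight (L : List (ℕ × List (Bool × Bool))) : ℕ := (L.map Prod.fst).sum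

theorem headWeight_eq (b : Bool) (L : List (ℕ × List (Bool × Bool))) : headWeight b L
    = (L.map fun x => bif (x.2.headD (false, false)).1 && ((x.2.headD (false, false)).2 == b)
        then x.1 else 0).sum := by
  have : ∀ s, L.foldl (fun s x => bif (x.2.headD (false, false)).1 &&
      ((x.2.headD (false, false)).2 == b) then s + x.1 else s) s
      = s + (L.map fun x => bif (x.2.headD (false, false)).1 &&
        ((x.2.headD (false, false)).2 == b) then x.1 else 0).sum := by
    induction L with
    | nil => intro s; simp
    | cons x L ih =>
      intro s
      rw [List.foldl_cons, ih, List.map_cons, List.sum_cons, ← add_assoc]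
      congr 1
      cases (x.2.headD (false, false)).1 && ((x.2.headD (false, false)).2 == b) <;> rfl
  exact (this 0).trans (zero_add _)

/-- Fixing the first position to `b` doubles the patterns that demand `b` there, loses those that
demand the opposite, and keeps the free ones. Hence the choice made by `bestBit` never decreases the
total weight. -/
theorem totalWeight_advance (b : Bool) (L : List (ℕ × List (Bool × Bool))) :
    totalWeight (advance b L) + headWeight (!b) L = totalWeight L + headWeight b L := by
  rw [headWeight_eq, headWeight_eq]
  induction L with
  | nil => rfl
  | cons x L ih =>
    simp only [totalWeight, advance, List.flatMap_cons, List.map_append, List.sum_append,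
      List.map_cons, List.sum_cons] at ih ⊢
    rcases x.2.headD (false, false) with ⟨f, v⟩
    cases f <;> cases v <;> cases b <;> (simp at ih ⊢; omega)

theorem totalWeight_le_advance (L : List (ℕ × List (Bool × Bool))) :
    totalWeight L ≤ totalWeight (advance (bestBit L) L) := by
  have h := totalWeight_advance (bestBit L) L
  cases hb : bestBit L <;> rw [hb] at h
  · rw [bestBit, ← Bool.not_eq_true, Nat.ble_eq] at hb
    simp only [Bool.not_false] at h
    omega
  · rw [bestBit, Nat.ble_eq] at hb
    simp only [Bool.not_true] at h
    omega

/-- The factor `2 ^ fixedCount` is the inverse of the probability that a uniformly random list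
agrees with the pattern, so the left side is the expectation of the right side over random lists.
The greedy bits do at least as well as the average. -/
theorem totalWeight_le_agrees (k : ℕ) (L : List (ℕ × List (Bool × Bool)))
    (hL : ∀ x ∈ L, x.2.length = k) : totalWeight L ≤
      (L.map fun x => bif agrees x.2 (greedyBits k L) then x.1 * 2 ^ fixedCount x.2 else 0).sum := by
  induction k generalizing L with
  | zero =>
    refine List.sum_le_sum fun x hx => ?_
    rw [List.length_eq_zero_iff.1 (hL x hx)]
    simp [agrees, fixedCount]
  | succ k ih =>
    refine (totalWeight_le_advance L).trans ?_
    refine (ih (advance (bestBit L) L) ?_).trans (le_of_eq ?_)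
    · intro x hx
      obtain ⟨y, hy, hx⟩ := List.mem_flatMap.1 hx
      have := hL y hy
      have h2 : x.2 = y.2.tail := by
        cases h3 : (y.2.headD (false, false)).1 <;> rw [h3] at hx
        · simp at hx; rw [hx]
        · cases h4 : (y.2.headD (false, false)).2 == bestBit L <;> rw [h4] at hx
          · simp at hx
          · simp at hx; rw [hx]
      rw [h2, List.length_tail, this]; rfl
    · rw [greedyBits]
      generalize greedyBits k (advance (bestBit L) L) = bits
      generalize bestBit L = b
      induction L with
      | nil => rfl
      | cons x L ihL =>
        have ihL := ihL (fun y hy => hL y (by simp [hy]))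
        simp only [advance, List.flatMap_cons, List.map_append, List.sum_append,
          List.map_cons, List.sum_cons] at ihL ⊢
        rw [ihL]
        congr 1
        obtain ⟨w, p⟩ := x
        have hp : p.length = k + 1 := hL (w, p) (by simp)
        cases p with
        | nil => simp at hp
        | cons y p =>
          obtain ⟨f, v⟩ := y
          cases f <;> cases v <;> cases b <;> simp [agrees, fixedCount, pow_succ] <;>
            (try (cases agrees p bits <;> simp <;> ring))

/-! ### Greedy cover of the patterns -/

/-- One round of the greedy cover: the sets chosen so far, and the patterns not yet covered. -/
def coverRound (k : ℕ) (s : List (List Bool) × List (ℕ × List (Bool × Bool))) :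
    List (List Bool) × List (ℕ × List (Bool × Bool)) :=
  bif Nat.ble s.2.length 0 then s else
    (greedyBits k (s.2.map fun x => (2 ^ x.1, x.2)) :: s.1,
      s.2.filter fun x => !agrees x.2 (greedyBits k (s.2.map fun x => (2 ^ x.1, x.2))))

/-- A family of sets such that every pattern agrees with one of them. -/
def coverFamily (z k : ℕ) : List (List Bool) :=
  ((coverRound k)^[(patterns z k).length] ([], patterns z k)).1

theorem length_greedyBits (k : ℕ) (L : List (ℕ × List (Bool × Bool))) :
    (greedyBits k L).length = k := by
  induction k generalizing L with
  | zero => rfl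
  | succ k ih => simp [greedyBits, ih]

/-- Each pattern in `U` has initial weight at least one and final weight `2 ^ z` if it agrees, so a
fraction of at least `2 ^ (-z)` of `U` is covered by one list. -/
theorem length_le_agrees {z k : ℕ} {U : List (ℕ × List (Bool × Bool))}
    (hU : ∀ x ∈ U, x ∈ patterns z k) : U.length ≤
      (U.filter fun x => agrees x.2 (greedyBits k (U.map fun x => (2 ^ x.1, x.2)))).length * 2 ^ z := by
  have h := totalWeight_le_agrees k (U.map fun x => (2 ^ x.1, x.2)) (by
    intro y hy
    obtain ⟨x, hx, rfl⟩ := List.mem_map.1 hy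
    exact (length_of_mem_patterns (hU x hx) : x.2.length = k))
  generalize greedyBits k (U.map fun x => (2 ^ x.1, x.2)) = bits at h ⊢
  have h1 : U.length ≤ totalWeight (U.map fun x => (2 ^ x.1, x.2)) := by
    rw [totalWeight, List.map_map]
    clear h hU
    induction U with
    | nil => simp
    | cons x U ih =>
      have : 1 ≤ 2 ^ x.1 := Nat.one_le_two_pow
      simp only [List.map_cons, List.sum_cons, List.length_cons, Function.comp_apply] at ih ⊢
      omega
  refine h1.trans (h.trans (le_of_eq ?_))
  clear h h1
  induction U with
  | nil => simp
  | cons x U ih =>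
    have ih := ih fun y hy => hU y (by simp [hy])
    have hx := budget_of_mem_patterns (hU x (by simp))
    rw [List.map_cons, List.map_cons, List.sum_cons, ih, List.filter_cons]
    cases hb : agrees x.2 bits
    · simp
    · simp only [cond_true, if_true, List.length_cons]
      rw [← pow_add, hx]
      ring

/-- Properties that are preserved by the rounds of the greedy cover. -/
structure CoverState (z k i : ℕ) (s : List (List Bool) × List (ℕ × List (Bool × Bool))) : Prop where
  sub : ∀ x ∈ s.2, x ∈ patterns z k
  covered : ∀ x ∈ patterns z k, x ∈ s.2 ∨ ∃ A ∈ s.1, agrees x.2 A = true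
  decay : (s.2.length : ℝ) ≤ (patterns z k).length * (1 - 1 / 2 ^ z) ^ s.1.length
  progress : s.2.length ≤ (patterns z k).length - i
  card_le : ∀ E, (patterns z k).length ≤ 2 ^ E → s.1.length ≤ 2 ^ z * E + 1

theorem coverState_init (z k : ℕ) : CoverState z k 0 ([], patterns z k) :=
  ⟨fun _ h => h, fun _ h => .inl h, by simp, le_rfl, by simp⟩

/-- A round covers at least the fraction `2 ^ (-z)` of the uncovered patterns, so their number
decays geometrically in the size of the family. -/
theorem CoverState.round {z k i : ℕ} {s : List (List Bool) × List (ℕ × List (Bool × Bool))}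
    (h : CoverState z k i s) : CoverState z k (i + 1) (coverRound k s) := by
  obtain ⟨F, U⟩ := s
  obtain ⟨hsub, hcov, hdec, hpro, hcard⟩ := h
  simp only at hsub hcov hdec hpro hcard
  rw [coverRound]
  cases hU : Nat.ble U.length 0
  · have hU0 : 0 < U.length := by
      by_contra hc
      have : Nat.ble U.length 0 = true := by rw [Nat.ble_eq]; omega
      rw [this] at hU; cases hU
    have hagr := length_le_agrees hsub
    simp only [cond_false]
    generalize greedyBits k (U.map fun x => (2 ^ x.1, x.2)) = bits at hagr
    have hsum : (U.filter fun x => agrees x.2 bits).length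
        + (U.filter fun x => !agrees x.2 bits).length = U.length :=
      (List.length_eq_length_filter_add (l := U) fun x => agrees x.2 bits).symm
    have hz : (0 : ℝ) < 2 ^ z := by positivity
    refine ⟨fun x hx => hsub x (List.mem_filter.1 hx).1, ?_, ?_, ?_, ?_⟩
    · intro x hx
      rcases hcov x hx with h | ⟨A, hA, h⟩
      · cases hb : agrees x.2 bits
        · exact .inl (List.mem_filter.2 ⟨h, by simp [hb]⟩)
        · exact .inr ⟨bits, by simp, hb⟩
      · exact .inr ⟨A, by simp [hA], h⟩
    · simp only [List.length_cons, pow_succ]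
      rw [← mul_assoc]
      have h1 : ((U.filter fun x => !agrees x.2 bits).length : ℝ) ≤ U.length * (1 - 1 / 2 ^ z) := by
        have h2 : (U.length : ℝ) ≤ (U.filter fun x => agrees x.2 bits).length * 2 ^ z := by
          exact_mod_cast hagr
        have h3 : ((U.filter fun x => agrees x.2 bits).length : ℝ)
          + (U.filter fun x => !agrees x.2 bits).length = U.length := by exact_mod_cast hsum
        rw [← div_le_iff₀ hz] at h2
        have h4 : (U.length : ℝ) * (1 - 1 / 2 ^ z) = U.length - U.length / 2 ^ z := by ring
        rw [h4]
        linarith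
      refine h1.trans (mul_le_mul_of_nonneg_right hdec ?_)
      rw [sub_nonneg, div_le_one hz]
      exact one_le_pow₀ (by norm_num)
    · simp only
      -- At least one pattern is newly covered, so as many rounds as there are patterns always
      -- suffice.
      have : 0 < (U.filter fun x => agrees x.2 bits).length := by
        by_contra hc
        have : (U.filter fun x => agrees x.2 bits).length = 0 := by omega
        rw [this] at hagr
        omega
      omega
    · intro E hE
      rw [List.length_cons]
      refine Nat.succ_le_succ ?_
      -- A list is added only while some pattern is uncovered, so at that moment `1 ≤ exp (E -
      -- F.length / 2 ^ z)`. Hence the family had at most `2 ^ z * E` members before the addition.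
      have h1 : (1 : ℝ) ≤ U.length := by exact_mod_cast hU0
      have h2 : ((patterns z k).length : ℝ) ≤ Real.exp E := by
        calc ((patterns z k).length : ℝ) ≤ 2 ^ E := by exact_mod_cast hE
          _ ≤ Real.exp 1 ^ E := pow_le_pow_left₀ (by norm_num)
              (by have := Real.add_one_le_exp (1 : ℝ); linarith) E
          _ = Real.exp E := by rw [← Real.exp_nat_mul, mul_one]
      have h3 : (1 - 1 / 2 ^ z : ℝ) ^ F.length ≤ Real.exp (-(F.length / 2 ^ z)) := by
        calc (1 - 1 / 2 ^ z : ℝ) ^ F.length ≤ Real.exp (-(1 / 2 ^ z)) ^ F.length := by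
              refine pow_le_pow_left₀ ?_ (Real.one_sub_le_exp_neg _) _
              rw [sub_nonneg, div_le_one hz]
              exact one_le_pow₀ (by norm_num)
          _ = _ := by rw [← Real.exp_nat_mul]; ring_nf
      have h4 : (1 : ℝ) ≤ Real.exp (E - F.length / 2 ^ z) := by
        rw [sub_eq_add_neg, Real.exp_add]
        refine (h1.trans hdec).trans (mul_le_mul h2 h3 ?_ (Real.exp_pos _).le)
        refine pow_nonneg ?_ _
        rw [sub_nonneg, div_le_one hz]
        exact one_le_pow₀ (by norm_num)
      rw [Real.one_le_exp_iff, sub_nonneg, div_le_iff₀ hz, mul_comm] at h4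
      exact_mod_cast h4
  · rw [Nat.ble_eq] at hU
    exact ⟨hsub, hcov, hdec, by simp only [cond_true]; omega, hcard⟩

theorem coverState_iterate (z k i : ℕ) :
    CoverState z k i ((coverRound k)^[i] ([], patterns z k)) := by
  induction i with
  | zero => exact coverState_init z k
  | succ i ih => rw [Function.iterate_succ_apply']; exact ih.round

theorem exists_agrees {z k : ℕ} {x : ℕ × List (Bool × Bool)} (hx : x ∈ patterns z k) :
    ∃ A ∈ coverFamily z k, agrees x.2 A = true := by
  have h := coverState_iterate z k (patterns z k).length
  rcases h.covered x hx with h1 | h1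
  · have := h.progress
    rw [Nat.sub_self, Nat.le_zero, List.length_eq_zero_iff] at this
    rw [this] at h1
    cases h1
  · exact h1

theorem length_coverFamily_le {z k E : ℕ} (hE : (patterns z k).length ≤ 2 ^ E) :
    (coverFamily z k).length ≤ 2 ^ z * E + 1 :=
  (coverState_iterate z k (patterns z k).length).card_le E hE

theorem getD_eq_of_agrees {p : List (Bool × Bool)} {l : List Bool} (h : agrees p l = true) {i : ℕ}
    (hi : i < p.length) (hf : p[i].1 = true) : l.getD i false = p[i].2 := by
  induction p generalizing l i with
  | nil => simp at hi
  | cons y p ih =>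
    rw [agrees, Bool.and_eq_true, Bool.or_eq_true] at h
    cases i with
    | zero =>
      simp only [List.getElem_cons_zero] at hf ⊢
      rw [hf] at h
      have : y.2 = l.headD false := by simpa using h.1
      rw [this]
      cases l <;> rfl
    | succ i =>
      simp only [List.getElem_cons_succ] at hf ⊢
      rw [← ih h.2 (by simpa using hi) hf]
      cases l <;> simp

/-- Some set of the family contains the first and avoids the second of two disjoint sets. -/
theorem exists_mem_coverFamily {z k : ℕ} {T Y : Finset ℕ} (hTY : Disjoint T Y)
    (hz : T.card + Y.card ≤ z) (hT : ∀ i ∈ T, i < k) (hY : ∀ i ∈ Y, i < k) :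
    ∃ A ∈ coverFamily z k, (∀ i ∈ T, A.getD i false = true) ∧ ∀ i ∈ Y, A.getD i false = false := by
  classical
  -- The pattern demands `true` on `T`, `false` on `Y`, and leaves all other positions free.
  set p : List (Bool × Bool) := (List.range k).map fun i => (decide (i ∈ T ∪ Y), decide (i ∈ T))
    with hp
  have hlen : p.length = k := by simp [hp]
  have hcount : fixedCount p ≤ z := by
    rw [fixedCount, hp, List.countP_map]
    simp only [Function.comp_def]
    rw [List.countP_eq_length_filter, ← List.toFinset_card_of_nodup (List.nodup_range.filter _)]
    refine le_trans (Finset.card_le_card (t := T ∪ Y) ?_) ((Finset.card_union_le _ _).trans hz)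
    intro i hi
    simp only [List.toFinset_filter, decide_eq_true_eq, Finset.mem_filter] at hi
    exact hi.2
  have hmem := mem_patterns p (by
    intro y hy h
    obtain ⟨i, -, rfl⟩ := List.mem_map.1 hy
    simp only [decide_eq_false_iff_not, Finset.mem_union, not_or] at h ⊢
    exact h.1) hcount
  rw [hlen] at hmem
  obtain ⟨A, hA, hag⟩ := exists_agrees hmem
  refine ⟨A, hA, fun i hi => ?_, fun i hi => ?_⟩
  · rw [getD_eq_of_agrees hag (i := i) (by rw [hlen]; exact hT i hi) (by simp [hp, hi])]
    simp [hp, hi]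
  · rw [getD_eq_of_agrees hag (i := i) (by rw [hlen]; exact hY i hi) (by simp [hp, hi])]
    simp [hp, Finset.disjoint_right.1 hTY hi]

/-! ### Hashing by residues -/

/-- Some small modulus separates the elements of a small set. -/
theorem exists_injOn_mod {S : Finset ℕ} {z L : ℕ} (hS : S.card ≤ z) (hm : ∀ x ∈ S, x < 2 ^ L) :
    ∃ q, 1 ≤ q ∧ q ≤ 2 * (L * (z * z)) + 3 ∧ Set.InjOn (fun x => x % q) S := by
  by_contra hcon
  push Not at hcon
  set N := L * (z * z) with hN
  set D : Finset (ℕ × ℕ) := (S ×ˢ S).filter fun x => x.1 < x.2 with hD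
  have hpos : 0 < ∏ x ∈ D, (x.2 - x.1) := Finset.prod_pos fun x hx => by
    have := (Finset.mem_filter.1 hx).2
    omega
  -- If every modulus caused a collision, each of them would divide some difference of two elements
  -- of `S`, and hence the product of all differences.
  have hdvd : (Finset.Icc 1 (2 * N + 3)).lcm _root_.id ∣ ∏ x ∈ D, (x.2 - x.1) := by
    refine Finset.lcm_dvd fun q hq => ?_
    obtain ⟨hq1, hq2⟩ := Finset.mem_Icc.1 hq
    have hni := hcon q hq1 hq2
    simp only [Set.InjOn, not_forall] at hni
    obtain ⟨x, hx, y, hy, hxy, hne⟩ := hni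
    have key : ∀ x ∈ S, ∀ y ∈ S, x % q = y % q → x < y → q ∣ ∏ x ∈ D, (x.2 - x.1) := by
      intro x hx y hy hxy hlt
      have h1 : (x, y) ∈ D := Finset.mem_filter.2 ⟨Finset.mem_product.2 ⟨hx, hy⟩, hlt⟩
      exact ((Nat.modEq_iff_dvd' hlt.le).1 hxy).trans
        (Finset.dvd_prod_of_mem (fun x : ℕ × ℕ => x.2 - x.1) h1)
    rcases lt_or_gt_of_ne hne with h | h
    · exact key x hx y hy hxy h
    · exact key y hy x hx hxy.symm h
  have hle : ∏ x ∈ D, (x.2 - x.1) ≤ 2 ^ N := by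
    calc ∏ x ∈ D, (x.2 - x.1) ≤ ∏ _x ∈ D, 2 ^ L := Finset.prod_le_prod' fun x hx => by
          have := hm x.2 (Finset.mem_product.1 (Finset.mem_filter.1 hx).1).2
          omega
      _ = 2 ^ (L * D.card) := by rw [Finset.prod_const, ← pow_mul]
      _ ≤ 2 ^ N := by
          refine Nat.pow_le_pow_right (by norm_num) (Nat.mul_le_mul_left _ ?_)
          refine (Finset.card_filter_le _ _).trans ?_
          rw [Finset.card_product]
          exact Nat.mul_le_mul hS hS
  -- The lower bound for the least common multiple of `1, …, 2 * N + 3` contradicts that it divides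
  -- a positive product of at most `2 ^ N`, since `(2 * N + 4) * 2 ^ N < 2 ^ (2 * N + 3)`.
  have h1 : 2 ^ (2 * N + 3) ≤ (2 * N + 3 + 1) * (Finset.Icc 1 (2 * N + 3)).lcm _root_.id :=
    Chebyshev.two_pow_le_mul_lcmUpto _
  have h2 := (Nat.le_of_dvd hpos hdvd).trans hle
  have h3 : N + 1 ≤ 2 ^ N := Nat.lt_two_pow_self
  have h4 : (2 * N + 3 + 1) * (Finset.Icc 1 (2 * N + 3)).lcm _root_.id ≤ (2 * N + 4) * 2 ^ N :=
    Nat.mul_le_mul_left _ h2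
  have h5 : 2 ^ (2 * N + 3) = 8 * 2 ^ N * 2 ^ N := by ring
  have h6 : (2 * N + 4) * 2 ^ N < 8 * 2 ^ N * 2 ^ N :=
    Nat.mul_lt_mul_of_pos_right (by omega) (by positivity)
  omega

/-- The number of moduli. -/
def moduli (L z : ℕ) : ℕ := 2 * (L * (z * z)) + 3

/-- Select the points whose residue belongs to a given set. -/
def residueMask (m q : ℕ) (A : List Bool) : List Bool :=
  (List.range m).map fun x => A.getD (x % q) false

/-- Specifications that separate small sets of points. -/
def hashSpecs (m z L : ℕ) : List (List Bool × ℕ) :=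
  (List.range (moduli L z)).flatMap fun i => (coverFamily z (moduli L z)).flatMap fun A =>
    (List.range z).map fun t => (residueMask m (i + 1) A, t + 1)

theorem hashSpecs_snd_le {m z L : ℕ} {sp : List Bool × ℕ} (h : sp ∈ hashSpecs m z L) :
    sp.2 ≤ z := by
  obtain ⟨i, -, h⟩ := List.mem_flatMap.1 h
  obtain ⟨A, -, h⟩ := List.mem_flatMap.1 h
  obtain ⟨t, ht, rfl⟩ := List.mem_map.1 h
  exact List.mem_range.1 ht

theorem length_hashSpecs (m z L : ℕ) : (hashSpecs m z L).length
    = moduli L z * ((coverFamily z (moduli L z)).length * z) := by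
  simp [hashSpecs, List.length_flatMap]

/-- The crude estimate `2 * k + 1 ≤ 2 ^ (2 * k)` for the number `k` of moduli is good enough: the
family is then linear in `k`, and so is the number of moduli used with it, which accounts for the
square of the logarithm. -/
theorem length_coverFamily_moduli_le (z L : ℕ) :
    (coverFamily z (moduli L z)).length ≤ 2 ^ z * (2 * moduli L z * z) + 1 := by
  refine length_coverFamily_le ((length_patterns_le _ _).trans ?_)
  rw [pow_mul]
  exact Nat.pow_le_pow_left (Nat.lt_two_pow_self) z

/-- A modulus that is injective on `T ∪ Y` maps `T` and `Y` to disjoint sets of residues, and these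
are separated by a member of the family. -/
theorem exists_mem_hashSpecs {m z L : ℕ} (hL : m ≤ 2 ^ L) {T Y : Finset (Fin m)}
    (hTY : Disjoint T Y) (hz : T.card + Y.card ≤ z) {t : ℕ} (ht1 : 1 ≤ t) (htz : t ≤ z) :
    ∃ mask, (mask, t) ∈ hashSpecs m z L ∧ (∀ p ∈ T, mask.getD p false = true) ∧
      ∀ p ∈ Y, mask.getD p false = false := by
  obtain ⟨q, hq1, hq2, hinj⟩ := exists_injOn_mod (S := (T ∪ Y).image Fin.val) (z := z) (L := L)
    (Finset.card_image_le.trans ((Finset.card_union_le _ _).trans hz)) (by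
      intro x hx
      obtain ⟨p, -, rfl⟩ := Finset.mem_image.1 hx
      exact p.2.trans_le hL)
  have hqm : q ≤ moduli L z := hq2
  obtain ⟨A, hA, hAT, hAY⟩ := exists_mem_coverFamily (z := z) (k := moduli L z)
    (T := T.image fun p : Fin m => (p : ℕ) % q) (Y := Y.image fun p : Fin m => (p : ℕ) % q) (by
      rw [Finset.disjoint_left]
      intro c hc hc'
      obtain ⟨p, hp, rfl⟩ := Finset.mem_image.1 hc
      obtain ⟨p', hp', h⟩ := Finset.mem_image.1 hc'
      have := Fin.ext (hinj
        (Finset.mem_coe.2 (Finset.mem_image_of_mem _ (Finset.mem_union_right _ hp')))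
        (Finset.mem_coe.2 (Finset.mem_image_of_mem _ (Finset.mem_union_left _ hp))) h)
      subst this
      exact Finset.disjoint_left.1 hTY hp hp')
    ((add_le_add Finset.card_image_le Finset.card_image_le).trans hz)
    (by
      intro i hi
      obtain ⟨p, -, rfl⟩ := Finset.mem_image.1 hi
      exact (Nat.mod_lt _ hq1).trans_le hqm)
    (by
      intro i hi
      obtain ⟨p, -, rfl⟩ := Finset.mem_image.1 hi
      exact (Nat.mod_lt _ hq1).trans_le hqm)
  have hget : ∀ p : Fin m, (residueMask m q A).getD p false = A.getD ((p : ℕ) % q) false := by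
    intro p
    rw [List.getD_eq_getElem _ _ (by simp [residueMask])]
    simp [residueMask]
  refine ⟨residueMask m q A, ?_, fun p hp => ?_, fun p hp => ?_⟩
  · rw [hashSpecs, List.mem_flatMap]
    -- The ranges start at zero, whereas index `i` stands for the modulus `i + 1` and index `t` for
    -- the number `t + 1` of points.
    refine ⟨q - 1, List.mem_range.2 (by omega), List.mem_flatMap.2 ⟨A, hA, List.mem_map.2
      ⟨t - 1, List.mem_range.2 (by omega), ?_⟩⟩⟩
    rw [Nat.sub_add_cancel hq1, Nat.sub_add_cancel ht1]
  · rw [hget]; exact hAT _ (Finset.mem_image_of_mem _ hp)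
  · rw [hget]; exact hAY _ (Finset.mem_image_of_mem _ hp)

/-! ### Programs for the separating family -/

namespace Prog

variable {e a b c : Ty} (orc : ℕ → List ℕ → Bool)

/-- The first entry of a list, or a default value. -/
def firstP (dflt : Prog .unit a) (l : Prog e (.list a)) : Prog e a :=
  .seq (.pair .unit l) (.uncons dflt (.seq .snd .fst))

@[simp] theorem firstP_val (dflt : Prog .unit a) (l : Prog e (.list a)) (x : e.Val) :
    (firstP dflt l).val orc x = (l.val orc x).headD (dflt.val orc ()) := by
  simp only [firstP, val]
  cases l.val orc x <;> rfl

theorem firstP_cost_le (dflt : Prog .unit a) (l : Prog e (.list a)) (x : e.Val) :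
    (firstP dflt l).cost 1 1 orc x ≤ l.cost 1 1 orc x + dflt.cost 1 1 orc () + 7 := by
  simp only [firstP, cost, val]
  cases l.val orc x <;> simp only <;> omega

/-- Equality of booleans. -/
def eqbP (f g : Prog e .bool) : Prog e .bool := .cond f g (notP g)

@[simp] theorem eqbP_val (f g : Prog e .bool) (x : e.Val) :
    (eqbP f g).val orc x = (f.val orc x == g.val orc x) := by
  simp only [eqbP, val, notP_val]
  cases f.val orc x <;> cases g.val orc x <;> rfl

theorem cond_cost_le {t : Prog e .bool} {f g : Prog e a} {x : e.Val} {B : ℕ}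
    (hf : f.cost 1 1 orc x ≤ B) (hg : g.cost 1 1 orc x ≤ B) :
    (Prog.cond t f g).cost 1 1 orc x ≤ t.cost 1 1 orc x + B + 1 := by
  simp only [cost]
  cases t.val orc x <;> simp only [cond_true, cond_false] <;> omega

theorem eqbP_cost_le (f g : Prog e .bool) (x : e.Val) :
    (eqbP f g).cost 1 1 orc x ≤ f.cost 1 1 orc x + g.cost 1 1 orc x + 3 := by
  have := cond_cost_le orc (t := f) (f := g) (g := notP g) (x := x)
    (B := g.cost 1 1 orc x + 2) (by omega) (by rw [notP_cost])
  rw [eqbP]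
  omega

/-- Patterns. -/
abbrev patternTy : Ty := .list (.prod .bool .bool)

/-- Patterns with a weight. -/
abbrev weightedTy : Ty := .prod .nat patternTy

/-- Does a list of booleans agree with a pattern? -/
def agreesP : Prog (.prod patternTy (.list .bool)) .bool :=
  .seq (foldE (.pair (.boolConst true) .snd) .fst
    (.pair (andP (.seq .fst .fst) (.cond (.seq .snd (.seq .fst .fst))
        (eqbP (.seq .snd (.seq .fst .snd)) (firstP (.boolConst false) (.seq .fst .snd)))
        (.boolConst true)))
      (.seq (.seq .fst .snd) tailP))) .fst

theorem foldl_agrees (p : List (Bool × Bool)) (s : Bool × List Bool) :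
    (p.foldl (fun s y => (s.1 && bif y.1 then (y.2 == s.2.headD false) else true, s.2.tail)) s).1
      = (s.1 && agrees p s.2) := by
  induction p generalizing s with
  | nil => simp [agrees]
  | cons y p ih =>
    rw [List.foldl_cons, ih, agrees]
    cases s.1 <;> cases y.1 <;> simp

@[simp] theorem agreesP_val (x : (Ty.prod patternTy (.list .bool)).Val) :
    agreesP.val orc x = agrees x.1 x.2 := by
  simp only [agreesP, foldE_val, val, andP_val, eqbP_val, firstP_val, tailP_val]
  exact (foldl_agrees x.1 (true, x.2)).trans (Bool.true_and _)

theorem agreesP_cost_le (x : (Ty.prod patternTy (.list .bool)).Val) :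
    agreesP.cost 1 1 orc x ≤ x.1.length * 80 + 15 := by
  have := foldE_time_le (B := 60) orc (init := .pair (.boolConst true) .snd)
    (lst := (.fst : Prog (.prod patternTy (.list .bool)) patternTy))
    (body := (.pair (andP (.seq .fst .fst) (.cond (.seq .snd (.seq .fst .fst))
        (eqbP (.seq .snd (.seq .fst .snd)) (firstP (.boolConst false) (.seq .fst .snd)))
        (.boolConst true)))
      (.seq (.seq .fst .snd) tailP))) (x := x) (fun _ _ => True) le_rfl le_rfl
    le_rfl trivial (fun i _ s _ y _ => ⟨trivial, by
      have h1 := andP_cost_le orc (s, (y, x)) (.seq .fst .fst :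
        Prog (.prod (.prod .bool (.list .bool)) (.prod (.prod .bool .bool)
          (.prod patternTy (.list .bool)))) .bool) (.cond (.seq .snd (.seq .fst .fst))
        (eqbP (.seq .snd (.seq .fst .snd)) (firstP (.boolConst false) (.seq .fst .snd)))
        (.boolConst true))
      have h2 := eqbP_cost_le orc (.seq .snd (.seq .fst .snd) :
        Prog (.prod (.prod .bool (.list .bool)) (.prod (.prod .bool .bool)
          (.prod patternTy (.list .bool)))) .bool) (firstP (.boolConst false) (.seq .fst .snd))
          (s, (y, x))
      have h3 := firstP_cost_le orc (.boolConst false) (.seq .fst .snd :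
        Prog (.prod (.prod .bool (.list .bool)) (.prod (.prod .bool .bool)
          (.prod patternTy (.list .bool)))) _) (s, (y, x))
      have h4 := cond_cost_le orc (t := (.seq .snd (.seq .fst .fst) :
        Prog (.prod (.prod .bool (.list .bool)) (.prod (.prod .bool .bool)
          (.prod patternTy (.list .bool)))) .bool)) (f :=
        (eqbP (.seq .snd (.seq .fst .snd)) (firstP (.boolConst false) (.seq .fst .snd))))
        (g := .boolConst true) (x := (s, (y, x))) (B := 30)
        (by simp only [cost] at h2 h3 ⊢; omega) (by simp only [cost]; omega)
      have h5 := tailP_cost_le orc (a := .bool) s.2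
      simp only [cost, val] at h1 h4 h5 ⊢
      omega⟩)
  simp only [agreesP, cost, val] at this ⊢
  omega

/-- Extensions of a pattern by one position. -/
def extendPatternP : Prog weightedTy (.list weightedTy) :=
  .cond (leP (.natConst 1) .fst)
    (consP (.pair .fst (consP (.pair (.boolConst false) (.boolConst false)) .snd))
      (consP (.pair (subP .fst (.natConst 1)) (consP (.pair (.boolConst true) (.boolConst false)) .snd))
        (consP (.pair (subP .fst (.natConst 1)) (consP (.pair (.boolConst true) (.boolConst true)) .snd))
          .nil)))
    (consP (.pair .fst (consP (.pair (.boolConst false) (.boolConst false)) .snd)) .nil)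

@[simp] theorem extendPatternP_val (x : weightedTy.Val) :
    extendPatternP.val orc x = extendPattern x := by
  simp only [extendPatternP, val, leP_val, consP_val, subP_val]
  rfl

theorem extendPatternP_cost_le (x : weightedTy.Val) : extendPatternP.cost 1 1 orc x ≤ 60 := by
  refine (cond_cost_le orc (B := 54) ?_ ?_).trans ?_
  all_goals simp only [cost, leP_cost, consP_cost, subP_cost]; omega

/-- All patterns of a given length with a bound for the number of fixed positions. -/
def patternsP : Prog (.prod .nat .nat) (.list weightedTy) :=
  iterE .fst (consP (.pair .snd .nil) .nil) (flatMapE .fst (.seq .fst extendPatternP))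

@[simp] theorem patternsP_val (x : (Ty.prod .nat .nat).Val) :
    patternsP.val orc x = patterns x.2 x.1 := by
  simp only [patternsP, iterE_val, flatMapE_val, val, consP_val, extendPatternP_val]
  rfl

theorem patternsP_cost_le (x : (Ty.prod .nat .nat).Val) {k z : ℕ} (hk : x.1 = k) (hz : x.2 = z) :
    patternsP.cost 1 1 orc x ≤ k * ((2 * k + 1) ^ z * 120 + 15) + 20 := by
  have hP : ∀ i < k, (patterns z i).length ≤ (2 * k + 1) ^ z := fun i hi =>
    (length_patterns_le z i).trans (Nat.pow_le_pow_left (by omega) z)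
  generalize (2 * k + 1) ^ z = P at hP ⊢
  have hbody : ∀ y : (Ty.prod (.list weightedTy) (.prod .nat .nat)).Val, y.1.length ≤ P →
      (flatMapE .fst (.seq .fst extendPatternP) :
        Prog (.prod (.list weightedTy) (.prod .nat .nat)) (.list weightedTy)).cost 1 1 orc y
        ≤ 1 + P * (62 + 3 * 10 + 20) + 12 := by
    intro y hy
    refine flatMapE_time_le orc (tl := 1) (B := 62) (k := 3) le_rfl hy ?_ ?_
    · intro u _
      have := extendPatternP_cost_le orc u
      simp only [cost, val]; omega
    · intro u _
      simp only [extendPatternP_val, val, extendPattern]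
      cases Nat.ble 1 u.1 <;> simp
  have h := iterE_time_le (B := P * 112 + 13) (n := k) orc
    (cnt := .fst)
    (init := consP (.pair .snd .nil) .nil)
    (body := (flatMapE .fst (.seq .fst extendPatternP) :
      Prog (.prod (.list weightedTy) (.prod .nat .nat)) (.list weightedTy)))
    (x := x) (fun i L => L = patterns z i) le_rfl le_rfl hk.le (by
      simp only [val, hz, patterns, consP_val]; rfl)
    (fun (i : ℕ) hi L hL => by
      subst hL
      refine ⟨?_, ?_⟩
      · simp only [flatMapE_val, extendPatternP_val, val]
        exact (patterns_succ z i).symm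
      · refine (hbody _ (hP i (hi.trans_eq hk))).trans ?_
        omega)
  simp only [patternsP, cost, consP_cost] at h ⊢
  refine h.trans ?_
  have : k * (P * 112 + 13 + 2) ≤ k * (P * 120 + 15) := Nat.mul_le_mul_left _ (by omega)
  omega

/-- The weight of the patterns whose first position is fixed to `b`. -/
def headWeightP (b : Bool) : Prog (.list weightedTy) .nat :=
  foldE (.natConst 0) .id
    (.cond (andP (.seq (firstP (.pair (.boolConst false) (.boolConst false))
          (.seq .snd (.seq .fst .snd))) .fst)
        (eqbP (.seq (firstP (.pair (.boolConst false) (.boolConst false))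
          (.seq .snd (.seq .fst .snd))) .snd) (.boolConst b)))
      (addP .fst (.seq .snd (.seq .fst .fst))) .fst)

@[simp] theorem headWeightP_val (b : Bool) (L : List (ℕ × List (Bool × Bool))) :
    (headWeightP b).val orc L = headWeight b L := by
  simp only [headWeightP, foldE_val, val, andP_val, eqbP_val, firstP_val, addP_val]
  rfl

theorem headWeightP_cost_le (b : Bool) (L : List (ℕ × List (Bool × Bool))) :
    (headWeightP b).cost 1 1 orc L ≤ L.length * 80 + 10 := by
  have := foldE_time_le (B := 60) orc (init := .natConst 0)
    (lst := (.id : Prog (.list weightedTy) (.list weightedTy)))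
    (body := (.cond (andP (.seq (firstP (.pair (.boolConst false) (.boolConst false))
          (.seq .snd (.seq .fst .snd))) .fst)
        (eqbP (.seq (firstP (.pair (.boolConst false) (.boolConst false))
          (.seq .snd (.seq .fst .snd))) .snd) (.boolConst b)))
      (addP .fst (.seq .snd (.seq .fst .fst))) .fst)) (x := L) (fun _ _ => True) le_rfl le_rfl
    le_rfl trivial (fun i _ s _ y _ => ⟨trivial, by
      have h1 := andP_cost_le orc (s, (y, L)) (.seq (firstP (.pair (.boolConst false) (.boolConst false))
          (.seq .snd (.seq .fst .snd))) .fst :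
        Prog (.prod .nat (.prod weightedTy (.list weightedTy))) .bool)
        (eqbP (.seq (firstP (.pair (.boolConst false) (.boolConst false))
          (.seq .snd (.seq .fst .snd))) .snd) (.boolConst b))
      have h2 := eqbP_cost_le orc (.seq (firstP (.pair (.boolConst false) (.boolConst false))
          (.seq .snd (.seq .fst .snd))) .snd :
        Prog (.prod .nat (.prod weightedTy (.list weightedTy))) .bool) (.boolConst b) (s, (y, L))
      have h3 := firstP_cost_le orc (.pair (.boolConst false) (.boolConst false))
        (.seq .snd (.seq .fst .snd) :
        Prog (.prod .nat (.prod weightedTy (.list weightedTy))) _) (s, (y, L))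
      refine (cond_cost_le orc (B := 9) ?_ ?_).trans ?_
      · simp only [addP_cost, cost]; omega
      · simp only [cost]; omega
      · simp only [cost] at h1 h2 h3 ⊢
        omega⟩)
  simp only [headWeightP, cost, val] at this ⊢
  omega

/-- Fix the first position of all patterns. -/
def advanceP : Prog (.prod .bool (.list weightedTy)) (.list weightedTy) :=
  flatMapE .snd
    (.cond (.seq (firstP (.pair (.boolConst false) (.boolConst false)) (.seq .fst .snd)) .fst)
      (.cond (eqbP (.seq (firstP (.pair (.boolConst false) (.boolConst false)) (.seq .fst .snd)) .snd)
          (.seq .snd .fst))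
        (consP (.pair (addP (.seq .fst .fst) (.seq .fst .fst)) (.seq (.seq .fst .snd) tailP)) .nil) .nil)
      (consP (.pair (.seq .fst .fst) (.seq (.seq .fst .snd) tailP)) .nil))

theorem advanceP_val_aux (y : weightedTy.Val) (b : Bool) :
    (bif (y.2.headD (false, false)).1 then
    (bif (y.2.headD (false, false)).2 == b then [(y.1 + y.1, y.2.tail)] else [])
    else [(y.1, y.2.tail)] : List (ℕ × List (Bool × Bool))).length ≤ 1 := by
  cases (y.2.headD (false, false)).1
  · simp
  · cases (y.2.headD (false, false)).2 == b <;> simp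

@[simp] theorem advanceP_val (x : (Ty.prod .bool (.list weightedTy)).Val) :
    advanceP.val orc x = advance x.1 x.2 := by
  simp only [advanceP, flatMapE_val, val, eqbP_val, firstP_val, addP_val, tailP_val, consP_val]
  rfl

/-- Patterns are dropped but never multiplied, so the cost per position stays linear in the initial
number of patterns. -/
theorem length_advance_le (b : Bool) (L : List (ℕ × List (Bool × Bool))) :
    (advance b L).length ≤ L.length := by
  refine (length_flatMap_le (k := 1) le_rfl fun y _ => advanceP_val_aux y b).trans ?_
  omega

theorem advanceP_cost_le (x : (Ty.prod .bool (.list weightedTy)).Val) :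
    advanceP.cost 1 1 orc x ≤ x.2.length * 130 + 15 := by
  refine (flatMapE_time_le orc (tl := 1) (B := 90) (k := 1) (n := x.2.length) le_rfl le_rfl ?_ ?_).trans ?_
  · intro y _
    have h5 := tailP_cost_le orc (a := .prod .bool .bool) y.2
    have h3 := firstP_cost_le orc (.pair (.boolConst false) (.boolConst false))
        (.seq .fst .snd : Prog (.prod weightedTy (.prod .bool (.list weightedTy))) _) (y, x)
    have h2 := eqbP_cost_le orc (.seq (firstP (.pair (.boolConst false) (.boolConst false))
      (.seq .fst .snd)) .snd : Prog (.prod weightedTy (.prod .bool (.list weightedTy))) _)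
      (.seq .snd .fst) (y, x)
    refine (cond_cost_le orc (B := 70) ?_ ?_).trans ?_
    · refine (cond_cost_le orc (B := 35) ?_ ?_).trans ?_
      · simp only [consP_cost, addP_cost, cost, val] at h5 ⊢; omega
      · simp only [cost]; omega
      · simp only [cost] at h2 h3 ⊢; omega
    · simp only [consP_cost, cost, val] at h5 ⊢; omega
    · simp only [cost] at h3 ⊢; omega
  · intro y _
    simp only [val, eqbP_val, firstP_val, addP_val, tailP_val, consP_val]
    exact advanceP_val_aux y x.1
  · omega

end Prog

/-! ### The program for the deterministic specifications -/

namespace Prog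

variable {e a b c : Ty} (orc : ℕ → List ℕ → Bool)

/-- The value at the first position that keeps more weight. -/
def bestBitP : Prog (.list weightedTy) .bool := leP (headWeightP false) (headWeightP true)

/-- Fix one more position. -/
def greedyStepP : Prog (.prod (.list .bool) (.list weightedTy)) (.prod (.list .bool) (.list weightedTy)) :=
  letE (.seq .snd bestBitP)
    (.pair (consP .fst (.seq .snd .fst)) (.seq (.pair .fst (.seq .snd .snd)) advanceP))

/-- The method of conditional expectations. -/
def greedyBitsP : Prog (.prod .nat (.list weightedTy)) (.list .bool) :=
  revP (.seq (.seq (.pair .fst (.pair .nil .snd)) (.iter greedyStepP)) .fst)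

theorem greedyStepP_val (s : (Ty.prod (.list .bool) (.list weightedTy)).Val) :
    greedyStepP.val orc s = (bestBit s.2 :: s.1, advance (bestBit s.2) s.2) := by
  simp only [greedyStepP, letE_val, val, bestBitP, leP_val, consP_val, advanceP_val, headWeightP_val]
  rfl

theorem greedyStepP_cost_le (s : (Ty.prod (.list .bool) (.list weightedTy)).Val) :
    greedyStepP.cost 1 1 orc s ≤ s.2.length * 300 + 70 := by
  have h1 := headWeightP_cost_le orc false s.2
  have h2 := headWeightP_cost_le orc true s.2
  have h3 := advanceP_cost_le orc (bestBit s.2, s.2)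
  simp only at h3
  have h4 : bestBitP.val orc s.2 = bestBit s.2 := by
    simp only [bestBitP, leP_val, headWeightP_val]; rfl
  simp only [greedyStepP, letE_cost, cost, val, consP_cost, h4]
  simp only [bestBitP, leP_cost]
  omega

theorem iterate_greedy (k : ℕ) (bits : List Bool) (L : List (ℕ × List (Bool × Bool))) :
    ((fun s : List Bool × List (ℕ × List (Bool × Bool)) =>
      (bestBit s.2 :: s.1, advance (bestBit s.2) s.2))^[k] (bits, L)).1
      = (greedyBits k L).reverse ++ bits := by
  induction k generalizing bits L with
  | zero => rfl
  | succ k ih => rw [Function.iterate_succ_apply, ih, greedyBits]; simp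

@[simp] theorem greedyBitsP_val (x : (Ty.prod .nat (.list weightedTy)).Val) :
    greedyBitsP.val orc x = greedyBits x.1 x.2 := by
  rw [greedyBitsP, revP_val]
  simp only [val]
  have : (fun s => greedyStepP.val orc s) = fun s => (bestBit s.2 :: s.1, advance (bestBit s.2) s.2) :=
    funext fun s => greedyStepP_val orc s
  rw [this]
  refine (congrArg List.reverse (iterate_greedy x.1 [] x.2)).trans ?_
  simp

theorem greedyBitsP_cost_le (x : (Ty.prod .nat (.list weightedTy)).Val) {k : ℕ} (hk : x.1 = k) :
    greedyBitsP.cost 1 1 orc x ≤ k * (x.2.length * 300 + 75) + 20 := by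
  have h1 : iterCost (fun s => greedyStepP.val orc s) (fun s => greedyStepP.cost 1 1 orc s) k
      ([], x.2) ≤ k * (x.2.length * 300 + 70) := by
    refine iterCost_le (fun _ s => s.2.length ≤ x.2.length) le_rfl fun i _ s hs => ⟨?_, ?_⟩
    · rw [greedyStepP_val]
      exact (length_advance_le _ _).trans hs
    · refine (greedyStepP_cost_le orc s).trans ?_
      exact Nat.add_le_add_right (Nat.mul_le_mul_right 300 hs) 70
  have h2 := congrArg List.length (greedyBitsP_val orc x)
  rw [greedyBitsP, revP_val, List.length_reverse, length_greedyBits, hk] at h2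
  rw [greedyBitsP, revP_cost, h2]
  simp only [cost, val, hk]
  have e1 : k * (x.2.length * 300 + 75) = k * (x.2.length * 300 + 70) + k * 5 := by ring
  omega

/-- One round of the greedy cover. -/
def coverRoundP : Prog (.prod (.prod (.list (.list .bool)) (.list weightedTy)) .nat)
    (.prod (.list (.list .bool)) (.list weightedTy)) :=
  .cond (leP (lengthP (.seq .fst .snd)) (.natConst 0)) .fst
    (letE (.seq (.pair .snd (mapE (.seq .fst .snd)
        (.pair (powP (.natConst 2) (.seq .fst .fst)) (.seq .fst .snd)))) greedyBitsP)
      (.pair (consP .fst (.seq .snd (.seq .fst .fst)))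
        (filterE (.seq .snd (.seq .fst .snd))
          (notP (.seq (.pair (.seq .fst .snd) (.seq .snd .fst)) agreesP)))))

@[simp] theorem coverRoundP_val
    (x : (Ty.prod (.prod (.list (.list .bool)) (.list weightedTy)) .nat).Val) :
    coverRoundP.val orc x = coverRound x.2 x.1 := by
  simp only [coverRoundP, val, leP_val, lengthP_val, letE_val, mapE_val, powP_val, greedyBitsP_val,
    consP_val, filterE_val, notP_val, agreesP_val]
  rfl

theorem coverRoundP_cost_le
    (x : (Ty.prod (.prod (.list (.list .bool)) (.list weightedTy)) .nat).Val) {k z P : ℕ}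
    (hk : x.2 = k) (hP : x.1.2.length ≤ P) (hx : ∀ y ∈ x.1.2, (y.1 : ℕ) ≤ z ∧ y.2.length = k) :
    coverRoundP.cost 1 1 orc x ≤ P * (k * 400 + z * 40 + 200) + k * 100 + 120 := by
  have h0 := lengthP_cost_le orc x (.seq .fst .snd :
    Prog (.prod (.prod (.list (.list .bool)) (.list weightedTy)) .nat) (.list weightedTy))
  have h1 := mapE_time_le orc (lst := (.seq .fst .snd :
    Prog (.prod (.prod (.list (.list .bool)) (.list weightedTy)) .nat) (.list weightedTy)))
    (body := (.pair (powP (.natConst 2) (.seq .fst .fst)) (.seq .fst .snd))) (x := x) (tl := 3)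
    (n := P) (B := z * 37 + 30) le_rfl hP (fun y hy => by
      obtain ⟨(u : ℕ), p⟩ := y
      have h := powP_cost_le orc ((u, p), x) (.natConst 2 : Prog (.prod weightedTy
        (.prod (.prod (.list (.list .bool)) (.list weightedTy)) .nat)) .nat) (.seq .fst .fst)
      have h' : u * 37 ≤ z * 37 := Nat.mul_le_mul_right _ (hx (u, p) hy).1
      simp only [cost, val] at h ⊢
      omega)
  have h2 := greedyBitsP_cost_le orc ((k, x.1.2.map fun y => (2 ^ (y.1 : ℕ), y.2)) :
    (Ty.prod .nat (.list weightedTy)).Val) rfl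
  simp only [List.length_map] at h2
  have h2' : k * (x.1.2.length * 300 + 75) ≤ k * (P * 300 + 75) :=
    Nat.mul_le_mul_left _ (by omega)
  generalize hbits : greedyBits k (x.1.2.map fun y => (2 ^ (y.1 : ℕ), y.2)) = bits at *
  have h3 := filterE_time_le orc (lst := (.seq .snd (.seq .fst .snd) : Prog (.prod (.list .bool)
    (.prod (.prod (.list (.list .bool)) (.list weightedTy)) .nat)) (.list weightedTy)))
    (test := (notP (.seq (.pair (.seq .fst .snd) (.seq .snd .fst)) agreesP))) (x := (bits, x))
    (tl := 5) (n := P) (B := k * 80 + 30) le_rfl hP (fun y hy => by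
      have h := agreesP_cost_le orc (y.2, bits)
      simp only [(hx y hy).2] at h
      simp only [notP_cost, cost, val]
      omega)
  refine (cond_cost_le orc (B := P * (k * 380 + z * 37 + 115) + k * 75 + 80) ?_ ?_).trans ?_
  · simp only [cost]; omega
  · simp only [letE_cost, cost, val, consP_cost, mapE_val, greedyBitsP_val, powP_val, hk, hbits]
      at h1 h2 h3 ⊢
    have e1 : P * (k * 380 + z * 37 + 115) = k * (P * 300) + P * (z * 37 + 30 + 25)
      + P * (k * 80 + 30 + 30) := by ring
    have e2 : k * (P * 300 + 75) = k * (P * 300) + k * 75 := by ring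
    omega
  · simp only [leP_cost, cost, val] at h0 ⊢
    have e1 : P * (k * 400 + z * 40 + 200) = P * (k * 380 + z * 37 + 115)
      + P * (k * 20 + z * 3) + P * 85 := by ring
    omega

/-- A family of sets such that every pattern agrees with one of them. -/
def coverFamilyP : Prog (.prod .nat .nat) (.list (.list .bool)) :=
  .seq (.pair patternsP .fst)
    (.seq (iterE (lengthP .fst) (.pair .nil .fst) (.seq (.pair .fst (.seq .snd .snd)) coverRoundP)) .fst)

@[simp] theorem coverFamilyP_val (x : (Ty.prod .nat .nat).Val) :
    coverFamilyP.val orc x = coverFamily x.2 x.1 := by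
  simp only [coverFamilyP, val, iterE_val, lengthP_val, patternsP_val, coverRoundP_val]
  rfl

/-- With `P` bounding the number of patterns there are at most `P` rounds, each of cost linear in
`P`; hence the square. -/
theorem coverFamilyP_cost_le (x : (Ty.prod .nat .nat).Val) {k z : ℕ} (hk : x.1 = k) (hz : x.2 = z) :
    coverFamilyP.cost 1 1 orc x
      ≤ 1000 * (((2 * k + 1) ^ z) ^ 2 * ((k + 1) * (z + 1))) := by
  have h0 := patternsP_cost_le orc x hk hz
  have h1 := lengthP_cost_le orc (patterns z k, k)
    (.fst : Prog (.prod (.list weightedTy) .nat) (.list weightedTy))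
  have hP := length_patterns_le z k
  have hP1 : 1 ≤ (2 * k + 1) ^ z := Nat.one_le_pow _ _ (by omega)
  have hst := coverState_iterate z k
  generalize (2 * k + 1) ^ z = P at *
  have h2 := iterE_time_le orc (cnt := (lengthP .fst : Prog (.prod (.list weightedTy) .nat) .nat))
    (init := .pair .nil .fst) (body := .seq (.pair .fst (.seq .snd .snd)) coverRoundP)
    (x := (patterns z k, k)) (n := P) (tc := P * 19 + 9) (ti := 3)
    (B := P * (k * 400 + z * 40 + 200) + k * 100 + 130)
    (fun i s => s = (coverRound k)^[i] ([], patterns z k))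
    (by simp only [cost, val] at h1; omega) (by simp [cost])
    (by rw [lengthP_val]; exact hP) rfl (fun i _ s hs => by
      subst hs
      refine ⟨?_, ?_⟩
      · simp only [val, coverRoundP_val, Function.iterate_succ_apply']
      · have h := coverRoundP_cost_le orc ((coverRound k)^[i] ([], patterns z k), k) (k := k)
          (z := z) (P := P) rfl ((hst i).progress.trans ((Nat.sub_le _ _).trans hP))
          (fun y hy => ⟨Nat.le.intro (budget_of_mem_patterns ((hst i).sub y hy)), length_of_mem_patterns ((hst i).sub y hy)⟩)
        simp only [cost, val]
        omega)
  simp only [coverFamilyP, cost, val, patternsP_val, hk, hz] at h2 ⊢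
  have e1 : 1000 * (P ^ 2 * ((k + 1) * (z + 1)))
    = P * P * (1000 * (k * z) + 1000 * k + 1000 * z + 1000) := by ring
  have e2 : k * (P * 120 + 15) = P * (k * 120) + k * 15 := by ring
  have e3 : P * (P * (k * 400 + z * 40 + 200) + k * 100 + 130 + 2)
    = P * P * (k * 400 + z * 40 + 200) + P * (k * 100) + P * 132 := by ring
  have e4 : P * (k * 220 + 200) ≤ P * P * (k * 220 + 200) :=
    Nat.mul_le_mul_right _ (Nat.le_mul_of_pos_left _ hP1)
  have e5 : P * (k * 220 + 200) = P * (k * 120) + P * (k * 100) + P * 132 + P * 68 := by ring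
  have e6 : P * P * (1000 * (k * z) + 1000 * k + 1000 * z + 1000)
    = P * P * (k * 400 + z * 40 + 200) + P * P * (k * 220 + 200)
      + P * P * (1000 * (k * z) + 380 * k + 960 * z + 600) := by ring
  have e7 : 1 * (k * 15 + 600) ≤ P * P * (1000 * (k * z) + 380 * k + 960 * z + 600) :=
    Nat.mul_le_mul (Nat.mul_pos hP1 hP1) (by omega)
  omega

/-- The remainder. -/
def modP : Prog (.prod .nat .nat) .nat :=
  iterE .fst .fst (.cond (leP (.seq .snd .snd) .fst) (subP .fst (.seq .snd .snd)) .fst)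

theorem modP_val (x : (Ty.prod .nat .nat).Val) {u q : ℕ} (hu : x.1 = u) (hq : x.2 = q) (hq0 : 1 ≤ q) :
    modP.val orc x = (u % q : ℕ) := by
  simp only [modP, iterE_val, val, leP_val, subP_val, hu, hq]
  -- Each round either finds the number already below `q` or lowers it by at least one, so `u`
  -- rounds reach the remainder.
  have key : ∀ i : ℕ, ((fun r : ℕ => bif Nat.ble q r then r - q else r)^[i] u) % q = u % q ∧
      ((fun r : ℕ => bif Nat.ble q r then r - q else r)^[i] u < q ∨
        (fun r : ℕ => bif Nat.ble q r then r - q else r)^[i] u + i ≤ u) := by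
    intro i
    induction i with
    | zero => exact ⟨rfl, .inr le_rfl⟩
    | succ i ih =>
      rw [Function.iterate_succ_apply']
      generalize (fun r : ℕ => bif Nat.ble q r then r - q else r)^[i] u = r at ih ⊢
      cases hb : Nat.ble q r
      · have : ¬ q ≤ r := by rw [← Nat.ble_eq, hb]; simp
        exact ⟨ih.1, .inl (by simp only [cond_false]; omega)⟩
      · rw [Nat.ble_eq] at hb
        refine ⟨?_, .inr ?_⟩
        · rw [cond_true, ← ih.1, ← Nat.mod_eq_sub_mod hb]
        · simp only [cond_true]; omega
  obtain ⟨h1, h2⟩ := key u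
  have h3 : (fun r : ℕ => bif Nat.ble q r then r - q else r)^[u] u < q := by omega
  exact (Nat.mod_eq_of_lt h3).symm.trans h1

theorem modP_cost_le (x : (Ty.prod .nat .nat).Val) : modP.cost 1 1 orc x ≤ (x.1 : ℕ) * 20 + 10 := by
  have := iterE_time_le orc (cnt := .fst) (init := .fst)
    (body := .cond (leP (.seq .snd .snd) .fst) (subP .fst (.seq .snd .snd)) .fst) (x := x) (B := 15)
    (fun _ _ => True) le_rfl le_rfl le_rfl trivial (fun i _ s _ => ⟨trivial, by
      refine (cond_cost_le orc (B := 7) ?_ ?_).trans ?_ <;> simp only [leP_cost, subP_cost, cost] <;>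
        omega⟩)
  simp only [cost, val] at this
  rw [modP]
  omega

end Prog

namespace Prog

variable {e a b c : Ty} (orc : ℕ → List ℕ → Bool)

/-- An exponent `L` with `m ≤ 2 ^ L`. -/
def digitsP : Prog .nat .nat := addP (.seq logP .fst) (.natConst 1)

/-- One digit more than needed ensures `1 ≤ L`, so that additive constants can be absorbed into
multiples of `L`. It costs a factor of two in `2 ^ L`. -/
theorem digitsP_spec (m : ℕ) : ∃ L : ℕ, digitsP.val orc m = L ∧ 1 ≤ L ∧ m ≤ 2 ^ L ∧
    2 ^ L ≤ 4 * max m 2 := by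
  rcases Nat.eq_zero_or_pos m with rfl | hm
  · refine ⟨1, ?_, le_rfl, Nat.zero_le _, by norm_num⟩
    simp only [digitsP, addP_val, val, logP, iterE_val]
    rfl
  · obtain ⟨j, h1, h2, h3, -⟩ := logP_spec (orc := orc) hm
    refine ⟨j + 1, ?_, by omega, ?_, ?_⟩
    · simp only [digitsP, addP_val, val, h1]
    · rw [pow_succ]; omega
    · have : m ≤ max m 2 := le_max_left _ _
      rw [pow_succ]; omega

theorem digitsP_cost_le (m : ℕ) : digitsP.cost 1 1 orc m ≤ m * 27 + 20 := by
  have := logP_cost_le (orc := orc) m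
  simp only [digitsP, addP_cost, cost]
  omega

/-- The number of moduli. -/
def moduliP : Prog (.prod .nat .nat) .nat :=
  addP (mulP (.natConst 2) (mulP (.seq .fst digitsP) (mulP .snd .snd))) (.natConst 3)

theorem moduliP_val (x : (Ty.prod .nat .nat).Val) {m z L : ℕ} (hm : x.1 = m) (hz : x.2 = z)
    (hL : digitsP.val orc m = L) : moduliP.val orc x = moduli L z := by
  simp only [moduliP, addP_val, mulP_val, val, hm, hz, hL]
  rfl

theorem moduliP_cost_le (x : (Ty.prod .nat .nat).Val) {m z L : ℕ} (hm : x.1 = m) (hz : x.2 = z)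
    (hL : digitsP.val orc m = L) : moduliP.cost 1 1 orc x ≤ m * 27 + L * 9 + z * 9 + 100 := by
  have h1 := mulP_cost_le orc x (.natConst 2)
    (mulP (.seq .fst digitsP) (mulP .snd .snd) : Prog (.prod .nat .nat) .nat)
  have h2 := mulP_cost_le orc x (.seq .fst digitsP : Prog (.prod .nat .nat) .nat) (mulP .snd .snd)
  have h3 := mulP_cost_le orc x (.snd : Prog (.prod .nat .nat) .nat) .snd
  have h4 := digitsP_cost_le orc m
  simp only [moduliP, addP_cost, cost, val, hm, hz, hL] at h1 h2 h3 ⊢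
  omega

/-- The environment of the following program: the family, the number of moduli, and the numbers of
points and of points to be selected. -/
abbrev hashTy : Ty := .prod (.list (.list .bool)) (.prod .nat (.prod .nat .nat))

/-- The mask of a residue class. -/
def residueMaskP : Prog (.prod .nat (.prod (.list .bool) (.prod .nat hashTy))) (.list .bool) :=
  mapE (rangeP (.seq .snd (.seq .snd (.seq .snd (.seq .snd (.seq .snd .fst))))))
    (nthP (.boolConst false)
      (.seq (.pair .fst (addP (.seq .snd (.seq .snd (.seq .snd .fst))) (.natConst 1))) modP)
      (.seq .snd (.seq .snd .fst)))

theorem residueMaskP_val (x : (Ty.prod .nat (.prod (.list .bool) (.prod .nat hashTy))).Val) :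
    residueMaskP.val orc x = residueMask x.2.2.2.2.2.1 (x.2.2.1 + 1) x.2.1 := by
  simp only [residueMaskP, mapE_val, rangeP_val, val, nthP_val, addP_val]
  refine List.map_congr_left fun (u : ℕ) _ => ?_
  have h := modP_val orc ((u, (x.2.2.1 + 1 : ℕ)) : (Ty.prod .nat .nat).Val) (u := u)
    (q := (x.2.2.1 + 1 : ℕ)) rfl rfl (Nat.succ_pos _)
  rw [h]

theorem residueMaskP_cost_le (x : (Ty.prod .nat (.prod (.list .bool) (.prod .nat hashTy))).Val)
    {m : ℕ} (hm : x.2.2.2.2.2.1 = m) :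
    residueMaskP.cost 1 1 orc x ≤ m * (m * 32 + 90) + 45 := by
  have h0 := rangeP_cost_le orc x (.seq .snd (.seq .snd (.seq .snd (.seq .snd (.seq .snd .fst)))) :
    Prog (.prod .nat (.prod (.list .bool) (.prod .nat hashTy))) .nat)
  have h := mapE_time_le orc (lst := rangeP (.seq .snd (.seq .snd (.seq .snd (.seq .snd (.seq .snd .fst))))))
    (body := (nthP (.boolConst false)
      (.seq (.pair .fst (addP (.seq .snd (.seq .snd (.seq .snd .fst))) (.natConst 1))) modP)
      (.seq .snd (.seq .snd .fst)))) (x := x) (tl := m * 16 + 31) (n := m) (B := m * 32 + 45)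
    (by simp only [cost, val, hm] at h0; omega) (by
      rw [rangeP_val]; simp only [val, hm, List.length_range]; exact le_rfl)
    (fun (u : ℕ) hu => by
      have hu' : u < m := by
        rw [rangeP_val] at hu
        simp only [val, hm] at hu
        exact List.mem_range.1 hu
      have h1 := nthP_cost_le orc (u, x) (.boolConst false) (.seq (.pair .fst (addP
        (.seq .snd (.seq .snd (.seq .snd .fst))) (.natConst 1))) modP : Prog (.prod .nat
          (.prod .nat (.prod (.list .bool) (.prod .nat hashTy)))) .nat) (.seq .snd (.seq .snd .fst))
      have h2 := modP_cost_le orc ((u, (x.2.2.1 + 1 : ℕ)) : (Ty.prod .nat .nat).Val)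
      have h3 := modP_val orc ((u, (x.2.2.1 + 1 : ℕ)) : (Ty.prod .nat .nat).Val) (u := u)
        (q := (x.2.2.1 + 1 : ℕ)) rfl rfl (Nat.succ_pos _)
      have h4 : u % (x.2.2.1 + 1 : ℕ) ≤ u := Nat.mod_le _ _
      simp only [cost, val, addP_val, addP_cost, h3] at h1 h2 ⊢
      generalize u % (x.2.2.1 + 1 : ℕ) = r at h1 h4
      omega)
  rw [residueMaskP]
  have e : m * (m * 32 + 90) = m * (m * 32 + 45 + 25) + m * 20 := by ring
  omega

/-- The specifications for one modulus and one set. -/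
def classSpecsP : Prog (.prod (.list .bool) (.prod .nat hashTy)) (.list specTy) :=
  mapE (rangeP (.seq .snd (.seq .snd (.seq .snd (.seq .snd .snd)))))
    (.pair residueMaskP (addP .fst (.natConst 1)))

theorem classSpecsP_val (x : (Ty.prod (.list .bool) (.prod .nat hashTy)).Val) :
    classSpecsP.val orc x = (List.range x.2.2.2.2.2).map fun t =>
      (residueMask x.2.2.2.2.1 (x.2.1 + 1) x.1, t + 1) := by
  simp only [classSpecsP, mapE_val, rangeP_val, val, residueMaskP_val, addP_val]

theorem classSpecsP_cost_le (x : (Ty.prod (.list .bool) (.prod .nat hashTy)).Val) {m z : ℕ}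
    (hm : x.2.2.2.2.1 = m) (hz : x.2.2.2.2.2 = z) :
    classSpecsP.cost 1 1 orc x ≤ z * (m * (m * 32 + 90) + 100) + 40 := by
  have h0 := rangeP_cost_le orc x (.seq .snd (.seq .snd (.seq .snd (.seq .snd .snd))) :
    Prog (.prod (.list .bool) (.prod .nat hashTy)) .nat)
  have h := mapE_time_le orc (lst := rangeP (.seq .snd (.seq .snd (.seq .snd (.seq .snd .snd)))))
    (body := .pair residueMaskP (addP .fst (.natConst 1))) (x := x) (tl := z * 16 + 25) (n := z)
    (B := m * (m * 32 + 90) + 51) (by simp only [cost, val, hz] at h0; omega) (by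
      rw [rangeP_val]; simp only [val, hz, List.length_range]; exact le_rfl)
    (fun t _ => by
      have := residueMaskP_cost_le orc (t, x) hm
      simp only [cost, addP_cost]
      omega)
  rw [classSpecsP]
  have e : z * (m * (m * 32 + 90) + 100) = z * (m * (m * 32 + 90) + 51 + 25) + z * 24 := by ring
  omega

/-- All specifications of the deterministic algorithm. -/
def hashSpecsP : Prog (.prod .nat .nat) (.list specTy) :=
  letE moduliP (letE (.seq (.pair .fst (.seq .snd .snd)) coverFamilyP)
    (flatMapE (rangeP (.seq .snd .fst)) (flatMapE (.seq .snd .fst) classSpecsP)))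

theorem hashSpecsP_val (x : (Ty.prod .nat .nat).Val) {m z L : ℕ} (hm : x.1 = m) (hz : x.2 = z)
    (hL : digitsP.val orc m = L) : hashSpecsP.val orc x = hashSpecs m z L := by
  simp only [hashSpecsP, letE_val, flatMapE_val, val, coverFamilyP_val, rangeP_val, classSpecsP_val,
    moduliP_val orc x hm hz hL, hm, hz]
  rfl

theorem hashSpecsP_cost_le (x : (Ty.prod .nat .nat).Val) {m z L : ℕ} (hm : x.1 = m) (hz : x.2 = z)
    (hL : digitsP.val orc m = L) (hLm : L ≤ 4 * m + 8) : hashSpecsP.cost 1 1 orc x ≤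
      1000 * (((2 * moduli L z + 1) ^ z) ^ 2 * ((moduli L z + 1) * (z + 1)))
      + (moduli L z + 1) * (((coverFamily z (moduli L z)).length + 1) * ((z + 1) * (300 * (m + 1) ^ 2)))
      := by
  have h0 := moduliP_cost_le orc x hm hz hL
  have hv := moduliP_val orc x hm hz hL
  have h1 := coverFamilyP_cost_le orc ((moduli L z, z) : (Ty.prod .nat .nat).Val) rfl rfl
  generalize 1000 * (((2 * moduli L z + 1) ^ z) ^ 2 * ((moduli L z + 1) * (z + 1))) = G at h1 ⊢
  generalize moduli L z = k at *
  generalize hF : coverFamily z k = F at *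
  set y : (hashTy).Val := (F, (k, x)) with hy
  have h2 : ∀ i : ℕ, (flatMapE (.seq .snd .fst) classSpecsP : Prog (.prod .nat hashTy) _).cost 1 1
      orc (i, y) ≤ 3 + F.length * (z * (m * (m * 32 + 90) + 100) + 40 + z * 10 + 20) + 12 := by
    intro i
    refine flatMapE_time_le orc le_rfl le_rfl (fun A _ => classSpecsP_cost_le orc (A, (i, y)) hm hz)
      fun A _ => ?_
    rw [classSpecsP_val, List.length_map, List.length_range]
    exact hz.le
  have h3 := rangeP_cost_le orc y (.seq .snd .fst : Prog hashTy .nat)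
  have h4 := flatMapE_time_le orc (lst := (rangeP (.seq .snd .fst) : Prog hashTy (.list .nat)))
    (body := flatMapE (.seq .snd .fst) classSpecsP) (x := y) (tl := k * 16 + 20) (n := k)
    (B := 3 + F.length * (z * (m * (m * 32 + 90) + 100) + 40 + z * 10 + 20) + 12)
    (k := F.length * z) (by simp only [cost, val, hy] at h3 ⊢; omega) (by
      rw [rangeP_val]; simp only [val, hy, List.length_range]; exact le_rfl) (fun i _ => h2 i)
    (fun i _ => by
      simp only [flatMapE_val, val, classSpecsP_val, hy]
      refine length_flatMap_le le_rfl fun A _ => ?_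
      rw [List.length_map, List.length_range, hz])
  rw [hy] at h4
  simp only [hashSpecsP, letE_cost, cost, val, hv, hz, coverFamilyP_val, hF] at h4 ⊢
  have e0 : m * (m * 32 + 90) = 32 * (m * m) + 90 * m := by ring
  have e1 : (z + 1) * (300 * (m + 1) ^ 2) = z * (32 * (m * m) + 90 * m + 100)
    + z * (268 * (m * m) + 510 * m + 200) + 300 * (m * m) + 600 * m + 300 := by ring
  have e2 : z * (268 * (m * m) + 510 * m + 200) = z * (268 * (m * m) + 510 * m) + 200 * z := by ring
  rw [e0] at h4
  generalize z * (32 * (m * m) + 90 * m + 100) = C at *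
  generalize (z + 1) * (300 * (m + 1) ^ 2) = T at *
  have e3 : (k + 1) * ((F.length + 1) * T) = k * (F.length * T) + k * T + F.length * T + T := by ring
  have e4 : k * (3 + F.length * (C + 40 + z * 10 + 20) + 12 + F.length * z * 10 + 20)
    = k * (F.length * (C + 60 + 20 * z)) + k * 35 := by ring
  have e5 : k * (F.length * (C + 60 + 20 * z)) ≤ k * (F.length * T) :=
    Nat.mul_le_mul_left _ (Nat.mul_le_mul_left _ (by omega))
  have e6 : k * 300 ≤ k * T := Nat.mul_le_mul_left _ (by omega)
  omega

end Prog

/-! ### The deterministic algorithm -/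

/-- `L ^ k` is at most the rising factorial, which is `k!` times a binomial coefficient below `2 ^
(k + L)`. With `2 ^ L = O(m)` this turns powers of `log m` with exponent depending on `z` into a
function of `z` times `m`. -/
theorem pow_le_factorial_mul_two_pow (L k : ℕ) : L ^ k ≤ k ^ k * 2 ^ k * 2 ^ L := by
  rcases Nat.eq_zero_or_pos L with rfl | hL
  · rcases Nat.eq_zero_or_pos k with rfl | hk
    · simp
    · rw [zero_pow hk.ne']; exact Nat.zero_le _
  calc L ^ k ≤ L.ascFactorial k := by
        obtain ⟨j, rfl⟩ : ∃ j, L = j + 1 := ⟨L - 1, by omega⟩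
        exact Nat.pow_succ_le_ascFactorial _ k
    _ = k.factorial * (L + k - 1).choose k := Nat.ascFactorial_eq_factorial_mul_choose' L k
    _ ≤ k ^ k * 2 ^ (k + L) := by
        refine Nat.mul_le_mul (Nat.factorial_le_pow k) ((Nat.choose_le_two_pow _ _).trans ?_)
        exact Nat.pow_le_pow_right (by norm_num) (by omega)
    _ = _ := by rw [pow_add, mul_assoc]

/-- The part of the running time of the deterministic algorithm that depends on the parameters. -/
def detBound (ℓ z : ℕ) : ℕ :=
  8000 * ((z + 1) * (48 * (z + 1) ^ 3) ^ (2 * z + 1))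
    + 2 ^ z * (z + 1) ^ 6 * (240000 + 800 * Prog.mainBound ℓ z + 1600) + 60

theorem length_hashSpecs_succ_le {m z L : ℕ} (hLm : L ≤ 4 * m + 8) :
    (moduli L z + 1) * (((coverFamily z (moduli L z)).length + 1) * (z + 1))
      ≤ 800 * (2 ^ z * (z + 1) ^ 6) * (m + 1) ^ 2 := by
  have h1 := length_coverFamily_moduli_le z L
  have h2 : moduli L z + 1 ≤ 20 * ((z + 1) ^ 2 * (m + 1)) := by
    have : L * (z * z) ≤ (8 * (m + 1)) * (z * z) := Nat.mul_le_mul_right _ (by omega)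
    have e : 20 * ((z + 1) ^ 2 * (m + 1)) = 2 * ((8 * (m + 1)) * (z * z)) + 4 * (m * (z * z))
      + 4 * (z * z) + 40 * (z * m) + 40 * z + 20 * m + 20 := by ring
    rw [moduli]
    omega
  generalize moduli L z = k at *
  have h3 : (coverFamily z k).length + 1 ≤ 2 ^ z * (2 * (k + 1) * (z + 1)) := by
    have : 2 ^ z * (2 * (k + 1) * (z + 1)) = 2 ^ z * (2 * k * z) + 2 ^ z * (2 * k + 2 * z) + 2 ^ z * 2 := by
      ring
    have : 1 ≤ 2 ^ z := Nat.one_le_two_pow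
    omega
  calc (k + 1) * (((coverFamily z k).length + 1) * (z + 1))
      ≤ (k + 1) * (2 ^ z * (2 * (k + 1) * (z + 1)) * (z + 1)) :=
        Nat.mul_le_mul_left _ (Nat.mul_le_mul_right _ h3)
    _ = 2 * 2 ^ z * (z + 1) ^ 2 * ((k + 1) * (k + 1)) := by ring
    _ ≤ 2 * 2 ^ z * (z + 1) ^ 2 *
        ((20 * ((z + 1) ^ 2 * (m + 1))) * (20 * ((z + 1) ^ 2 * (m + 1)))) :=
        Nat.mul_le_mul_left _ (Nat.mul_le_mul h2 h2)
    _ = _ := by ring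

/-- The time for the family is a power of the number of moduli with exponent `2 * z + 1`, and the
number of moduli is linear in `L`. The dependence of the exponent on `z` is removed by
`pow_le_factorial_mul_two_pow`. -/
theorem patterns_time_le {m z L : ℕ} (hL1 : 1 ≤ L) (hL : 2 ^ L ≤ 8 * (m + 1)) :
    1000 * (((2 * moduli L z + 1) ^ z) ^ 2 * ((moduli L z + 1) * (z + 1)))
      ≤ 8000 * ((z + 1) * (48 * (z + 1) ^ 3) ^ (2 * z + 1)) * (m + 1) := by
  have h1 : 2 * (moduli L z + 1) ≤ 12 * (z + 1) ^ 2 * L := by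
    have e : 12 * (z + 1) ^ 2 * L = 4 * (L * (z * z)) + 8 * (L * (z * z)) + 24 * (L * z) + 12 * L := by
      ring
    rw [moduli]
    omega
  generalize moduli L z = k at *
  have h2 : ((2 * k + 1) ^ z) ^ 2 * (k + 1) ≤ (48 * (z + 1) ^ 3) ^ (2 * z + 1) * (8 * (m + 1)) := by
    calc ((2 * k + 1) ^ z) ^ 2 * (k + 1) ≤ ((2 * (k + 1)) ^ z) ^ 2 * (2 * (k + 1)) :=
          Nat.mul_le_mul (Nat.pow_le_pow_left (Nat.pow_le_pow_left (by omega) _) _) (by omega)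
      _ = (2 * (k + 1)) ^ (2 * z + 1) := by rw [← pow_mul, mul_comm z 2, ← pow_succ]
      _ ≤ (12 * (z + 1) ^ 2 * L) ^ (2 * z + 1) := Nat.pow_le_pow_left h1 _
      _ = (12 * (z + 1) ^ 2) ^ (2 * z + 1) * L ^ (2 * z + 1) := mul_pow _ _ _
      _ ≤ (12 * (z + 1) ^ 2) ^ (2 * z + 1) *
          ((2 * z + 1) ^ (2 * z + 1) * 2 ^ (2 * z + 1) * (8 * (m + 1))) :=
          Nat.mul_le_mul_left _ ((pow_le_factorial_mul_two_pow _ _).trans (Nat.mul_le_mul_left _ hL))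
      _ = (12 * (z + 1) ^ 2 * ((2 * z + 1) * 2)) ^ (2 * z + 1) * (8 * (m + 1)) := by
          rw [mul_pow (12 * (z + 1) ^ 2) ((2 * z + 1) * 2), mul_pow (2 * z + 1) 2]; ring
      _ ≤ _ := by
          refine Nat.mul_le_mul_right _ (Nat.pow_le_pow_left ?_ _)
          have e : 48 * (z + 1) ^ 3 = 12 * (z + 1) ^ 2 * (4 * (z + 1)) := by ring
          rw [e]
          exact Nat.mul_le_mul_left _ (by omega)
  calc 1000 * (((2 * k + 1) ^ z) ^ 2 * ((k + 1) * (z + 1)))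
      = 1000 * (z + 1) * (((2 * k + 1) ^ z) ^ 2 * (k + 1)) := by ring
    _ ≤ 1000 * (z + 1) * ((48 * (z + 1) ^ 3) ^ (2 * z + 1) * (8 * (m + 1))) :=
        Nat.mul_le_mul_left _ h2
    _ = _ := by ring

theorem detBound_time_le {m n B N K A S P : ℕ} (hN : N + 1 ≤ K) (hK : K ≤ 800 * S * (m + 1) ^ 2)
    (hA : A ≤ P * (m + 1)) :
    60 + m * 19 + (A + 300 * K * (m + 1) ^ 2) + (N + 1) * ((n + 1) * (m + 1) ^ 2 * B) + 2 * (N * n)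
      ≤ (P + S * (240000 + 800 * B + 1600) + 60) * ((n + 1) * (m + 1) ^ 4) := by
  have h1 : 60 + m * 19 ≤ 60 * ((n + 1) * (m + 1) ^ 4) := by
    have : m + 1 ≤ (n + 1) * (m + 1) ^ 4 :=
      (Nat.le_self_pow (by norm_num) _).trans (Nat.le_mul_of_pos_left _ (by omega))
    omega
  have h2 : A ≤ P * ((n + 1) * (m + 1) ^ 4) := hA.trans <| Nat.mul_le_mul_left _ <|
    (Nat.le_self_pow (by norm_num) _).trans (Nat.le_mul_of_pos_left _ (by omega))
  have h3 : 300 * K * (m + 1) ^ 2 ≤ 240000 * S * ((n + 1) * (m + 1) ^ 4) := by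
    calc 300 * K * (m + 1) ^ 2 ≤ 300 * (800 * S * (m + 1) ^ 2) * (m + 1) ^ 2 :=
          Nat.mul_le_mul_right _ (Nat.mul_le_mul_left _ hK)
      _ = 240000 * S * (m + 1) ^ 4 := by ring
      _ ≤ _ := Nat.mul_le_mul_left _ (Nat.le_mul_of_pos_left _ (by omega))
  have h4 : (N + 1) * ((n + 1) * (m + 1) ^ 2 * B) ≤ 800 * S * B * ((n + 1) * (m + 1) ^ 4) := by
    calc (N + 1) * ((n + 1) * (m + 1) ^ 2 * B)
        ≤ (800 * S * (m + 1) ^ 2) * ((n + 1) * (m + 1) ^ 2 * B) :=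
          Nat.mul_le_mul_right _ (hN.trans hK)
      _ = _ := by ring
  have h5 : 2 * (N * n) ≤ 1600 * S * ((n + 1) * (m + 1) ^ 4) := by
    calc 2 * (N * n) ≤ 2 * ((800 * S * (m + 1) ^ 2) * (n + 1)) :=
          Nat.mul_le_mul_left _ (Nat.mul_le_mul (by omega) (by omega))
      _ = 1600 * S * ((n + 1) * (m + 1) ^ 2) := by ring
      _ ≤ _ := Nat.mul_le_mul_left _ (Nat.mul_le_mul_left _
          (Nat.pow_le_pow_right (by omega) (by norm_num)))
  have e : (P + S * (240000 + 800 * B + 1600) + 60) * ((n + 1) * (m + 1) ^ 4)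
      = P * ((n + 1) * (m + 1) ^ 4) + 240000 * S * ((n + 1) * (m + 1) ^ 4)
        + 800 * S * B * ((n + 1) * (m + 1) ^ 4) + 1600 * S * ((n + 1) * (m + 1) ^ 4)
        + 60 * ((n + 1) * (m + 1) ^ 4) := by ring
  omega

namespace Prog

/-- The deterministic algorithm. -/
def detP : Prog CoverageInstance.inputTy (.list .nat) :=
  .seq (.pair (.seq (.pair pointsP (.seq .snd .fst)) hashSpecsP) .id) mainP

theorem hashSpecsP_isDet : hashSpecsP.isDet = true := by decide
theorem hashSpecsP_isQueryFree : hashSpecsP.isQueryFree = true := by decide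

theorem detP_isDet : detP.isDet = true := by
  simp only [detP, isDet, hashSpecsP_isDet, mainP_isDet, pointsP, lengthP, foldE, addP, Bool.and_true]

variable {ℓ n m s : ℕ} (I : CoverageInstance ℓ n m s) (z : ℕ)

/-- The summand `2 * (N * n)` next to the time is room reserved for replacing the rounded logarithm
by the real one. -/
theorem detP_outcome (hz : 1 ≤ z) {r : List ℕ × Cost} (hr : r ∈ (I.exec detP z).support) :
    ∃ L N : ℕ, 1 ≤ L ∧ 2 ^ L ≤ 4 * max m 2 ∧
      N = moduli L z * ((coverFamily z (moduli L z)).length * z) ∧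
      (∀ v ∈ r.1, v < n) ∧ r.1.length ≤ N * Γbound ℓ z ∧ r.2.queries ≤ n * (N * Γbound ℓ z) ∧
      r.2.time + 2 * (N * n) ≤ N * (n * (Nat.clog 2 n + 1)) + detBound ℓ z * ((n + 1) * (m + 1) ^ 4) ∧
      I.IsKernel z (CoverageInstance.outputSet n r.1) := by
  obtain ⟨L, hL, hL1, hmL, hL2⟩ := digitsP_spec I.oracle m
  have hLm : L ≤ 4 * m + 8 := by
    have : L < 2 ^ L := Nat.lt_two_pow_self
    have : max m 2 ≤ m + 2 := by omega
    omega
  rw [CoverageInstance.exec, run_eq_pure I.oracle detP (deterministic_of_isDet detP_isDet),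
    PMF.support_pure, Set.mem_singleton_iff] at hr
  subst hr
  have hxm : (I.input z).2.2.1.length = m := by rw [CoverageInstance.input_eq]; simp
  have hxz : (I.input z).2.1 = z := by rw [CoverageInstance.input_eq]
  have hpm : pointsP.val I.oracle (I.input z) = m := by
    simp only [pointsP, lengthP_val, val, hxm]
  have hspecs := hashSpecsP_val I.oracle ((m, z) : (Ty.prod .nat .nat).Val) rfl rfl hL
  have hval : detP.val I.oracle (I.input z)
      = (hashSpecs m z L).flatMap fun sp => I.specOutput z sp.1 sp.2 := by
    refine Eq.trans ?_ (mainP_val I z _)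
    simp only [detP, val, hpm, hxz, hspecs]
  have hlen := length_hashSpecs m z L
  refine ⟨L, (hashSpecs m z L).length, hL1, hL2, hlen, ?_, ?_, ?_, ?_, ?_⟩
  · intro v hv
    simp only [hval] at hv
    obtain ⟨sp, -, hv⟩ := List.mem_flatMap.1 hv
    exact I.specOutput_lt v hv
  · simp only [hval]
    exact length_flatMap_le le_rfl fun sp _ => I.specOutput_length_le z sp.1 sp.2
  · have h := mainP_queries_le I z (hashSpecs m z L)
    have h2 := cost_queries_eq_zero I.oracle hashSpecsP_isQueryFree ((m, z) : (Ty.prod .nat .nat).Val)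
    have h3 := cost_queries_eq_zero I.oracle (show pointsP.isQueryFree = true from rfl) (I.input z)
    simp only [queries, detP, cost, val, hpm, hxz, hspecs, h2, h3, zero_add]
    exact h
  · have h := mainP_cost_le I z (hashSpecs m z L)
      fun sp hsp => (hashSpecs_snd_le hsp).trans (by omega)
    have h1 := hashSpecsP_cost_le I.oracle ((m, z) : (Ty.prod .nat .nat).Val) rfl rfl hL hLm
    have h2 := lengthP_cost_le I.oracle (I.input z)
      (.seq .snd (.seq .snd .fst) : Prog CoverageInstance.inputTy (.list .real))
    have h3 := length_hashSpecs_succ_le (m := m) (z := z) hLm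
    have h4 := patterns_time_le (m := m) (z := z) hL1 (by
      have : max m 2 ≤ 2 * (m + 1) := by omega
      omega)
    simp only [cost, val, detP, pointsP, hxm, hxz, hspecs, lengthP_val] at h h1 h2 ⊢
    have hN : (hashSpecs m z L).length + 1
        ≤ (moduli L z + 1) * (((coverFamily z (moduli L z)).length + 1) * (z + 1)) := by
      rw [hlen]
      have e : (moduli L z + 1) * (((coverFamily z (moduli L z)).length + 1) * (z + 1))
          = moduli L z * ((coverFamily z (moduli L z)).length * z) + 1
            + (moduli L z * ((coverFamily z (moduli L z)).length + 1) + moduli L z * z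
              + (coverFamily z (moduli L z)).length * (z + 1) + z) := by ring
      omega
    have e : (moduli L z + 1) * (((coverFamily z (moduli L z)).length + 1) *
        ((z + 1) * (300 * (m + 1) ^ 2)))
        = 300 * ((moduli L z + 1) * (((coverFamily z (moduli L z)).length + 1) * (z + 1)))
          * (m + 1) ^ 2 := by ring
    rw [e] at h1
    have h5 := detBound_time_le (m := m) (n := n) (B := mainBound ℓ z) hN h3 h4
    rw [detBound]
    omega
  · refine I.isKernel_of_separating (specs := hashSpecs m z L) ?_ ?_
    · intro sp hsp v hv
      simp only [CoverageInstance.outputSet, Finset.mem_filter, Finset.mem_univ, true_and, hval]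
      exact List.mem_flatMap.2 ⟨sp, hsp, hv⟩
    · intro T Y hTY hle t ht1 htz
      exact exists_mem_hashSpecs hmL hTY hle ht1 htz

end Prog

/-! ### The bounds of the theorem -/

theorem card_outputSet_le (n : ℕ) (l : List ℕ) : (CoverageInstance.outputSet n l).card ≤ l.length := by
  calc (CoverageInstance.outputSet n l).card
      = ((CoverageInstance.outputSet n l).map Fin.valEmbedding).card := (Finset.card_map _).symm
    _ ≤ l.toFinset.card := by
        refine Finset.card_le_card fun v hv => ?_
        obtain ⟨e, he, rfl⟩ := Finset.mem_map.1 hv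
        exact List.mem_toFinset.2 (Finset.mem_filter.1 he).2
    _ ≤ l.length := List.toFinset_card_le l

/-- Rounding costs one unit and the definition of the sorting cost another. The excess `2 * n` is
not bounded by a multiple of `n * log n` when `n = 1`, so it has to be charged to the term that is
polynomial in `m`. -/
theorem mul_clog_add_one_le (n : ℕ) : (n : ℝ) * (Nat.clog 2 n + 1) ≤ n * Real.logb 2 n + 2 * n := by
  rcases Nat.eq_zero_or_pos n with rfl | hn
  · simp
  have hn' : (0 : ℝ) < n := by exact_mod_cast hn
  have h : (Nat.clog 2 n : ℝ) ≤ Real.logb 2 n + 1 := by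
    rcases Nat.eq_zero_or_pos (Nat.clog 2 n) with h0 | h0
    · rw [h0]
      have : 0 ≤ Real.logb 2 n := Real.logb_nonneg (by norm_num) (by exact_mod_cast hn)
      push_cast; linarith
    · have h1 : 2 ^ (Nat.clog 2 n - 1) < n :=
        Nat.pow_lt_of_lt_clog (by omega)
      have h2 : ((Nat.clog 2 n - 1 : ℕ) : ℝ) ≤ Real.logb 2 n := by
        rw [Real.le_logb_iff_rpow_le (by norm_num) hn', Real.rpow_natCast]
        exact_mod_cast h1.le
      rw [Nat.cast_sub h0] at h2
      push_cast at h2; linarith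
  nlinarith

/-- A bound on the outcome in terms of a natural number of representative sets yields the bounds in
terms of a real number of representative sets that is at least as large. -/
theorem MeetsBounds.of_nat {ℓ n m z c N : ℕ} {N' F E : ℝ} {r : List ℕ × Cost} (hN : (N : ℝ) ≤ N')
    (hlt : ∀ v ∈ r.1, v < n) (hlen : r.1.length ≤ N * Γbound ℓ z)
    (hq : r.2.queries ≤ n * (N * Γbound ℓ z))
    (ht : (r.2.time : ℝ) ≤ N * (n * (Nat.clog 2 n + 1)) + E)
    (hE : E + 2 * (N * n) ≤ F * ((n + 1) * (m + 1) ^ c)) :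
    MeetsBounds ℓ n m z N' F 1 c r := by
  have hN0 : (0 : ℝ) ≤ N := Nat.cast_nonneg N
  have hΓ : (N : ℝ) * Γbound ℓ z ≤ N' * Γbound ℓ z :=
    mul_le_mul_of_nonneg_right hN (Nat.cast_nonneg _)
  refine ⟨hlt, ?_, ?_, ?_⟩
  · refine le_trans ?_ hΓ
    exact_mod_cast (card_outputSet_le n r.1).trans hlen
  · rw [Nat.cast_one, one_mul]
    refine le_trans ?_ (mul_le_mul_of_nonneg_left hΓ (Nat.cast_nonneg n))
    exact_mod_cast hq
  · have h1 : (N : ℝ) * (n * (Nat.clog 2 n + 1)) ≤ N * (n * Real.logb 2 n) + 2 * (N * n) := by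
      have := mul_le_mul_of_nonneg_left (mul_clog_add_one_le n) hN0
      linarith
    have h2 : 0 ≤ (n : ℝ) * Real.logb 2 n := by
      rcases Nat.eq_zero_or_pos n with rfl | hn
      · simp
      · exact mul_nonneg (Nat.cast_nonneg n)
          (Real.logb_nonneg (by norm_num) (by exact_mod_cast hn))
    have h3 := mul_le_mul_of_nonneg_right hN h2
    rw [Nat.cast_one, one_mul]
    linarith

theorem Γbound_one_left {z : ℕ} (hz : 1 ≤ z) : Γbound 1 z = z := by
  simp [Γbound]; omega

theorem Γbound_le_of_two_le {ℓ : ℕ} (hℓ : 2 ≤ ℓ) (z : ℕ) :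
    (Γbound ℓ z : ℝ) ≤ (ℓ : ℝ) / (ℓ - 1) * ℓ ^ ((z - 1) * ℓ) := by
  have h : (1 : ℝ) < ℓ := by exact_mod_cast (by omega : 1 < ℓ)
  rw [Γbound, Nat.cast_sum]
  simp only [Nat.cast_pow]
  rw [geom_sum_eq h.ne', div_mul_eq_mul_div, ← pow_succ']
  gcongr
  linarith

/-! ### Estimates for the number of representative sets -/

/-- In the exponential series at `z` the terms of index `z - 1` and `z` are equal, so twice the
latter is at most `exp z`. The factor two compensates for the rational approximation of `ln (1 /
ε)`. -/
theorem pow_div_factorial_le {z : ℕ} (hz : 1 ≤ z) :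
    2 * (z : ℝ) ^ z ≤ Real.exp z * z.factorial := by
  have h := Real.sum_le_exp_of_nonneg (Nat.cast_nonneg z : (0 : ℝ) ≤ z) (z + 1)
  obtain ⟨y, rfl⟩ : ∃ y, z = y + 1 := ⟨z - 1, by omega⟩
  rw [Finset.sum_range_succ, Finset.sum_range_succ] at h
  have h0 : 0 ≤ ∑ i ∈ Finset.range y, ((y + 1 : ℕ) : ℝ) ^ i / i.factorial :=
    Finset.sum_nonneg fun i _ => by positivity
  have e : ((y + 1 : ℕ) : ℝ) ^ y / y.factorial
      = ((y + 1 : ℕ) : ℝ) ^ (y + 1) / (y + 1).factorial := by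
    rw [Nat.factorial_succ, pow_succ, Nat.cast_mul]
    have : (y.factorial : ℝ) ≠ 0 := by positivity
    have : ((y + 1 : ℕ) : ℝ) ≠ 0 := by positivity
    field_simp
  rw [e] at h
  have hf : (0 : ℝ) < (y + 1).factorial := by positivity
  have h1 : 2 * (((y + 1 : ℕ) : ℝ) ^ (y + 1) / (y + 1).factorial) ≤ Real.exp ((y + 1 : ℕ) : ℝ) := by
    linarith
  calc 2 * ((y + 1 : ℕ) : ℝ) ^ (y + 1)
      = 2 * (((y + 1 : ℕ) : ℝ) ^ (y + 1) / (y + 1).factorial) * (y + 1).factorial := by field_simp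
    _ ≤ _ := mul_le_mul_of_nonneg_right h1 hf.le

/-- A real number is bounded by a nonnegative rational number of about the same size, whose
numerator and denominator cannot both be large. -/
theorem exists_div_approx (x : ℝ) : ∃ a b : ℕ, 1 ≤ b ∧ x ≤ (a : ℝ) / b ∧
    (a : ℝ) / b ≤ 2 * max 0 x ∧ (a : ℝ) + 1 ≤ 3 * max 1 x := by
  rcases le_or_gt x 0 with h0 | h0
  · refine ⟨0, 1, le_rfl, by simpa using h0, by simp, ?_⟩
    have := le_max_left 1 x
    push_cast; linarith
  rcases lt_or_ge x 1 with h1 | h1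
  -- For `0 < x < 1` the fraction is `1 / ⌊1 / x⌋`; since `1 / x ≥ 1`, rounding down loses at most a
  -- factor of two.
  · have hx : 1 ≤ x⁻¹ := (one_le_inv₀ h0).2 h1.le
    have hb : 1 ≤ ⌊x⁻¹⌋₊ := Nat.le_floor (by simpa using hx)
    have hb' : (1 : ℝ) ≤ ⌊x⁻¹⌋₊ := by exact_mod_cast hb
    have hle := Nat.floor_le (inv_pos.2 h0).le
    have hlt := Nat.lt_floor_add_one x⁻¹
    refine ⟨1, ⌊x⁻¹⌋₊, hb, ?_, ?_, ?_⟩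
    · rw [Nat.cast_one, le_div_iff₀ (by linarith)]
      calc x * ⌊x⁻¹⌋₊ ≤ x * x⁻¹ := mul_le_mul_of_nonneg_left hle h0.le
        _ = 1 := mul_inv_cancel₀ h0.ne'
    · rw [max_eq_right h0.le, Nat.cast_one, div_le_iff₀ (by linarith)]
      calc (1 : ℝ) = x * x⁻¹ := (mul_inv_cancel₀ h0.ne').symm
        _ ≤ x * (2 * ⌊x⁻¹⌋₊) := mul_le_mul_of_nonneg_left (by linarith) h0.le
        _ = _ := by ring
    · rw [max_eq_left h1.le]; norm_num
  -- For `x ≥ 1` the fraction is `⌈x⌉ / 1`, which is less than `x + 1 ≤ 2 * x`.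
  · have h := Nat.ceil_lt_add_one h0.le
    refine ⟨⌈x⌉₊, 1, le_rfl, by simpa using Nat.le_ceil x, ?_, ?_⟩
    · rw [max_eq_right h0.le]; simp; linarith
    · rw [max_eq_right h1]; linarith

/-- By `hN`, `N` is at most `4 ^ z` times the arithmetic mean of `z ^ z * a / (z! * b)` and `1`, and
both are at most the maximum in `randSets`: for the former, the factor two in `hab` is offset by
`pow_div_factorial_le`. -/
theorem le_randSets {z a b N : ℕ} {ε : ℝ} (hz : 1 ≤ z) (hb : 1 ≤ b)
    (hab : (a : ℝ) / b ≤ 2 * max 0 (Real.log ε⁻¹))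
    (hN : 2 * (N * (z.factorial * b)) ≤ 4 ^ z * (z ^ z * a + z.factorial * b)) :
    (N : ℝ) ≤ randSets z ε := by
  have hb' : (0 : ℝ) < b := by exact_mod_cast hb
  have hf : (0 : ℝ) < z.factorial := by positivity
  have hN' : 2 * ((N : ℝ) * (z.factorial * b)) ≤ 4 ^ z * (z ^ z * a + z.factorial * b) := by
    exact_mod_cast hN
  rw [div_le_iff₀ hb'] at hab
  have h1 : Real.exp z * max 0 (Real.log ε⁻¹) ≤ max 1 (Real.exp z * Real.log ε⁻¹) := by
    rcases le_total 0 (Real.log ε⁻¹) with h | h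
    · rw [max_eq_right h]; exact le_max_right _ _
    · rw [max_eq_left h, mul_zero]; exact zero_le_one.trans (le_max_left _ _)
  have h2 : (z : ℝ) ^ z * a ≤ max 1 (Real.exp z * Real.log ε⁻¹) * (z.factorial * b) := by
    calc (z : ℝ) ^ z * a ≤ z ^ z * (2 * max 0 (Real.log ε⁻¹) * b) :=
          mul_le_mul_of_nonneg_left hab (by positivity)
      _ = 2 * z ^ z * (max 0 (Real.log ε⁻¹) * b) := by ring
      _ ≤ Real.exp z * z.factorial * (max 0 (Real.log ε⁻¹) * b) :=
          mul_le_mul_of_nonneg_right (pow_div_factorial_le hz) (by positivity)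
      _ = Real.exp z * max 0 (Real.log ε⁻¹) * (z.factorial * b) := by ring
      _ ≤ _ := mul_le_mul_of_nonneg_right h1 (by positivity)
  have h3 : (z.factorial : ℝ) * b ≤ max 1 (Real.exp z * Real.log ε⁻¹) * (z.factorial * b) :=
    le_mul_of_one_le_left (by positivity) (le_max_left _ _)
  have h4 := hN'.trans (mul_le_mul_of_nonneg_left (add_le_add h2 h3) (by positivity))
  refine le_of_mul_le_mul_right ?_ (mul_pos hf hb')
  rw [randSets]
  linarith

/-- Replacing `exp z` by `3 ^ z` makes the factor a natural number that is computable from `z`, so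
it can be part of `timeFactor`. -/
theorem randSets_le (z : ℕ) (ε : ℝ) : randSets z ε ≤ 12 ^ z * max 1 (Real.log ε⁻¹) := by
  have he : Real.exp z ≤ 3 ^ z := by
    rw [← Real.exp_one_pow]
    exact pow_le_pow_left₀ (Real.exp_pos _).le (Real.exp_one_lt_d9.le.trans (by norm_num)) _
  have h3 : (1 : ℝ) ≤ 3 ^ z := one_le_pow₀ (by norm_num)
  have hm := le_max_left 1 (Real.log ε⁻¹)
  have h : max 1 (Real.exp z * Real.log ε⁻¹) ≤ 3 ^ z * max 1 (Real.log ε⁻¹) := by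
    refine max_le (one_le_mul_of_one_le_of_one_le h3 hm) ?_
    calc Real.exp z * Real.log ε⁻¹ ≤ Real.exp z * max 1 (Real.log ε⁻¹) :=
          mul_le_mul_of_nonneg_left (le_max_right _ _) (Real.exp_pos _).le
      _ ≤ _ := mul_le_mul_of_nonneg_right he (by linarith)
  calc randSets z ε ≤ 4 ^ z * (3 ^ z * max 1 (Real.log ε⁻¹)) :=
        mul_le_mul_of_nonneg_left h (by positivity)
    _ = _ := by rw [← mul_assoc, ← mul_pow]; norm_num

/-- The family has `O(2 ^ z * k * z)` members for `k = O(L * z ^ 2)` moduli, so the product is `O(2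
^ z * z ^ 6 * L ^ 2)`, and `L` is at most three times the logarithm. -/
theorem le_detSets {z m L : ℕ} (hz : 1 ≤ z) (hL1 : 1 ≤ L) (hL : 2 ^ L ≤ 4 * max m 2) :
    ((moduli L z * ((coverFamily z (moduli L z)).length * z) : ℕ) : ℝ) ≤ detSets 20 z m := by
  have hm : (0 : ℝ) < (max m 2 : ℕ) := by positivity
  set t := Real.logb 2 (max m 2 : ℕ) with ht
  have ht1 : 1 ≤ t := by
    rw [ht, Real.le_logb_iff_rpow_le (by norm_num) hm, Real.rpow_one]
    exact_mod_cast le_max_right m 2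
  have hLt : (L : ℝ) ≤ 3 * t := by
    have : (L : ℝ) - 2 ≤ t := by
      rw [ht, Real.le_logb_iff_rpow_le (by norm_num) hm, Real.rpow_sub (by norm_num),
        Real.rpow_natCast]
      rw [div_le_iff₀ (by positivity), show (2 : ℝ) ^ (2 : ℝ) = 4 by norm_num, mul_comm _ (4 : ℝ)]
      exact_mod_cast hL
    linarith
  have hk : moduli L z ≤ 5 * (L * (z * z)) := by
    have : 1 ≤ L * (z * z) := Nat.mul_pos hL1 (Nat.mul_pos hz hz)
    rw [moduli]; omega
  have hF : (coverFamily z (moduli L z)).length ≤ 3 * 2 ^ z * (moduli L z * z) := by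
    have h := length_coverFamily_moduli_le z L
    have h1 : 1 ≤ moduli L z * z := Nat.mul_pos (by rw [moduli]; omega) hz
    have h2 : 1 ≤ 2 ^ z * (moduli L z * z) := Nat.mul_pos (by positivity) h1
    have e : 2 ^ z * (2 * moduli L z * z) = 2 * (2 ^ z * (moduli L z * z)) := by ring
    have e2 : 3 * 2 ^ z * (moduli L z * z) = 3 * (2 ^ z * (moduli L z * z)) := by ring
    omega
  have hN : moduli L z * ((coverFamily z (moduli L z)).length * z) ≤ 75 * 2 ^ (7 * z) * L ^ 2 := by
    calc moduli L z * ((coverFamily z (moduli L z)).length * z)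
        ≤ moduli L z * (3 * 2 ^ z * (moduli L z * z) * z) :=
          Nat.mul_le_mul_left _ (Nat.mul_le_mul_right _ hF)
      _ = 3 * 2 ^ z * z ^ 2 * (moduli L z * moduli L z) := by ring
      _ ≤ 3 * 2 ^ z * z ^ 2 * ((5 * (L * (z * z))) * (5 * (L * (z * z)))) :=
          Nat.mul_le_mul_left _ (Nat.mul_le_mul hk hk)
      _ = 75 * (2 ^ z * z ^ 6) * L ^ 2 := by ring
      _ ≤ 75 * (2 ^ z * (2 ^ z) ^ 6) * L ^ 2 := by
          refine Nat.mul_le_mul_right _ (Nat.mul_le_mul_left _ (Nat.mul_le_mul_left _ ?_))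
          exact Nat.pow_le_pow_left Nat.lt_two_pow_self.le _
      _ = _ := by rw [← pow_mul, ← pow_add]; congr 3; ring
  -- The constant is `75 * 3 ^ 2`. Absorbing it into `2 ^ (13 * z)` yields the exponent `20 = 7 +
  -- 13`.
  have h675 : (675 : ℝ) ≤ 2 ^ (13 * z) :=
    le_trans (by norm_num : (675 : ℝ) ≤ 2 ^ 13)
      (pow_le_pow_right₀ (by norm_num) (by omega))
  calc ((moduli L z * ((coverFamily z (moduli L z)).length * z) : ℕ) : ℝ)
      ≤ 75 * 2 ^ (7 * z) * (L : ℝ) ^ 2 := by exact_mod_cast hN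
    _ ≤ 75 * 2 ^ (7 * z) * (3 * t) ^ 2 := by gcongr
    _ = 675 * (2 ^ (7 * z) * t ^ 2) := by ring
    _ ≤ 2 ^ (13 * z) * (2 ^ (7 * z) * t ^ 2) := by gcongr
    _ = detSets 20 z m := by
        rw [detSets, ← ht, ← mul_assoc, ← pow_add]; congr 2; ring

/-! ### Computability of the factor that depends on the parameters -/

theorem primrec₂_pow : Primrec₂ (fun a b : ℕ => a ^ b) := by
  have h : Primrec₂ fun a b : ℕ => (Nat.rec (motive := fun _ => ℕ) 1 (fun _ r => r * a) b : ℕ) :=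
    Primrec.nat_rec (Primrec.const 1)
      (Primrec.nat_mul.comp (Primrec.snd.comp Primrec.snd) Primrec.fst).to₂
  refine h.of_eq fun a b => ?_
  induction b with
  | zero => rfl
  | succ b ih => rw [pow_succ, ← ih]

/-- The factor of the running time that depends on the parameters only. -/
def timeFactor (ℓ z : ℕ) : ℕ :=
  detBound ℓ z + (3 * (4 ^ z * (z ^ z + 1) * (Prog.mainBound ℓ z + Prog.setupBound z + 600 * z + 500))
    + 2 * 12 ^ z)

theorem computable₂_timeFactor : Computable₂ timeFactor := by
  have add : ∀ {f g : ℕ × ℕ → ℕ}, Primrec f → Primrec g → Primrec fun x => f x + g x :=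
    fun hf hg => Primrec.nat_add.comp hf hg
  have mul : ∀ {f g : ℕ × ℕ → ℕ}, Primrec f → Primrec g → Primrec fun x => f x * g x :=
    fun hf hg => Primrec.nat_mul.comp hf hg
  have pow : ∀ {f g : ℕ × ℕ → ℕ}, Primrec f → Primrec g → Primrec fun x => f x ^ g x :=
    fun hf hg => primrec₂_pow.comp hf hg
  have cst : ∀ k : ℕ, Primrec fun _ : ℕ × ℕ => k := fun k => Primrec.const k
  have hl : Primrec fun x : ℕ × ℕ => x.1 := Primrec.fst
  have hz : Primrec fun x : ℕ × ℕ => x.2 := Primrec.snd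
  have hmain : Primrec fun x : ℕ × ℕ => Prog.mainBound x.1 x.2 := by
    unfold Prog.mainBound
    exact add (add (mul (cst _) (mul (pow (add hl (cst 1)) (add (mul hz hl) (cst 2)))
      (pow (add (mul hz hl) (cst 1)) (cst 2)))) (mul (cst _) hz)) (cst _)
  have hsetup : Primrec fun x : ℕ × ℕ => Prog.setupBound x.2 := by
    unfold Prog.setupBound
    exact mul (cst _) (mul (add (pow hz hz) (cst 1)) (pow (add hz (cst 1)) (cst 2)))
  have hdet : Primrec fun x : ℕ × ℕ => detBound x.1 x.2 := by
    unfold detBound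
    exact add (add (mul (cst _) (mul (add hz (cst 1)) (pow (mul (cst _) (pow (add hz (cst 1)) (cst 3)))
      (add (mul (cst 2) hz) (cst 1))))) (mul (mul (pow (cst 2) hz) (pow (add hz (cst 1)) (cst 6)))
      (add (add (cst _) (mul (cst _) hmain)) (cst _)))) (cst _)
  have : Primrec fun x : ℕ × ℕ => timeFactor x.1 x.2 := by
    unfold timeFactor
    exact add hdet (add (mul (cst 3) (mul (mul (pow (cst 4) hz) (add (pow hz hz) (cst 1)))
      (add (add (add hmain hsetup) (mul (cst _) hz)) (cst _)))) (mul (cst 2) (pow (cst 12) hz)))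
  exact this.to_comp

/-! ### Both algorithms meet the bounds -/

theorem meetsBounds_randP {ℓ z n m s : ℕ} (I : CoverageInstance ℓ n m s) (hz : 1 ≤ z) {ε : ℝ}
    {a b : ℕ} (hb : 1 ≤ b) (hab : (a : ℝ) / b ≤ 2 * max 0 (Real.log ε⁻¹))
    (ha : (a : ℝ) + 1 ≤ 3 * max 1 (Real.log ε⁻¹)) {r : List ℕ × Cost}
    (hr : r ∈ (I.exec (Prog.randP a b) z).support) :
    MeetsBounds ℓ n m z (randSets z ε) (timeFactor ℓ z * max 1 (Real.log ε⁻¹)) 1 20 r := by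
  obtain ⟨N, hN, hlt, hlen, hq, ht⟩ := Prog.randP_outcome I z a b hb hz hr
  have hNε := le_randSets hz hb hab hN
  refine MeetsBounds.of_nat (E := (((a + 1) * (4 ^ z * (z ^ z + 1) * ((n + 1) * (m + 1) ^ 2 *
    (Prog.mainBound ℓ z + Prog.setupBound z + 600 * z + 500))) : ℕ) : ℝ))
    hNε hlt hlen hq (by exact_mod_cast ht) ?_
  have hM : (1 : ℝ) ≤ max 1 (Real.log ε⁻¹) := le_max_left _ _
  have hN2 := hNε.trans (randSets_le z ε)
  generalize max 1 (Real.log ε⁻¹) = M at *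
  obtain ⟨D, hD⟩ : ∃ D, D = Prog.mainBound ℓ z + Prog.setupBound z + 600 * z + 500 := ⟨_, rfl⟩
  rw [← hD]
  have hpow : ((m : ℝ) + 1) ^ 2 ≤ (m + 1) ^ 20 :=
    pow_le_pow_right₀ (by linarith [(Nat.cast_nonneg m : (0 : ℝ) ≤ m)]) (by norm_num)
  have hpow1 : (1 : ℝ) ≤ ((m : ℝ) + 1) ^ 20 :=
    one_le_pow₀ (by linarith [(Nat.cast_nonneg m : (0 : ℝ) ≤ m)])
  have h1 : ((a : ℝ) + 1) * (4 ^ z * (z ^ z + 1) * ((n + 1) * (m + 1) ^ 2 * D))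
      ≤ 3 * M * (4 ^ z * (z ^ z + 1) * ((n + 1) * (m + 1) ^ 20 * D)) :=
    mul_le_mul ha (mul_le_mul_of_nonneg_left (mul_le_mul_of_nonneg_right
      (mul_le_mul_of_nonneg_left hpow (by positivity)) (Nat.cast_nonneg D)) (by positivity))
      (by positivity) (by positivity)
  have h2 : 2 * ((N : ℝ) * n) ≤ 2 * ((12 ^ z * M) * ((n + 1) * (m + 1) ^ 20)) := by
    have : (n : ℝ) ≤ (n + 1) * (m + 1) ^ 20 :=
      (by linarith : (n : ℝ) ≤ n + 1).trans (le_mul_of_one_le_right (by positivity) hpow1)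
    gcongr
  have h3 : 0 ≤ (detBound ℓ z : ℝ) * M * ((n + 1) * (m + 1) ^ 20) := by positivity
  have e : (timeFactor ℓ z : ℝ) * M * ((n + 1) * (m + 1) ^ 20)
      = (detBound ℓ z : ℝ) * M * ((n + 1) * (m + 1) ^ 20)
        + 3 * M * (4 ^ z * (z ^ z + 1) * ((n + 1) * (m + 1) ^ 20 * D))
        + 2 * ((12 ^ z * M) * ((n + 1) * (m + 1) ^ 20)) := by
    rw [timeFactor, ← hD]
    push_cast
    ring
  rw [e]
  push_cast at h1 ⊢
  linarith

theorem meetsBounds_detP {ℓ z n m s : ℕ} (I : CoverageInstance ℓ n m s) (hz : 1 ≤ z)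
    {r : List ℕ × Cost} (hr : r ∈ (I.exec Prog.detP z).support) :
    MeetsBounds ℓ n m z (detSets 20 z m) (timeFactor ℓ z) 1 20 r ∧
      I.IsKernel z (CoverageInstance.outputSet n r.1) := by
  obtain ⟨L, N, hL1, hL, hN, hlt, hlen, hq, ht, hker⟩ := Prog.detP_outcome I z hz hr
  refine ⟨?_, hker⟩
  have ht' : (r.2.time : ℝ) + 2 * (N * n)
      ≤ N * (n * (Nat.clog 2 n + 1)) + detBound ℓ z * ((n + 1) * (m + 1) ^ 4) := by
    exact_mod_cast ht
  refine MeetsBounds.of_nat (E := detBound ℓ z * ((n + 1) * (m + 1) ^ 4) - 2 * (N * n))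
    (hN ▸ le_detSets hz hL1 hL) hlt hlen hq (by linarith) ?_
  have hle : (detBound ℓ z : ℝ) ≤ timeFactor ℓ z := by
    exact_mod_cast Nat.le_add_right _ _
  have hpow : ((m : ℝ) + 1) ^ 4 ≤ (m + 1) ^ 20 :=
    pow_le_pow_right₀ (by linarith [(Nat.cast_nonneg m : (0 : ℝ) ≤ m)]) (by norm_num)
  rw [sub_add_cancel]
  gcongr

theorem theorem6 :
    ∃ (f : ℕ → ℕ → ℕ) (C c : ℕ), Computable₂ f ∧
      -- randomized algorithms
      (∀ ε : ℝ, 0 < ε → ∃ P : Prog CoverageInstance.inputTy (.list .nat),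
        ∀ (ℓ z n m s : ℕ) (I : CoverageInstance ℓ n m s), 1 ≤ z →
          (∀ r ∈ (I.exec P z).support,
            MeetsBounds ℓ n m z (randSets z ε) (f ℓ z * max 1 (Real.log ε⁻¹)) C c r) ∧
          ENNReal.ofReal (1 - ε) ≤ (I.exec P z).toOuterMeasure
            {r | I.IsKernel z (CoverageInstance.outputSet n r.1)}) ∧
      -- a deterministic algorithm
      (∃ P : Prog CoverageInstance.inputTy (.list .nat), P.Deterministic ∧
        ∀ (ℓ z n m s : ℕ) (I : CoverageInstance ℓ n m s), 1 ≤ z →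
          ∀ r ∈ (I.exec P z).support,
            MeetsBounds ℓ n m z (detSets c z m) (f ℓ z) C c r ∧
            I.IsKernel z (CoverageInstance.outputSet n r.1)) ∧
      -- the explicit form of the factor `Γ_{ℓ,z}`
      (∀ z : ℕ, 1 ≤ z → Γbound 1 z = z ∧
        ∀ ℓ : ℕ, 2 ≤ ℓ → (Γbound ℓ z : ℝ) ≤ (ℓ : ℝ) / (ℓ - 1) * ℓ ^ ((z - 1) * ℓ)) := by
  -- The constant `20` is dictated by the exponent in `detSets`; as a power of `m + 1` in the
  -- running time, `2` and `4` are what the two algorithms need.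
  refine ⟨timeFactor, 1, 20, computable₂_timeFactor, fun ε hε => ?_, ?_, fun z hz =>
    ⟨Γbound_one_left hz, fun ℓ hℓ => Γbound_le_of_two_le hℓ z⟩⟩
  -- The real number `ε` enters the program only through the constants `a` and `b`, which are chosen
  -- before the instance.
  · obtain ⟨a, b, hb, hle, hab, ha⟩ := exists_div_approx (Real.log ε⁻¹)
    exact ⟨Prog.randP a b, fun ℓ z n m s I hz =>
      ⟨fun r hr => meetsBounds_randP I hz hb hab ha hr,
        Prog.le_toOuterMeasure_randP I z a b hb hz hε hle⟩⟩
  · exact ⟨Prog.detP, Prog.deterministic_of_isDet Prog.detP_isDet, fun ℓ z n m s I hz r hr =>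
      meetsBounds_detP I hz hr⟩
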